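/- Let $W$ be a separable real Banach space, $V$ a real Hilbert space, $T>0$, and let $A$ generate an analytic, exponentially stable $C_0$-semigroup $(S(t))_{t\ge 0}$ on $W$. For $\gamma>0$ let $D_\gamma=D((-A)^\gamma)$ with norm $|x|_{D_\gamma}=|(-A)^\gamma x|$, where $(-A)^{-\gamma}=\Gamma(\gamma)^{-1}\int_0^\infty t^{\gamma-1}S(t)\,dt$; for $K\in\mathcal L(V,D_\gamma)$ let $|K|_{D_\gamma}$ be its operator norm. The spaces $V\otimes V$ and $W\otimes V$ are the completions of the algebraic tensor products for fixed crossnorms such that $K\otimes \mathrm{Id}\colon V\otimes V\to W\otimes V$ has norm at most $|K|$ for every $K\in\mathcal L(V,W)$ (for example the projective norms or, if $W$ is a Hilbert space, the Hilbert tensor norms). For $E\in\mathcal L(W\otimes V,W)$, $x\in W$, $K\in\mathcal L(V,W)$ write $Ex\in\mathcal L(V,W)$, $(Ex)v=E(x\otimes v)$, and $EK=E\circ(K\otimes\mathrm{Id})\in\mathcal L(V\otimes V,W)$. Let $\alpha\le 1/2$, $\alpha+2\beta>1$ and $\alpha>\beta$. Let $(\omega,\omega^{(2)})$ be an $\alpha$-Hölder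 rough path on $[0,T]$: for $0\le s\le r\le t\le T$ and some constant $M$, $|\omega_t-\omega_s|\le M(t-s)^\alpha$ in $V$, $|\omega^{(2)}_{ts}|\le M(t-s)^{2\alpha}$ in $V\otimes V$, and $\omega^{(2)}_{ts}-\omega^{(2)}_{rs}-\omega^{(2)}_{tr}=(\omega_r-\omega_s)\otimes(\omega_t-\omega_r)$. Write $(\delta\omega)_{ts}=\omega_t-\omega_s$, $|||\omega|||_\alpha=\sup_{s<t}|(\delta\omega)_{ts}|/(t-s)^\alpha$, $\|\omega^{(2)}\|_{2\alpha}=\sup_t|\omega^{(2)}_{t0}|+\sup_{s<t}|\omega^{(2)}_{ts}|/(t-s)^{2\alpha}$, $\tilde\omega_{ts}=(\delta\omega)_{ts}\otimes(\delta\omega)_{ts}-\omega^{(2)}_{ts}$, $(\hat\delta y)_{ts}=y_t-S(t-s)y_s$ and $(\hat\delta_2z)_{t\tau s}=z_{ts}-z_{t\tau}-S(t-\tau)z_{\tau s}$. For $s\le\tau\le t$ put $$\omega^S_{ts}(K)=S(t-s)K(\delta\omega)_{ts}-\int_s^tAS(t-r)K(\delta\omega)_{tr}\,dr,$$ $$a_{ts}(E,x)=\omega^S_{ts}(Ex)+\int_s^t\omega^S_{tr}(EAS(r-s)x)\,dr\quad\text{(improper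 at }r=s),$$ $$c_{ts}(E,K)=\omega^S_{ts}(EK(\delta\omega)_{ts})-S(t-s)EK\tilde\omega_{ts}+\int_s^tAS(t-r)EK\tilde\omega_{tr}\,dr,$$ $$\Xi^{(b),s}_{t\tau}(E,K)=\omega^S_{t\tau}(E\,\omega^S_{\tau s}(K))+c_{t\tau}(E,K).$$ (In the second term $E$ is contracted with the vector $\omega^S_{\tau s}(K)\in W$; in $EK(\delta\omega)_{ts}$, with the vector $K(\delta\omega)_{ts}\in W$.) Then for all $E\in\mathcal L(W\otimes V,W)$, $K\in\mathcal L(V,D_\beta)$ and $s\in[0,T]$ there is exactly one continuous $y=\mathcal I\Xi^{(b),s}(E,K)\colon[s,T]\to W$ such that $y_s=0$ and, for some constant $c$ and all $s\le u\le v\le T$, $$|(\hat\delta y)_{vu}|\le c(v-u)^{\alpha},\qquad |(\hat\delta y)_{vu}-\Xi^{(b),s}_{vu}(E,K)|\le c(v-u)^{\alpha+2\beta}.$$ Put $b_{ts}(E,K)=(\hat\delta\,\mathcal I\Xi^{(b),s}(E,K))_{ts}$. Each $b_{ts}$ is bilinear, and: (i) There is a constant $C$, depending only on $W$, $S$, $T$,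 $\alpha$, $\beta$, such that for all $0\le s\le t\le T$ $$|b_{ts}(E,K)|\le C\,|E|\,|K|_{D_\beta}\bigl(|||\omega|||_\alpha^2+\|\omega^{(2)}\|_{2\alpha}\bigr)(t-s)^{2\alpha}.$$ (ii) Let $\omega^n$ be primitives on $[0,T]$ of bounded strongly measurable $V$-valued functions (e.g. piecewise linear or $C^1$ paths), $\omega^{(2),n}_{ts}=\int_s^t(\omega^n_r-\omega^n_s)\otimes d\omega^n_r$, and suppose that $$\sup_{s<t}\frac{|(\delta\omega^n)_{ts}-(\delta\omega)_{ts}|}{(t-s)^\alpha}+\sup_{s<t}\frac{|\omega^{(2),n}_{ts}-\omega^{(2)}_{ts}|}{(t-s)^{2\alpha}}\to0.$$ Then $b^n_{ts}(E,K)=\int_s^tS(t-r)E\int_s^rS(r-q)K\,d\omega^n_q\,d\omega^n_r$ belongs to $C^{2\alpha}([0,T],\mathcal L(\mathcal L(W\otimes V,W)\times\mathcal L(V,D_\beta),W))$ (bounded bilinear maps) and converges to $b$ in this space. (iii) For all $0\le s\le\tau\le t\le T$: $\;(\hat\delta_2b)_{t\tau s}(E,K)=a_{t\tau}(E,\omega^S_{\tau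 s}(K))$. -/

import Mathlib

open MeasureTheory Set Filter Topology TensorProduct

universe u v

noncomputable section

namespace RoughEvolution

/-! ### Analytic semigroups, generators and fractional powers -/

section Semigroup

variable {W : Type u} [NormedAddCommGroup W] [NormedSpace ℝ W]

/-- The open sector of half-angle `θ` around the positive real axis. -/
def sector (θ : ℝ) : Set ℂ := {z : ℂ | z ≠ 0 ∧ |z.arg| < θ}

/-- `S` (used at times `t ≥ 0` only) is an analytic `C₀`-semigroup on the real Banach space `W`:
a strongly continuous semigroup which extends holomorphically to a sector. The extension takes
its values in the operators of the complexification of `W`; it is written as `P + iQ` with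
operators `P z`, `Q z` of `W`, and holomorphy is real differentiability (in operator norm)
together with the Cauchy-Riemann equations, the complex derivative being `P' + iQ'`. As usual
the extension is strongly continuous at `0` within the sector. -/
structure IsAnalyticSemigroup (S : ℝ → W →L[ℝ] W) : Prop where
  map_zero : S 0 = ContinuousLinearMap.id ℝ W
  map_add : ∀ s t : ℝ, 0 ≤ s → 0 ≤ t → S (s + t) = S s ∘L S t
  strong_cont : ∀ x : W, ContinuousOn (fun t : ℝ => S t x) (Ici 0)
  holomorphic : ∃ θ : ℝ, 0 < θ ∧ θ ≤ Real.pi / 2 ∧ ∃ P Q : ℂ → W →L[ℝ] W,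
    (∀ t : ℝ, 0 < t → P (t : ℂ) = S t ∧ Q (t : ℂ) = 0) ∧
    (∀ z ∈ sector θ, ∃ P' Q' : W →L[ℝ] W,
      HasFDerivAt P (Complex.reCLM.smulRight P' - Complex.imCLM.smulRight Q') z ∧
      HasFDerivAt Q (Complex.reCLM.smulRight Q' + Complex.imCLM.smulRight P') z) ∧
    (∀ x : W, Tendsto (fun z => P z x) (𝓝[sector θ] 0) (𝓝 x) ∧
      Tendsto (fun z => Q z x) (𝓝[sector θ] 0) (𝓝 0))

/-- Exponential stability: `‖S(t)‖ ≤ M e^{-δt}` for all `t ≥ 0`, with some `δ > 0`. -/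
def IsExpStable (S : ℝ → W →L[ℝ] W) : Prop :=
  ∃ M δ : ℝ, 0 < δ ∧ ∀ t : ℝ, 0 ≤ t → ‖S t‖ ≤ M * Real.exp (-(δ * t))

/-- The generator `A x = lim_{h ↓ 0} (S(h)x - x)/h` (meaningful for `x` in the domain of `A`;
below it is only applied to vectors `S(t)x` with `t > 0`, and at the end point `S(0)x` of an
integral). -/
def gen (S : ℝ → W →L[ℝ] W) (x : W) : W :=
  limUnder (𝓝[>] (0 : ℝ)) (fun h : ℝ => h⁻¹ • (S h x - x))

/-- `(-A)^{-γ} x = Γ(γ)⁻¹ ∫₀^∞ t^{γ-1} S(t)x dt`, for `γ > 0`. -/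
def negFracPow (S : ℝ → W →L[ℝ] W) (γ : ℝ) (x : W) : W :=
  (Real.Gamma γ)⁻¹ • ∫ t in Ioi (0 : ℝ), t ^ (γ - 1) • S t x

/-- `D_γ = D((-A)^γ)`, the range of `(-A)^{-γ}`. -/
def fracDomain (S : ℝ → W →L[ℝ] W) (γ : ℝ) : Set W := range (negFracPow S γ)

/-- `(-A)^γ` on `D_γ`, the inverse of `(-A)^{-γ}`. The norm of `D_γ` is `‖(-A)^γ x‖`. -/
def fracPow (S : ℝ → W →L[ℝ] W) (γ : ℝ) : W → W := Function.invFun (negFracPow S γ)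

variable {V : Type v} [NormedAddCommGroup V] [NormedSpace ℝ V]

/-- `K ∈ L(V, D_γ)`. -/
def MapsIntoDomain (S : ℝ → W →L[ℝ] W) (γ : ℝ) (K : V →L[ℝ] W) : Prop :=
  (∀ v, K v ∈ fracDomain S γ) ∧ ∃ M : ℝ, ∀ v, ‖fracPow S γ (K v)‖ ≤ M * ‖v‖

/-- The operator norm `|K|_{D_γ}` of `K ∈ L(V, D_γ)`. -/
def domainOpNorm (S : ℝ → W →L[ℝ] W) (γ : ℝ) (K : V →L[ℝ] W) : ℝ :=
  sInf {M : ℝ | 0 ≤ M ∧ ∀ v, ‖fracPow S γ (K v)‖ ≤ M * ‖v‖}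

/-- `(δ̂ y)_{ts} = y_t - S(t-s) y_s`. -/
def hatDelta (S : ℝ → W →L[ℝ] W) (y : ℝ → W) (t s : ℝ) : W := y t - S (t - s) (y s)

/-- `(δ̂₂ z)_{tτs} = z_{ts} - z_{tτ} - S(t-τ) z_{τs}`. -/
def hatDelta₂ (S : ℝ → W →L[ℝ] W) (z : ℝ → ℝ → W) (t τ s : ℝ) : W :=
  z t s - z t τ - S (t - τ) (z τ s)

/-- `y : [s₀,T] → W` is the path that the sewing lemma produces from the approximation term
`Ξ_{ts}`, `s₀ ≤ s ≤ t ≤ T`: it is continuous, vanishes at `s₀`, and satisfies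
`|(δ̂y)_{ts}| ≤ C (t-s)^κ` and `|(δ̂y)_{ts} - Ξ_{ts}| ≤ C (t-s)^ρ`. -/
def IsSewing (S : ℝ → W →L[ℝ] W) (Ξ : ℝ → ℝ → W) (s₀ T κ ρ : ℝ) (y : ℝ → W) : Prop :=
  ContinuousOn y (Icc s₀ T) ∧ y s₀ = 0 ∧
  ∃ C : ℝ, ∀ s t : ℝ, s₀ ≤ s → s ≤ t → t ≤ T →
    ‖hatDelta S y t s‖ ≤ C * (t - s) ^ κ ∧ ‖hatDelta S y t s - Ξ t s‖ ≤ C * (t - s) ^ ρ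

/-- The sewing map `Ξ ↦ 𝓘Ξ`. -/
def sew (S : ℝ → W →L[ℝ] W) (Ξ : ℝ → ℝ → W) (s₀ T κ ρ : ℝ) : ℝ → W :=
  Classical.epsilon (IsSewing S Ξ s₀ T κ ρ)

end Semigroup

/-! ### Completed tensor products -/

section Tensor

/-- A vector space `X`, seminormed by `p`. -/
def SeminormedBy {X : Type*} [AddCommGroup X] [Module ℝ X] (_ : Seminorm ℝ X) : Type _ := X

instance {X : Type*} [AddCommGroup X] [Module ℝ X] (p : Seminorm ℝ X) :
    SeminormedAddCommGroup (SeminormedBy p) :=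
  p.toAddGroupSeminorm.toSeminormedAddCommGroup

instance {X : Type*} [AddCommGroup X] [Module ℝ X] (p : Seminorm ℝ X) :
    NormedSpace ℝ (SeminormedBy p) :=
  { (inferInstance : Module ℝ X) with
    norm_smul_le := fun c x => (map_smul_eq_mul p c x).le }

/-- The Banach space obtained by completing `(X, p)`. -/
abbrev CompletionOf {X : Type*} [AddCommGroup X] [Module ℝ X] (p : Seminorm ℝ X) : Type _ :=
  UniformSpace.Completion (SeminormedBy p)

/-- The norms by which `V ⊗ V` and `W ⊗ V` are completed. Both are crossnorms on the algebraic
tensor product, and `K ⊗ Id : V ⊗ V → W ⊗ V` has norm at most `‖K‖` for every `K ∈ L(V, W)`.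
Examples are the projective norms and, when `V` and `W` are Hilbert spaces, the Hilbert space
tensor norms. -/
structure TensorNorms (V : Type v) (W : Type u) [NormedAddCommGroup V] [NormedSpace ℝ V]
    [NormedAddCommGroup W] [NormedSpace ℝ W] where
  normVV : Seminorm ℝ (V ⊗[ℝ] V)
  normWV : Seminorm ℝ (W ⊗[ℝ] V)
  normVV_tmul : ∀ v w : V, normVV (v ⊗ₜ[ℝ] w) = ‖v‖ * ‖w‖
  normWV_tmul : ∀ (x : W) (v : V), normWV (x ⊗ₜ[ℝ] v) = ‖x‖ * ‖v‖
  map_le : ∀ (K : V →L[ℝ] W) (z : V ⊗[ℝ] V),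
    normWV (TensorProduct.map (K : V →ₗ[ℝ] W) LinearMap.id z) ≤ ‖K‖ * normVV z

namespace TensorNorms

variable {V : Type v} {W : Type u} [NormedAddCommGroup V] [NormedSpace ℝ V]
  [NormedAddCommGroup W] [NormedSpace ℝ W]

/-- The completed tensor product `V ⊗ V`. -/
abbrev VV (N : TensorNorms V W) : Type _ := CompletionOf N.normVV

/-- The completed tensor product `W ⊗ V`. -/
abbrev WV (N : TensorNorms V W) : Type _ := CompletionOf N.normWV

/-- The elementary tensor `v ⊗ w` in the completed `V ⊗ V`. -/
def tmulVV (N : TensorNorms V W) (v w : V) : N.VV :=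
  ((show SeminormedBy N.normVV from v ⊗ₜ[ℝ] w : SeminormedBy N.normVV) : N.VV)

/-- `x ↦ (v ↦ x ⊗ v)`, with values in the completed `W ⊗ V`. -/
def tmulWV (N : TensorNorms V W) : W →L[ℝ] V →L[ℝ] N.WV :=
  LinearMap.mkContinuous₂
    ((TensorProduct.mk ℝ W V).compr₂
      (show W ⊗[ℝ] V →ₗ[ℝ] N.WV from
        (UniformSpace.Completion.toComplL (𝕜 := ℝ) (E := SeminormedBy N.normWV)).toLinearMap))
    1 (fun x v => by
      have h := UniformSpace.Completion.norm_coe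
        (show SeminormedBy N.normWV from x ⊗ₜ[ℝ] v)
      have h2 := N.normWV_tmul x v
      rw [one_mul]
      exact (h.trans h2).le)

/-- `K ⊗ Id` on the algebraic tensor product, as a bounded operator. -/
def mapIdAlg (N : TensorNorms V W) (K : V →L[ℝ] W) :
    SeminormedBy N.normVV →L[ℝ] SeminormedBy N.normWV :=
  LinearMap.mkContinuous
    (show SeminormedBy N.normVV →ₗ[ℝ] SeminormedBy N.normWV from
      TensorProduct.map (K : V →ₗ[ℝ] W) LinearMap.id)
    ‖K‖ (fun z => N.map_le K z)

/-- `K ⊗ Id : V ⊗ V → W ⊗ V` on the completed tensor products. -/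
def mapId (N : TensorNorms V W) (K : V →L[ℝ] W) : N.VV →L[ℝ] N.WV :=
  ((UniformSpace.Completion.toComplL (𝕜 := ℝ) (E := SeminormedBy N.normWV)) ∘L
      N.mapIdAlg K).extend
    (UniformSpace.Completion.toComplL (𝕜 := ℝ) (E := SeminormedBy N.normVV))

end TensorNorms

end Tensor

/-! ### Rough paths -/

section RoughPaths

/-- `|||ω|||_α = sup_{0 ≤ s < t ≤ T} |ω_t - ω_s| / (t-s)^α`. -/
def holderSeminorm {X : Type*} [NormedAddCommGroup X] (T α : ℝ) (ω : ℝ → X) : ℝ :=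
  ⨆ p : {p : ℝ × ℝ // 0 ≤ p.2 ∧ p.2 < p.1 ∧ p.1 ≤ T},
    ‖ω p.1.1 - ω p.1.2‖ / (p.1.1 - p.1.2) ^ α

/-- `‖z‖_γ = sup_{0 ≤ t ≤ T} |z_{t0}| + sup_{0 ≤ s < t ≤ T} |z_{ts}| / (t-s)^γ`. -/
def holderNorm₂ {X : Type*} [NormedAddCommGroup X] (T γ : ℝ) (z : ℝ → ℝ → X) : ℝ :=
  (⨆ t : Icc (0 : ℝ) T, ‖z t 0‖) +
  ⨆ p : {p : ℝ × ℝ // 0 ≤ p.2 ∧ p.2 < p.1 ∧ p.1 ≤ T},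
    ‖z p.1.1 p.1.2‖ / (p.1.1 - p.1.2) ^ γ

variable {V : Type v} {W : Type u} [NormedAddCommGroup V] [NormedSpace ℝ V]
  [NormedAddCommGroup W] [NormedSpace ℝ W]

/-- `(ω, ω₂)` is an `α`-Hölder rough path on `[0,T]`; `ω₂ t s` is the second order process at
`(t,s)`, `s ≤ t`. -/
structure IsRoughPath (N : TensorNorms V W) (T α : ℝ) (ω : ℝ → V) (ω₂ : ℝ → ℝ → N.VV) :
    Prop where
  holder : ∃ M : ℝ, ∀ s t : ℝ, 0 ≤ s → s ≤ t → t ≤ T → ‖ω t - ω s‖ ≤ M * (t - s) ^ α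
  holder₂ : ∃ M : ℝ, ∀ s t : ℝ, 0 ≤ s → s ≤ t → t ≤ T → ‖ω₂ t s‖ ≤ M * (t - s) ^ (2 * α)
  chen : ∀ s r t : ℝ, 0 ≤ s → s ≤ r → r ≤ t → t ≤ T →
    ω₂ t s - ω₂ r s - ω₂ t r = N.tmulVV (ω r - ω s) (ω t - ω r)

/-- `w` is a regular path on `[0,T]` with derivative `g`: it is the primitive of the bounded
strongly measurable function `g`, so that `dw_r = g(r) dr`. Piecewise linear paths, with `g`
the piecewise constant slope, and `C¹` paths are of this kind. -/
structure IsRegularPath (T : ℝ) (w g : ℝ → V) : Prop where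
  meas : AEStronglyMeasurable g (volume.restrict (Icc 0 T))
  bdd : ∃ M : ℝ, ∀ r ∈ Icc (0 : ℝ) T, ‖g r‖ ≤ M
  primitive : ∀ t ∈ Icc (0 : ℝ) T, w t = w 0 + ∫ r in (0 : ℝ)..t, g r

/-- The iterated integral `∫_s^t (w_r - w_s) ⊗ dw_r` of a regular path with derivative `g`. -/
def regularArea (N : TensorNorms V W) (w g : ℝ → V) (t s : ℝ) : N.VV :=
  ∫ r in s..t, N.tmulVV (w r - w s) (g r)

/-- Convergence of `(ω^n, ω₂^n)` to `(ω, ω₂)` in the rough path metric `d_{α,T}`. -/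
def RoughConverges (N : TensorNorms V W) (T α : ℝ) (ωn : ℕ → ℝ → V) (ω₂n : ℕ → ℝ → ℝ → N.VV)
    (ω : ℝ → V) (ω₂ : ℝ → ℝ → N.VV) : Prop :=
  ∀ ε > 0, ∀ᶠ n in atTop, ∀ s t : ℝ, 0 ≤ s → s < t → t ≤ T →
    ‖(ωn n t - ωn n s) - (ω t - ω s)‖ ≤ ε * (t - s) ^ α ∧
    ‖ω₂n n t s - ω₂ t s‖ ≤ ε * (t - s) ^ (2 * α)

end RoughPaths

/-! ### The supporting processes -/

section Processes

variable {V : Type v} {W : Type u} [NormedAddCommGroup V] [NormedSpace ℝ V]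
  [NormedAddCommGroup W] [NormedSpace ℝ W]

/-- `ω^S_{ts}(K) = ∫_s^t S(t-r) K dω_r`, integrated by parts:
`S(t-s) K (ω_t - ω_s) - ∫_s^t A S(t-r) K (ω_t - ω_r) dr`. -/
def omegaS (S : ℝ → W →L[ℝ] W) (ω : ℝ → V) (t s : ℝ) (K : V →L[ℝ] W) : W :=
  S (t - s) (K (ω t - ω s)) - ∫ r in s..t, gen S (S (t - r) (K (ω t - ω r)))

/-- For `E ∈ L(W ⊗ V, W)` and `x ∈ W`, the operator `E x : v ↦ E (x ⊗ v)`. -/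
def contract (N : TensorNorms V W) (E : N.WV →L[ℝ] W) (x : W) : V →L[ℝ] W :=
  E ∘L N.tmulWV x

/-- For `E ∈ L(W ⊗ V, W)` and `K ∈ L(V, W)`, the operator `E K : v ⊗ w ↦ E (K v ⊗ w)`. -/
def contractOp (N : TensorNorms V W) (E : N.WV →L[ℝ] W) (K : V →L[ℝ] W) : N.VV →L[ℝ] W :=
  E ∘L N.mapId K

/-- `a_{ts}(E, x) = ∫_s^t S(t-r) E S(r-s) x dω_r`, integrated by parts:
`ω^S_{ts}(E x) + ∫_s^t ω^S_{tr}(E A S(r-s) x) dr`. The integral is improper at `r = s`. -/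
def processA (S : ℝ → W →L[ℝ] W) (N : TensorNorms V W) (ω : ℝ → V) (t s : ℝ)
    (E : N.WV →L[ℝ] W) (x : W) : W :=
  omegaS S ω t s (contract N E x) +
    limUnder (𝓝[>] (0 : ℝ)) (fun ε : ℝ =>
      ∫ r in Ioc (s + ε) t, omegaS S ω t r (contract N E (gen S (S (r - s) x))))

/-- `∫_s^t (ω_t - ω_r) ⊗ dω_r`, that is `(ω_t - ω_s) ⊗ (ω_t - ω_s) - ω₂_{ts}`. -/
def coArea (N : TensorNorms V W) (ω : ℝ → V) (ω₂ : ℝ → ℝ → N.VV) (t s : ℝ) : N.VV :=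
  N.tmulVV (ω t - ω s) (ω t - ω s) - ω₂ t s

/-- `c_{ts}(E, K) = ∫_s^t S(t-r) E K (ω_r - ω_s) dω_r`, integrated by parts:
with `ω̃ = coArea`,
`ω^S_{ts}(E K (ω_t - ω_s)) - S(t-s) E K ω̃_{ts} + ∫_s^t A S(t-r) E K ω̃_{tr} dr`. -/
def processC (S : ℝ → W →L[ℝ] W) (N : TensorNorms V W) (ω : ℝ → V) (ω₂ : ℝ → ℝ → N.VV)
    (t s : ℝ) (E : N.WV →L[ℝ] W) (K : V →L[ℝ] W) : W :=
  omegaS S ω t s (contract N E (K (ω t - ω s)))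
    - S (t - s) (contractOp N E K (coArea N ω ω₂ t s))
    + ∫ r in s..t, gen S (S (t - r) (contractOp N E K (coArea N ω ω₂ t r)))

/-- `Ξ^{(b),s}_{tτ}(E, K) = ω^S_{tτ}(E ω^S_{τs}(K)) + c_{tτ}(E, K)`. -/
def xiB (S : ℝ → W →L[ℝ] W) (N : TensorNorms V W) (ω : ℝ → V) (ω₂ : ℝ → ℝ → N.VV)
    (E : N.WV →L[ℝ] W) (K : V →L[ℝ] W) (s t τ : ℝ) : W :=
  omegaS S ω t τ (contract N E (omegaS S ω τ s K)) + processC S N ω ω₂ t τ E K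

/-- `b_{ts}(E, K) = (δ̂ 𝓘Ξ^{(b),s})_{ts}(E, K)`, sewn with the exponents `α` and `α + 2β`. -/
def processB (S : ℝ → W →L[ℝ] W) (N : TensorNorms V W) (T α β : ℝ) (ω : ℝ → V)
    (ω₂ : ℝ → ℝ → N.VV) (t s : ℝ) (E : N.WV →L[ℝ] W) (K : V →L[ℝ] W) : W :=
  hatDelta S (sew S (xiB S N ω ω₂ E K s) s T α (α + 2 * β)) t s

/-- For a regular path with derivative `g`, the iterated integral
`∫_s^t S(t-r) E (∫_s^r S(r-q) K dw_q) dw_r`. -/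
def regularB (S : ℝ → W →L[ℝ] W) (N : TensorNorms V W) (g : ℝ → V) (t s : ℝ)
    (E : N.WV →L[ℝ] W) (K : V →L[ℝ] W) : W :=
  ∫ r in s..t, S (t - r) (contract N E (∫ q in s..r, S (r - q) (K (g q))) (g r))

/-- `z` is an element of `C^γ([0,T], L(L(W ⊗ V, W) × L(V, D_β), W))`: every `z_{ts}` is
bilinear, and `|z_{ts}| ≤ M (t-s)^γ` in the norm of bounded bilinear maps. -/
def IsHolderBilinear (S : ℝ → W →L[ℝ] W) (N : TensorNorms V W) (T β γ : ℝ)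
    (z : ℝ → ℝ → (N.WV →L[ℝ] W) → (V →L[ℝ] W) → W) : Prop :=
  (∀ s t : ℝ, 0 ≤ s → s ≤ t → t ≤ T →
    (∀ (E E' : N.WV →L[ℝ] W) (K : V →L[ℝ] W) (c : ℝ), MapsIntoDomain S β K →
      z t s (c • E + E') K = c • z t s E K + z t s E' K) ∧
    (∀ (E : N.WV →L[ℝ] W) (K K' : V →L[ℝ] W) (c : ℝ), MapsIntoDomain S β K →
      MapsIntoDomain S β K' → z t s E (c • K + K') = c • z t s E K + z t s E K')) ∧
  ∃ M : ℝ, ∀ (s t : ℝ) (E : N.WV →L[ℝ] W) (K : V →L[ℝ] W), 0 ≤ s → s ≤ t → t ≤ T →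
    MapsIntoDomain S β K → ‖z t s E K‖ ≤ M * ‖E‖ * domainOpNorm S β K * (t - s) ^ γ

/-- `z^n → z` in `C^γ([0,T], L(L(W ⊗ V, W) × L(V, D_β), W))`. -/
def HolderBilinearConverges (S : ℝ → W →L[ℝ] W) (N : TensorNorms V W) (T β γ : ℝ)
    (zn : ℕ → ℝ → ℝ → (N.WV →L[ℝ] W) → (V →L[ℝ] W) → W)
    (z : ℝ → ℝ → (N.WV →L[ℝ] W) → (V →L[ℝ] W) → W) : Prop :=
  ∀ ε > 0, ∀ᶠ n in atTop, ∀ (E : N.WV →L[ℝ] W) (K : V →L[ℝ] W), MapsIntoDomain S β K →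
    (∀ t : ℝ, 0 ≤ t → t ≤ T →
      ‖zn n t 0 E K - z t 0 E K‖ ≤ ε * ‖E‖ * domainOpNorm S β K) ∧
    (∀ s t : ℝ, 0 ≤ s → s < t → t ≤ T →
      ‖zn n t s E K - z t s E K‖ ≤ ε * ‖E‖ * domainOpNorm S β K * (t - s) ^ γ)

end Processes

end RoughEvolution

end

open RoughEvolution

/-!
The process `b` is an iterated integral `∫ S(t-r) E (∫ S(r-q) K dω_q) dω_r`, and it is obtained by a
sewing lemma along the semigroup. Everything rests on three properties of `S` (`SmoothingPair`,
`exists_smoothingPair`): it is bounded, it is differentiable in operator norm at positive times, and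
`‖A S(t)‖ ≤ M / t`. The last one is Cauchy's estimate on discs of radius proportional to `t` for small
`t`, and exponential decay for large `t`. Of `K ∈ L(V, D_β)` only the bounds `‖K v‖ ≤ κ ‖v‖` and
`‖A S(t) K v‖ ≤ κ t^{β-1} ‖v‖` are used (`RegularOp`, `exists_regularOp`).

*The defect of `Ξ^{(b),s}`.* The convolution `ω^S` gains `β` derivatives: for regular `K`, the vector
`x = ω^S_{τs}(K)` satisfies `‖A S(σ) x‖ ≤ C (τ-s)^{α-β} σ^{2β-1}` (`norm_D_omegaS_le`), so that its orbit
is `2β`-Hölder continuous at `0`. Hence the remainder `ω^S_{us}(K) - ω^S_{τs}(K) - K (ω_u - ω_τ)` is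
`O((u-τ)^{2β})` (`norm_remainder_le`). By the algebraic relations of `ω^S` and `c`, which are splittings
of one integral by parts (`ibp_split`, `hatDelta₂_processC`), `-δ̂₂Ξ^{(b),s}` at `(t,u,τ)` is `ω^S_{tu}` of
`E` contracted with that remainder (`hatDelta₂_xiB`), hence of order `α + 2β > 1`.

*Sewing.* Riemann sums over dyadic grids of `[0,T]`, cut to `[s,t]`, converge and become additive in the
limit (`exists_hatDelta_sub_le`). In the maximal inequality for partitions an outer factor `S(r)` is
carried through the recursion, so that the bound of `S` enters only once
(`norm_partition_sum_sub_le`). A path whose increments `δ̂` are of order greater than one vanishes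
(`eq_zero_of_hatDelta_le`); all identities below are proved by this uniqueness.

*Consequences.* `Ξ^{(b),s}` is linear in `E` and in `K`, so `b` is bilinear. The defect, and `c`, are
locally Lipschitz in the rough path, hence so is `b` (`norm_processB_sub_le`). Comparison with the zero
rough path gives the bound (`norm_processB_le`), comparison with approximating paths gives the
convergence. For a regular path `w`, integration by parts identifies `ω^S` with a convolution
(`omegaS_eq_conv`, by smoothing with `S(ε)` and uniqueness), and the iterated integral is a sewing of `Ξ`
with the better exponent `1 + 2β`, hence equal to `b` (`regularB_eq_processB`). Finally, as functions of
`t`, `(δ̂₂b)_{tτs}(E,K)` and `a_{tτ}(E, ω^S_{τs}(K))` vanish at `t = τ` and have the same increments up to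
order `α + 2β`; the improper integral in `a` converges because of the singularity `σ^{2β-1}` above
(`hatDelta₂_processB`).
-/

namespace RoughEvolution

/-! ### Smoothing estimates of an analytic semigroup -/

section Smoothing

variable {W : Type u} [NormedAddCommGroup W] [NormedSpace ℝ W]

/-- What the argument uses of an exponentially stable analytic semigroup `S`: it is bounded by `M`,
differentiable in operator norm at positive times with derivative `D t = A S(t)`, and
`‖A S(t)‖ ≤ M / t`. -/
structure SmoothingPair (S D : ℝ → W →L[ℝ] W) (M : ℝ) : Prop where
  map_zero : S 0 = ContinuousLinearMap.id ℝ W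
  map_add : ∀ s t : ℝ, 0 ≤ s → 0 ≤ t → S (s + t) = S s ∘L S t
  strong_cont : ∀ x : W, ContinuousOn (fun t : ℝ => S t x) (Ici 0)
  one_le : 1 ≤ M
  norm_le : ∀ t : ℝ, 0 ≤ t → ‖S t‖ ≤ M
  hasDerivAt : ∀ t : ℝ, 0 < t → HasDerivAt S (D t) t
  norm_deriv_le : ∀ t : ℝ, 0 < t → ‖D t‖ ≤ M / t

/-- The discs around `t > 0` of radius `c t` lie in the sector, for some `c` independent of `t`. -/
theorem exists_closedBall_subset_sector {θ : ℝ} (hθ : 0 < θ) :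
    ∃ c : ℝ, 0 < c ∧ c ≤ 1 / 2 ∧ ∀ t : ℝ, 0 < t → ∀ z : ℂ, ‖z - t‖ ≤ c * t → z ∈ sector θ := by
  have h1 : Tendsto Complex.arg (𝓝 1) (𝓝 0) := by
    have := Complex.continuousAt_arg (x := 1) (by simp [Complex.slitPlane])
    simpa [ContinuousAt] using this
  rw [Metric.tendsto_nhds_nhds] at h1
  obtain ⟨ε, hε, h⟩ := h1 θ hθ
  refine ⟨min (1 / 2) (ε / 2), by positivity, min_le_left _ _, fun t ht z hz => ?_⟩
  have htc : (t : ℂ) ≠ 0 := by exact_mod_cast ht.ne'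
  have hzt : ‖z / t - 1‖ ≤ min (1 / 2) (ε / 2) := by
    have : z / t - 1 = (z - t) / t := by field_simp
    rw [this, norm_div, Complex.norm_real, Real.norm_of_nonneg ht.le, div_le_iff₀ ht]
    exact hz
  constructor
  · rintro rfl
    have : (1 : ℝ) ≤ 1 / 2 := by simpa using hzt.trans (min_le_left _ _)
    norm_num at this
  · have h2 := h (show dist (z / t) 1 < ε by
      rw [dist_eq_norm]
      have := hzt.trans (min_le_right _ _)
      linarith)
    have h3 : z = (t : ℂ) * (z / t) := by field_simp
    rw [h3, Complex.arg_real_mul _ ht]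
    simpa [Real.dist_eq] using h2

/-- The uniform boundedness principle along a countably generated filter. -/
theorem eventually_norm_le_of_tendsto [CompleteSpace W] {ι : Type*} {l : Filter ι}
    [l.IsCountablyGenerated] {P : ι → W →L[ℝ] W} {R : W → W}
    (h : ∀ x, Tendsto (fun z => P z x) l (𝓝 (R x))) :
    ∃ B : ℝ, ∀ᶠ z in l, ‖P z‖ ≤ B := by
  by_contra hcon
  push Not at hcon
  obtain ⟨U, hU⟩ := l.exists_antitone_basis
  have hex : ∀ n : ℕ, ∃ z ∈ U n, (n : ℝ) < ‖P z‖ := fun n => by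
    obtain ⟨z, hz, hz'⟩ := ((hcon n).and_eventually (hU.1.mem_of_mem trivial)).exists
    exact ⟨z, hz', hz⟩
  choose z hzU hz using hex
  have hzl : Tendsto z atTop l := hU.tendsto hzU
  obtain ⟨C, hC⟩ := banach_steinhaus (g := fun n => P (z n)) (fun x => by
    obtain ⟨C, hC⟩ := (Metric.isBounded_range_of_tendsto _ ((h x).comp hzl)).exists_norm_le
    exact ⟨C, fun n => hC _ ⟨n, rfl⟩⟩)
  obtain ⟨n, hn⟩ := exists_nat_gt C
  exact absurd (hC n) (not_le.2 (hn.trans (hz n)))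

/-- Cauchy's estimate for an operator-valued holomorphic function written as `P + iQ`, obtained from
the scalar one by testing against functionals. -/
theorem norm_deriv_le_of_cauchyRiemann {P Q : ℂ → W →L[ℝ] W} {z₀ : ℂ} {R B : ℝ} (hR : 0 < R)
    (hB : 0 ≤ B)
    (hPQ : ∀ z ∈ Metric.closedBall z₀ R, ∃ P' Q' : W →L[ℝ] W,
      HasFDerivAt P (Complex.reCLM.smulRight P' - Complex.imCLM.smulRight Q') z ∧
      HasFDerivAt Q (Complex.reCLM.smulRight Q' + Complex.imCLM.smulRight P') z)
    (hP : ∀ z ∈ Metric.closedBall z₀ R, ‖P z‖ ≤ B)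
    (hQ : ∀ z ∈ Metric.closedBall z₀ R, ‖Q z‖ ≤ B)
    {P' Q' : W →L[ℝ] W}
    (h1 : HasFDerivAt P (Complex.reCLM.smulRight P' - Complex.imCLM.smulRight Q') z₀)
    (h2 : HasFDerivAt Q (Complex.reCLM.smulRight Q' + Complex.imCLM.smulRight P') z₀) :
    ‖P'‖ ≤ 2 * B / R := by
  refine ContinuousLinearMap.opNorm_le_bound _ (by positivity) fun x => ?_
  refine NormedSpace.norm_le_dual_bound ℝ _ (by positivity) fun φ => ?_
  let f : ℂ → ℂ := fun z => ((φ (P z x) : ℝ) : ℂ) + ((φ (Q z x) : ℝ) : ℂ) * Complex.I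
  have key : ∀ (z : ℂ) (P' Q' : W →L[ℝ] W),
      HasFDerivAt P (Complex.reCLM.smulRight P' - Complex.imCLM.smulRight Q') z →
      HasFDerivAt Q (Complex.reCLM.smulRight Q' + Complex.imCLM.smulRight P') z →
      HasDerivAt f (((φ (P' x) : ℝ) : ℂ) + ((φ (Q' x) : ℝ) : ℂ) * Complex.I) z := by
    intro z P' Q' hP hQ
    let ψ : (W →L[ℝ] W) →L[ℝ] ℂ :=
      Complex.ofRealCLM ∘L φ ∘L ContinuousLinearMap.apply ℝ W x
    have hP2 := ψ.hasFDerivAt.comp z hP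
    have hQ2 := (ψ.hasFDerivAt.comp z hQ).mul_const Complex.I
    have h3 := hP2.add hQ2
    rw [hasDerivAt_iff_hasFDerivAt]
    refine hasFDerivAt_of_restrictScalars ℝ h3 ?_
    ext y
    simp only [ψ, ContinuousLinearMap.coe_restrictScalars', ContinuousLinearMap.toSpanSingleton_apply,
      smul_eq_mul, add_apply, ContinuousLinearMap.comp_apply, sub_apply,
      ContinuousLinearMap.smulRight_apply, Complex.reCLM_apply, Complex.imCLM_apply,
      ContinuousLinearMap.apply_apply, map_sub, map_add, map_smul, smul_apply,
      Complex.ofRealCLM_apply, Complex.real_smul]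
    nth_rewrite 1 [← Complex.re_add_im y]
    linear_combination ((y.im : ℂ) * (φ (Q' x) : ℂ)) * Complex.I_sq
  have hd := key z₀ P' Q' h1 h2
  have hc := Complex.norm_deriv_le_of_forall_mem_sphere_norm_le (f := f) (C := 2 * B * ‖x‖ * ‖φ‖)
    hR (DifferentiableOn.diffContOnCl (fun z hz => by
      rw [closure_ball _ hR.ne'] at hz
      obtain ⟨P'', Q'', h1', h2'⟩ := hPQ z hz
      exact (key z P'' Q'' h1' h2').differentiableAt.differentiableWithinAt))
    (fun z hz => by
      have hz' := Metric.sphere_subset_closedBall hz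
      have e1 : ‖φ (P z x)‖ ≤ B * ‖x‖ * ‖φ‖ := by
        calc ‖φ (P z x)‖ ≤ ‖φ‖ * (‖P z‖ * ‖x‖) :=
              (φ.le_opNorm _).trans (by gcongr; exact (P z).le_opNorm x)
          _ ≤ ‖φ‖ * (B * ‖x‖) := by gcongr; exact hP z hz'
          _ = _ := by ring
      have e2 : ‖φ (Q z x)‖ ≤ B * ‖x‖ * ‖φ‖ := by
        calc ‖φ (Q z x)‖ ≤ ‖φ‖ * (‖Q z‖ * ‖x‖) :=
              (φ.le_opNorm _).trans (by gcongr; exact (Q z).le_opNorm x)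
          _ ≤ ‖φ‖ * (B * ‖x‖) := by gcongr; exact hQ z hz'
          _ = _ := by ring
      calc ‖f z‖ ≤ ‖φ (P z x)‖ + ‖φ (Q z x)‖ := by
            refine (norm_add_le _ _).trans ?_
            simp
        _ ≤ _ := by linarith)
  rw [hd.deriv] at hc
  have hre : ‖φ (P' x)‖ ≤ ‖((φ (P' x) : ℝ) : ℂ) + ((φ (Q' x) : ℝ) : ℂ) * Complex.I‖ := by
    have := Complex.abs_re_le_norm (((φ (P' x) : ℝ) : ℂ) + ((φ (Q' x) : ℝ) : ℂ) * Complex.I)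
    simpa using this
  refine (hre.trans hc).trans (le_of_eq ?_)
  ring

/-- An exponentially stable analytic semigroup satisfies `‖A S(t)‖ ≤ M / t`. For small `t` this is
Cauchy's estimate on a disc of radius `c t` inside the sector, where the holomorphic extension is
bounded by the uniform boundedness principle; for large `t` it follows from
`A S(t) = S(t - t₁) A S(t₁)` and the exponential decay. -/
theorem exists_smoothingPair [CompleteSpace W] {S : ℝ → W →L[ℝ] W} (hS : IsAnalyticSemigroup S)
    (hexp : IsExpStable S) : ∃ (D : ℝ → W →L[ℝ] W) (M : ℝ), SmoothingPair S D M := by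
  obtain ⟨M₀, δ, hδ, hM₀⟩ := hexp
  obtain ⟨θ, hθ, -, P, Q, hreal, hhol, hlim⟩ := hS.holomorphic
  obtain ⟨c, hc, hc2, hball⟩ := exists_closedBall_subset_sector hθ
  have hM₀n : 0 ≤ M₀ := by
    have := (norm_nonneg _).trans (hM₀ 0 le_rfl)
    simpa using this
  -- The derivative of `S` is the real part `P'` of the complex derivative.
  have hder : ∀ t : ℝ, 0 < t → ∀ P' Q' : W →L[ℝ] W,
      HasFDerivAt P (Complex.reCLM.smulRight P' - Complex.imCLM.smulRight Q') (t : ℂ) →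
      HasDerivAt S P' t := by
    intro t ht P' Q' h
    have h1 : HasDerivAt (fun r : ℝ => P (r : ℂ))
        ((Complex.reCLM.smulRight P' - Complex.imCLM.smulRight Q') (1 : ℂ)) t :=
      h.comp_hasDerivAt t (Complex.ofRealCLM.hasDerivAt (x := t))
    have h2 : HasDerivAt (fun r : ℝ => P (r : ℂ)) P' t := by simpa using h1
    refine h2.congr_of_eventuallyEq ?_
    filter_upwards [lt_mem_nhds ht] with r hr using (hreal r hr).1.symm
  have hsec : ∀ t : ℝ, 0 < t → (t : ℂ) ∈ sector θ := fun t ht =>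
    hball t ht t (by simp; positivity)
  have hdiff : ∀ t : ℝ, 0 < t → HasDerivAt S (deriv S t) t := fun t ht => by
    obtain ⟨P', Q', h1, -⟩ := hhol t (hsec t ht)
    exact (hder t ht P' Q' h1).differentiableAt.hasDerivAt
  obtain ⟨B₁, hB₁⟩ := eventually_norm_le_of_tendsto (fun x => (hlim x).1)
  obtain ⟨B₂, hB₂⟩ := eventually_norm_le_of_tendsto (R := fun _ => 0) (fun x => (hlim x).2)
  obtain ⟨r, hr, hrB⟩ := Metric.mem_nhdsWithin_iff.1 (hB₁.and hB₂)
  set B : ℝ := max 0 (max B₁ B₂) with hBdef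
  have hBn : 0 ≤ B := le_max_left _ _
  have hnear : ∀ t : ℝ, 0 < t → t < r / 2 → ‖deriv S t‖ ≤ (2 * B / c) / t := by
    intro t ht htr
    have hsub : ∀ z ∈ Metric.closedBall (t : ℂ) (c * t), z ∈ sector θ ∧ ‖P z‖ ≤ B ∧ ‖Q z‖ ≤ B := by
      intro z hz
      rw [mem_closedBall_iff_norm] at hz
      have hzs := hball t ht z hz
      have hzr : z ∈ Metric.ball (0 : ℂ) r := by
        rw [mem_ball_zero_iff]
        calc ‖z‖ = ‖(z - t) + t‖ := by simp
          _ ≤ ‖z - t‖ + ‖(t : ℂ)‖ := norm_add_le _ _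
          _ ≤ c * t + t := by
            rw [Complex.norm_real, Real.norm_of_nonneg ht.le]; gcongr
          _ < r := by nlinarith
      obtain ⟨e1, e2⟩ := hrB ⟨hzr, hzs⟩
      exact ⟨hzs, e1.trans ((le_max_left _ _).trans (le_max_right _ _)),
        e2.trans ((le_max_right _ _).trans (le_max_right _ _))⟩
    obtain ⟨P', Q', h1, h2⟩ := hhol t (hsec t ht)
    have := norm_deriv_le_of_cauchyRiemann (R := c * t) (B := B) (by positivity) hBn
      (fun z hz => hhol z (hsub z hz).1) (fun z hz => (hsub z hz).2.1)
      (fun z hz => (hsub z hz).2.2) h1 h2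
    rw [(hder t ht P' Q' h1).deriv]
    refine this.trans (le_of_eq ?_)
    field_simp
  set t₁ : ℝ := r / 4 with ht₁
  have ht₁p : 0 < t₁ := by positivity
  have hfar : ∀ t : ℝ, r / 2 ≤ t →
      ‖deriv S t‖ ≤ (M₀ * Real.exp (δ * t₁) * ‖deriv S t₁‖ / δ) / t := by
    intro t ht
    have htp : 0 < t := by linarith
    have e1 : HasDerivAt S (S (t - t₁) ∘L deriv S t₁) t := by
      have h1 : HasDerivAt (fun q : ℝ => S (q - (t - t₁))) (deriv S t₁) t := by
        have h0 := hdiff t₁ ht₁p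
        have h0' : HasDerivAt S (deriv S t₁) (t - (t - t₁)) := by simpa using h0
        exact h0'.comp_sub_const t (t - t₁)
      have h2 := (ContinuousLinearMap.compL ℝ W W W (S (t - t₁))).hasFDerivAt.comp_hasDerivAt t h1
      refine h2.congr_of_eventuallyEq ?_
      filter_upwards [lt_mem_nhds (show t - t₁ < t by linarith)] with q hq
      have := hS.map_add (t - t₁) (q - (t - t₁)) (by linarith) (by linarith)
      simpa using this
    rw [e1.deriv]
    have e2 : t * Real.exp (-(δ * t)) ≤ 1 / δ := by
      have := Real.add_one_le_exp (δ * t)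
      rw [Real.exp_neg, le_div_iff₀ hδ, mul_assoc, mul_comm, mul_assoc,
        inv_mul_le_iff₀ (Real.exp_pos _)]
      linarith
    have e3 : ‖S (t - t₁)‖ ≤ M₀ * Real.exp (δ * t₁) * Real.exp (-(δ * t)) := by
      refine (hM₀ _ (by linarith)).trans (le_of_eq ?_)
      rw [mul_assoc, ← Real.exp_add]
      ring_nf
    rw [le_div_iff₀ htp]
    calc ‖S (t - t₁) ∘L deriv S t₁‖ * t
        ≤ ((M₀ * Real.exp (δ * t₁) * Real.exp (-(δ * t))) * ‖deriv S t₁‖) * t := by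
          gcongr
          exact (ContinuousLinearMap.opNorm_comp_le _ _).trans (by gcongr)
      _ = (M₀ * Real.exp (δ * t₁) * ‖deriv S t₁‖) * (t * Real.exp (-(δ * t))) := by ring
      _ ≤ (M₀ * Real.exp (δ * t₁) * ‖deriv S t₁‖) * (1 / δ) := by gcongr
      _ = _ := by ring
  set X : ℝ := 2 * B / c
  set Y : ℝ := M₀ * Real.exp (δ * t₁) * ‖deriv S t₁‖ / δ
  have hX : 0 ≤ X := by positivity
  have hY : 0 ≤ Y := by positivity
  refine ⟨deriv S, 1 + M₀ + X + Y, hS.map_zero, hS.map_add, hS.strong_cont, by linarith,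
    fun t ht => ?_, hdiff, fun t ht => ?_⟩
  · refine (hM₀ t ht).trans ?_
    have : Real.exp (-(δ * t)) ≤ 1 := Real.exp_le_one_iff.2 (by nlinarith)
    nlinarith
  · rcases lt_or_ge t (r / 2) with h | h
    · exact (hnear t ht h).trans (by gcongr; linarith)
    · exact (hfar t h).trans (by gcongr; linarith)

end Smoothing

section SmoothingPair

variable {W : Type u} [NormedAddCommGroup W] [NormedSpace ℝ W]
  {V : Type v} [NormedAddCommGroup V] [NormedSpace ℝ V]

theorem gen_zero (S : ℝ → W →L[ℝ] W) : gen S (0 : W) = 0 := by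
  refine Tendsto.limUnder_eq ?_
  simp

namespace SmoothingPair

variable {S D : ℝ → W →L[ℝ] W} {M : ℝ} (h : SmoothingPair S D M)
include h

theorem pos : 0 < M := zero_lt_one.trans_le h.one_le

theorem S_add_apply {s t : ℝ} (hs : 0 ≤ s) (ht : 0 ≤ t) (x : W) : S (s + t) x = S s (S t x) := by
  rw [h.map_add s t hs ht]; rfl

theorem S_zero_apply (x : W) : S 0 x = x := by rw [h.map_zero]; rfl

theorem norm_S_apply_le {t : ℝ} (ht : 0 ≤ t) (x : W) : ‖S t x‖ ≤ M * ‖x‖ :=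
  (S t).le_of_opNorm_le (h.norm_le t ht) x

theorem norm_D_apply_le {t : ℝ} (ht : 0 < t) (x : W) : ‖D t x‖ ≤ M / t * ‖x‖ :=
  (D t).le_of_opNorm_le (h.norm_deriv_le t ht) x

theorem hasDerivAt_apply {t : ℝ} (ht : 0 < t) (x : W) : HasDerivAt (fun r => S r x) (D t x) t :=
  (ContinuousLinearMap.apply ℝ W x).hasFDerivAt.comp_hasDerivAt t (h.hasDerivAt t ht)

theorem D_add {s t : ℝ} (hs : 0 ≤ s) (ht : 0 < t) : D (s + t) = S s ∘L D t := by
  refine HasDerivAt.unique (f := S) (x := s + t) (h.hasDerivAt (s + t) (by linarith)) ?_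
  have h1 : HasDerivAt (fun q : ℝ => S (q - s)) (D t) (s + t) := by
    have h0' : HasDerivAt S (D t) (s + t - s) := by simpa using h.hasDerivAt t ht
    exact h0'.comp_sub_const (s + t) s
  have h2 := (ContinuousLinearMap.compL ℝ W W W (S s)).hasFDerivAt.comp_hasDerivAt (s + t) h1
  refine h2.congr_of_eventuallyEq ?_
  filter_upwards [lt_mem_nhds (show s < s + t by linarith)] with q hq
  simpa using h.map_add s (q - s) hs (by linarith)

theorem D_add' {s t : ℝ} (hs : 0 ≤ s) (ht : 0 < t) : D (s + t) = D t ∘L S s := by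
  refine HasDerivAt.unique (f := S) (x := s + t) (h.hasDerivAt (s + t) (by linarith)) ?_
  have h1 : HasDerivAt (fun q : ℝ => S (q - s)) (D t) (s + t) := by
    have h0' : HasDerivAt S (D t) (s + t - s) := by simpa using h.hasDerivAt t ht
    exact h0'.comp_sub_const (s + t) s
  have h2 := ((ContinuousLinearMap.compL ℝ W W W).flip (S s)).hasFDerivAt.comp_hasDerivAt (s + t) h1
  refine h2.congr_of_eventuallyEq ?_
  filter_upwards [lt_mem_nhds (show s < s + t by linarith)] with q hq
  simpa using h.map_add (q - s) s (by linarith) hs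

theorem D_add_apply {s t : ℝ} (hs : 0 ≤ s) (ht : 0 < t) (x : W) : D (s + t) x = S s (D t x) := by
  rw [h.D_add hs ht]; rfl

theorem D_add_apply' {s t : ℝ} (hs : 0 ≤ s) (ht : 0 < t) (x : W) : D (s + t) x = D t (S s x) := by
  rw [h.D_add' hs ht]; rfl

/-- `A S(a) A S(b)` depends on `a + b` only. -/
theorem D_comp_D {a b : ℝ} (ha : 0 < a) (hb : 0 < b) (x : W) :
    D a (D b x) = D ((a + b) / 2) (D ((a + b) / 2) x) := by
  rcases le_total a b with hab | hab
  · have e1 := h.D_add_apply (s := (b - a) / 2) (t := (a + b) / 2) (by linarith) (by linarith) x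
    have e2 := h.D_add_apply' (s := (b - a) / 2) (t := a) (by linarith) ha (D ((a + b) / 2) x)
    rw [show (b - a) / 2 + (a + b) / 2 = b by ring] at e1
    rw [show (b - a) / 2 + a = (a + b) / 2 by ring] at e2
    rw [e1, e2]
  · have e1 := h.D_add_apply (s := (a - b) / 2) (t := b) (by linarith) hb x
    have e2 := h.D_add_apply' (s := (a - b) / 2) (t := (a + b) / 2) (by linarith) (by linarith)
      (D b x)
    rw [show (a - b) / 2 + (a + b) / 2 = a by ring] at e2
    rw [show (a - b) / 2 + b = (a + b) / 2 by ring] at e1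
    rw [e2, e1]

theorem continuousOn_S : ContinuousOn S (Ioi 0) := fun t ht =>
  (h.hasDerivAt t ht).continuousAt.continuousWithinAt

theorem continuousOn_D : ContinuousOn D (Ioi 0) := by
  intro t ht
  have ht' : (0 : ℝ) < t := ht
  have h1 : ContinuousAt (fun q : ℝ => S (q - t / 2) ∘L D (t / 2)) t := by
    have h2 : ContinuousAt (fun q : ℝ => S (q - t / 2)) t := by
      have h3 : ContinuousAt S (t - t / 2) :=
        (h.hasDerivAt (t - t / 2) (by linarith)).continuousAt
      exact h3.comp (f := fun q : ℝ => q - t / 2) (by fun_prop)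
    exact h2.clm_comp continuousAt_const
  refine (h1.congr ?_).continuousWithinAt
  filter_upwards [lt_mem_nhds (show t / 2 < t by linarith)] with q hq
  have := h.D_add (s := q - t / 2) (t := t / 2) (by linarith) (by linarith)
  rw [← this]
  ring_nf

/-- The limit in the definition of the generator exists on the range of `S(t)`, `t > 0`. -/
theorem gen_eq {t : ℝ} (ht : 0 < t) (x : W) : gen S (S t x) = D t x := by
  refine Tendsto.limUnder_eq ?_
  have h1 := (h.hasDerivAt_apply ht x).tendsto_slope_zero_right
  refine h1.congr' ?_
  filter_upwards [self_mem_nhdsWithin] with r hr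
  have hr' : (0 : ℝ) < r := hr
  rw [add_comm t r, h.S_add_apply hr'.le ht.le]

/-- Orbits of vectors with `‖A S(σ) y‖ ≤ B σ^{γ-1}` are `γ`-Hölder continuous at `0`. -/
theorem norm_S_sub_le [CompleteSpace W] {y : W} {B γ τ : ℝ} (hγ : 0 < γ)
    (hy : ∀ σ : ℝ, 0 < σ → ‖D σ y‖ ≤ B * σ ^ (γ - 1)) (hτ : 0 ≤ τ) :
    ‖S τ y - y‖ ≤ B / γ * τ ^ γ := by
  have hB : 0 ≤ B := by simpa using (norm_nonneg _).trans (hy 1 one_pos)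
  have hstep : ∀ σ : ℝ, 0 < σ → σ ≤ τ → ‖S τ y - S σ y‖ ≤ B / γ * τ ^ γ := by
    intro σ hσ hστ
    have hsub : uIcc σ τ ⊆ Ioi 0 := by
      rw [uIcc_of_le hστ]
      exact fun r hr => hσ.trans_le hr.1
    have hint : IntervalIntegrable (fun r => D r y) volume σ τ :=
      (ContinuousOn.clm_apply (h.continuousOn_D.mono hsub) continuousOn_const).intervalIntegrable
    rw [← intervalIntegral.integral_eq_sub_of_hasDerivAt
      (fun r hr => h.hasDerivAt_apply (hsub hr) y) hint]
    have hgi : IntervalIntegrable (fun r : ℝ => B * r ^ (γ - 1)) volume σ τ :=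
      (intervalIntegral.intervalIntegrable_rpow' (by linarith)).const_mul B
    refine (intervalIntegral.norm_integral_le_of_norm_le hστ
      (Eventually.of_forall fun r hr => hy r (hσ.trans hr.1)) hgi).trans ?_
    rw [intervalIntegral.integral_const_mul, integral_rpow (Or.inl (by linarith)), sub_add_cancel,
      div_mul_eq_mul_div, mul_div_assoc]
    gcongr
    have := Real.rpow_nonneg hσ.le γ
    linarith
  have hlim : Tendsto (fun σ => ‖S τ y - S σ y‖) (𝓝[>] 0) (𝓝 ‖S τ y - S 0 y‖) := by
    have := (h.strong_cont y 0 self_mem_Ici).mono_left (nhdsWithin_mono 0 Ioi_subset_Ici_self)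
    exact (tendsto_const_nhds.sub this).norm
  rw [h.S_zero_apply] at hlim
  rcases hτ.eq_or_lt with rfl | hτ'
  · simp [h.S_zero_apply, Real.zero_rpow hγ.ne']
  refine le_of_tendsto hlim ?_
  filter_upwards [Ioc_mem_nhdsGT hτ'] with σ hσ using hstep σ hσ.1 hσ.2

end SmoothingPair

/-- `K` maps into vectors whose orbits have the singularity `t^{β-1}` of elements of `D_β`. This is
all that is used of `K ∈ L(V, D_β)`; unlike the condition on `(-A)^β K`, it is visibly stable under
linear combinations. -/
structure RegularOp (D : ℝ → W →L[ℝ] W) (β κ : ℝ) (K : V →L[ℝ] W) : Prop where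
  nonneg : 0 ≤ κ
  norm_le : ∀ v, ‖K v‖ ≤ κ * ‖v‖
  norm_D_le : ∀ t : ℝ, 0 < t → ∀ v, ‖D t (K v)‖ ≤ κ * t ^ (β - 1) * ‖v‖

theorem RegularOp.smul_add {D : ℝ → W →L[ℝ] W} {β κ κ' : ℝ} {K K' : V →L[ℝ] W}
    (h : RegularOp D β κ K) (h' : RegularOp D β κ' K') (c : ℝ) :
    RegularOp D β (|c| * κ + κ') (c • K + K') where
  nonneg := by
    have := h.nonneg; have := h'.nonneg; positivity
  norm_le v := by
    calc ‖(c • K + K') v‖ ≤ ‖c • K v‖ + ‖K' v‖ := norm_add_le _ _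
      _ ≤ |c| * (κ * ‖v‖) + κ' * ‖v‖ := by
        rw [norm_smul, Real.norm_eq_abs]
        gcongr
        exacts [h.norm_le v, h'.norm_le v]
      _ = _ := by ring
  norm_D_le t ht v := by
    calc ‖D t ((c • K + K') v)‖ = ‖c • D t (K v) + D t (K' v)‖ := by simp
      _ ≤ ‖c • D t (K v)‖ + ‖D t (K' v)‖ := norm_add_le _ _
      _ ≤ |c| * (κ * t ^ (β - 1) * ‖v‖) + κ' * t ^ (β - 1) * ‖v‖ := by
        rw [norm_smul, Real.norm_eq_abs]
        gcongr
        exacts [h.norm_D_le t ht v, h'.norm_D_le t ht v]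
      _ = _ := by ring

theorem integrableOn_rpow_smul_semigroup {S D : ℝ → W →L[ℝ] W} {M : ℝ} (h : SmoothingPair S D M)
    (hexp : IsExpStable S) {β : ℝ} (hβ : 0 < β) (f : W) :
    IntegrableOn (fun r : ℝ => r ^ (β - 1) • S r f) (Ioi 0) := by
  obtain ⟨M₀, δ, hδ, hM₀⟩ := hexp
  have hg : IntegrableOn (fun r : ℝ => r ^ (β - 1) * Real.exp (-δ * r)) (Ioi 0) := by
    have := integrableOn_rpow_mul_exp_neg_mul_rpow (s := β - 1) (p := 1) (b := δ) (by linarith)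
      one_pos hδ
    simpa using this
  refine Integrable.mono' (hg.const_mul (M₀ * ‖f‖)) ?_ ?_
  · refine ContinuousOn.aestronglyMeasurable (ContinuousOn.smul ?_ ?_) measurableSet_Ioi
    · exact fun r hr => (Real.continuousAt_rpow_const r _ (Or.inl (ne_of_gt hr))).continuousWithinAt
    · exact (h.strong_cont f).mono Ioi_subset_Ici_self
  · refine (ae_restrict_iff' measurableSet_Ioi).2 (Eventually.of_forall fun r hr => ?_)
    have hr' : (0 : ℝ) < r := hr
    rw [norm_smul, Real.norm_of_nonneg (by positivity)]
    calc r ^ (β - 1) * ‖S r f‖ ≤ r ^ (β - 1) * ((M₀ * Real.exp (-(δ * r))) * ‖f‖) := by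
          gcongr
          exact (S r).le_of_opNorm_le (hM₀ r hr'.le) f
      _ = _ := by rw [neg_mul]; ring

theorem exists_norm_negFracPow_le {S D : ℝ → W →L[ℝ] W} {M : ℝ} (h : SmoothingPair S D M)
    (hexp : IsExpStable S) {β : ℝ} (hβ : 0 < β) :
    ∃ C : ℝ, 0 ≤ C ∧ ∀ f : W, ‖negFracPow S β f‖ ≤ C * ‖f‖ := by
  have hint := fun f => integrableOn_rpow_smul_semigroup h hexp hβ f
  obtain ⟨M₀, δ, hδ, hM₀⟩ := hexp
  have hg : IntegrableOn (fun r : ℝ => r ^ (β - 1) * Real.exp (-δ * r)) (Ioi 0) := by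
    have := integrableOn_rpow_mul_exp_neg_mul_rpow (s := β - 1) (p := 1) (b := δ) (by linarith)
      one_pos hδ
    simpa using this
  have hM₀n : 0 ≤ M₀ := by
    have := (norm_nonneg _).trans (hM₀ 0 le_rfl)
    simpa using this
  have hΓ := (Real.Gamma_pos_of_pos hβ).le
  set J : ℝ := ∫ r in Ioi (0 : ℝ), r ^ (β - 1) * Real.exp (-δ * r)
  have hJ : 0 ≤ J := setIntegral_nonneg measurableSet_Ioi fun r hr => by
    have hr' : (0 : ℝ) < r := hr
    positivity
  refine ⟨(Real.Gamma β)⁻¹ * (M₀ * J), by positivity, fun f => ?_⟩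
  rw [negFracPow, norm_smul, norm_inv, Real.norm_of_nonneg hΓ, mul_assoc]
  gcongr
  calc ‖∫ r in Ioi (0 : ℝ), r ^ (β - 1) • S r f‖
      ≤ ∫ r in Ioi (0 : ℝ), (M₀ * ‖f‖) * (r ^ (β - 1) * Real.exp (-δ * r)) := by
        refine norm_integral_le_of_norm_le (hg.const_mul _) ?_
        refine (ae_restrict_iff' measurableSet_Ioi).2 (Eventually.of_forall fun r hr => ?_)
        have hr' : (0 : ℝ) < r := hr
        rw [norm_smul, Real.norm_of_nonneg (by positivity)]
        calc r ^ (β - 1) * ‖S r f‖ ≤ r ^ (β - 1) * ((M₀ * Real.exp (-(δ * r))) * ‖f‖) := by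
              gcongr
              exact (S r).le_of_opNorm_le (hM₀ r hr'.le) f
          _ = _ := by rw [neg_mul]; ring
    _ = M₀ * J * ‖f‖ := by rw [integral_const_mul]; ring

/-- `‖A S(t) (-A)^{-β} f‖ ≤ C t^{β-1} ‖f‖`: the integral defining `(-A)^{-β}` is split at `r = t`. -/
theorem exists_norm_D_negFracPow_le [CompleteSpace W] {S D : ℝ → W →L[ℝ] W} {M : ℝ}
    (h : SmoothingPair S D M) (hexp : IsExpStable S) {β : ℝ} (hβ : 0 < β) (hβ1 : β < 1) :
    ∃ C : ℝ, 0 ≤ C ∧ ∀ t : ℝ, 0 < t → ∀ f : W,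
      ‖D t (negFracPow S β f)‖ ≤ C * t ^ (β - 1) * ‖f‖ := by
  have hint := fun f => integrableOn_rpow_smul_semigroup h hexp hβ f
  have hΓ := (Real.Gamma_pos_of_pos hβ).le
  have hM := h.pos
  have hβ1' : 0 < 1 - β := by linarith
  refine ⟨(Real.Gamma β)⁻¹ * (M * (1 / β + 1 / (1 - β))), by positivity, fun t ht f => ?_⟩
  rw [negFracPow, map_smul, norm_smul, norm_inv, Real.norm_of_nonneg hΓ, mul_assoc, mul_assoc]
  gcongr
  rw [← (D t).integral_comp_comm (hint f)]
  have hi : IntegrableOn (fun r : ℝ => D t (r ^ (β - 1) • S r f)) (Ioi 0) :=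
    (D t).integrable_comp (hint f)
  have hpt : ∀ r : ℝ, 0 < r → ‖D t (r ^ (β - 1) • S r f)‖ ≤ r ^ (β - 1) * (M / (r + t) * ‖f‖) := by
    intro r hr
    rw [map_smul, norm_smul, Real.norm_of_nonneg (by positivity), ← h.D_add_apply' hr.le ht]
    gcongr
    exact h.norm_D_apply_le (by positivity) f
  rw [← Ioc_union_Ioi_eq_Ioi ht.le, setIntegral_union (Ioc_disjoint_Ioi le_rfl) measurableSet_Ioi
    (hi.mono_set Ioc_subset_Ioi_self) (hi.mono_set (Ioi_subset_Ioi ht.le))]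
  have h1 : ‖∫ r in Ioc 0 t, D t (r ^ (β - 1) • S r f)‖ ≤ M * (1 / β) * t ^ (β - 1) * ‖f‖ := by
    rw [← intervalIntegral.integral_of_le ht.le]
    have hgi : IntervalIntegrable (fun r : ℝ => (M / t * ‖f‖) * r ^ (β - 1)) volume 0 t :=
      (intervalIntegral.intervalIntegrable_rpow' (by linarith)).const_mul _
    refine (intervalIntegral.norm_integral_le_of_norm_le ht.le
      (Eventually.of_forall fun r hr => (hpt r hr.1).trans ?_) hgi).trans (le_of_eq ?_)
    · have hr := hr.1
      rw [mul_comm]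
      gcongr
      linarith
    · rw [intervalIntegral.integral_const_mul, integral_rpow (Or.inl (by linarith)), sub_add_cancel,
        Real.zero_rpow hβ.ne', sub_zero, Real.rpow_sub_one ht.ne']
      field_simp
  have h2 : ‖∫ r in Ioi t, D t (r ^ (β - 1) • S r f)‖ ≤ M * (1 / (1 - β)) * t ^ (β - 1) * ‖f‖ := by
    have hgi : IntegrableOn (fun r : ℝ => (M * ‖f‖) * r ^ (β - 2)) (Ioi t) :=
      (integrableOn_Ioi_rpow_of_lt (by linarith) ht).const_mul _
    refine (norm_integral_le_of_norm_le hgi ?_).trans (le_of_eq ?_)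
    · refine (ae_restrict_iff' measurableSet_Ioi).2 (Eventually.of_forall fun r hr => ?_)
      have hr' : 0 < r := ht.trans hr
      refine (hpt r hr').trans ?_
      calc r ^ (β - 1) * (M / (r + t) * ‖f‖) ≤ r ^ (β - 1) * (M / r * ‖f‖) := by
            gcongr
            linarith
        _ = (M * ‖f‖) * r ^ (β - 2) := by
            rw [show β - 2 = β - 1 - 1 by ring, Real.rpow_sub_one hr'.ne' (β - 1)]
            ring
    · rw [integral_const_mul, integral_Ioi_rpow_of_lt (by linarith) ht,
        show β - 2 + 1 = -(1 - β) by ring, show β - 1 = -(1 - β) by ring]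
      field_simp
  calc _ ≤ _ := norm_add_le _ _
    _ ≤ _ := add_le_add h1 h2
    _ = _ := by ring

/-- The infimum in the definition of the operator norm is attained. -/
theorem domainOpNorm_spec {S : ℝ → W →L[ℝ] W} {γ : ℝ} {K : V →L[ℝ] W}
    (hK : MapsIntoDomain S γ K) :
    0 ≤ domainOpNorm S γ K ∧ ∀ v, ‖fracPow S γ (K v)‖ ≤ domainOpNorm S γ K * ‖v‖ := by
  obtain ⟨-, M, hM⟩ := hK
  have hne : {M : ℝ | 0 ≤ M ∧ ∀ v, ‖fracPow S γ (K v)‖ ≤ M * ‖v‖}.Nonempty :=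
    ⟨max M 0, le_max_right _ _, fun v => (hM v).trans (by gcongr; exact le_max_left _ _)⟩
  have hbd : BddBelow {M : ℝ | 0 ≤ M ∧ ∀ v, ‖fracPow S γ (K v)‖ ≤ M * ‖v‖} := ⟨0, fun _ h => h.1⟩
  have hcl : IsClosed {M : ℝ | 0 ≤ M ∧ ∀ v, ‖fracPow S γ (K v)‖ ≤ M * ‖v‖} := by
    simp only [ofPred_and, ofPred_forall]
    exact (isClosed_le continuous_const continuous_id).inter
      (isClosed_iInter fun v => isClosed_le continuous_const (by fun_prop))
  exact hcl.csInf_mem hne hbd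

/-- Operators `K ∈ L(V, D_β)` are regular. Only `(-A)^{-β} (-A)^β K v = K v` is used, which holds because
`K v` lies in the range of `(-A)^{-β}`; injectivity of `(-A)^{-β}` is not needed. -/
theorem exists_regularOp [CompleteSpace W] {S D : ℝ → W →L[ℝ] W} {M : ℝ}
    (h : SmoothingPair S D M) (hexp : IsExpStable S) {β : ℝ} (hβ : 0 < β) (hβ1 : β < 1) :
    ∃ C : ℝ, 0 ≤ C ∧ ∀ (V : Type v) [NormedAddCommGroup V] [NormedSpace ℝ V] (K : V →L[ℝ] W),
      MapsIntoDomain S β K → RegularOp D β (C * domainOpNorm S β K) K := by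
  obtain ⟨C₁, hC₁, h₁⟩ := exists_norm_negFracPow_le h hexp hβ
  obtain ⟨C₂, hC₂, h₂⟩ := exists_norm_D_negFracPow_le h hexp hβ hβ1
  refine ⟨C₁ + C₂, by positivity, fun V _ _ K hK => ?_⟩
  obtain ⟨hn, hle⟩ := domainOpNorm_spec hK
  have hinv : ∀ v, negFracPow S β (fracPow S β (K v)) = K v := fun v =>
    Function.invFun_eq (hK.1 v)
  refine ⟨by positivity, fun v => ?_, fun t ht v => ?_⟩
  · calc ‖K v‖ ≤ C₁ * ‖fracPow S β (K v)‖ := by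
          conv_lhs => rw [← hinv v]
          exact h₁ _
      _ ≤ (C₁ + C₂) * (domainOpNorm S β K * ‖v‖) := by
          gcongr
          · linarith
          · exact hle v
      _ = _ := by ring
  · calc ‖D t (K v)‖ ≤ C₂ * t ^ (β - 1) * ‖fracPow S β (K v)‖ := by
          conv_lhs => rw [← hinv v]
          exact h₂ t ht _
      _ ≤ (C₁ + C₂) * t ^ (β - 1) * (domainOpNorm S β K * ‖v‖) := by
          gcongr
          · linarith
          · exact hle v
      _ = _ := by ring

end SmoothingPair

/-! ### The sewing lemma along a semigroup -/

section Sewing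

variable {W : Type u} [NormedAddCommGroup W] [NormedSpace ℝ W]

/-- `‖(δ̂₂Ξ)_{tus}‖ ≤ L (t-s)^ρ` on `[s₀,T]`. -/
def DefectBound (S : ℝ → W →L[ℝ] W) (Ξ : ℝ → ℝ → W) (s₀ T L ρ : ℝ) : Prop :=
  ∀ s u t : ℝ, s₀ ≤ s → s ≤ u → u ≤ t → t ≤ T → ‖hatDelta₂ S Ξ t u s‖ ≤ L * (t - s) ^ ρ

/-- The constant of the sewing lemma, the fixed point of `C ↦ 2^{1-ρ} C + 2 M`. -/
noncomputable def sewConst (M ρ : ℝ) : ℝ := 2 * M / (1 - (2 : ℝ) ^ (1 - ρ))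

theorem two_rpow_one_sub_lt_one {ρ : ℝ} (hρ : 1 < ρ) : (2 : ℝ) ^ (1 - ρ) < 1 :=
  Real.rpow_lt_one_of_one_lt_of_neg one_lt_two (by linarith)

theorem sewConst_nonneg {M ρ : ℝ} (hM : 0 ≤ M) (hρ : 1 < ρ) : 0 ≤ sewConst M ρ :=
  div_nonneg (by linarith) (by linarith [two_rpow_one_sub_lt_one hρ])

/-- Cutting `[s,t]` by the grid of step `T / 2^n`; the cells outside `[s,t]` degenerate to its end
points. -/
noncomputable def gridPt (T s t : ℝ) (n k : ℕ) : ℝ := max s (min (k * (T / 2 ^ n)) t)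

/-- The Riemann sum of `Ξ` over `[s,t]`, cut by the grid of step `T / 2^n`. -/
noncomputable def gridSum (S : ℝ → W →L[ℝ] W) (Ξ : ℝ → ℝ → W) (T : ℝ) (n : ℕ) (t s : ℝ) : W :=
  ∑ k ∈ Finset.range (2 ^ n), S (t - gridPt T s t n (k + 1))
    (Ξ (gridPt T s t n (k + 1)) (gridPt T s t n k))

section Grid

variable {T s t : ℝ}

theorem gridPt_zero (hs : 0 ≤ s) (hst : s ≤ t) (n : ℕ) : gridPt T s t n 0 = s := by
  simp [gridPt, hs.trans hst, hs]

theorem gridPt_last (hst : s ≤ t) (ht : t ≤ T) (n : ℕ) : gridPt T s t n (2 ^ n) = t := by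
  have : ((2 ^ n : ℕ) : ℝ) * (T / 2 ^ n) = T := by push_cast; field_simp
  rw [gridPt, this, min_eq_right ht, max_eq_right hst]

theorem gridPt_mono (hT : 0 ≤ T) (n : ℕ) : Monotone (gridPt T s t n) := fun i j hij => by
  unfold gridPt; gcongr

theorem le_gridPt (n k : ℕ) : s ≤ gridPt T s t n k := le_max_left _ _

theorem gridPt_le (hst : s ≤ t) (n k : ℕ) : gridPt T s t n k ≤ t := max_le hst (min_le_right _ _)

theorem gridPt_succ_sub_le (hT : 0 ≤ T) (n k : ℕ) :
    gridPt T s t n (k + 1) - gridPt T s t n k ≤ T / 2 ^ n := by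
  have hh : 0 ≤ T / 2 ^ n := by positivity
  unfold gridPt
  push_cast
  rw [add_mul, one_mul]
  have h1 : min (k * (T / 2 ^ n) + T / 2 ^ n) t ≤ min (k * (T / 2 ^ n)) t + T / 2 ^ n := by
    rcases le_total (k * (T / 2 ^ n)) t with h | h
    · rw [min_eq_left h]; exact min_le_left _ _
    · rw [min_eq_right h]; exact (min_le_right _ _).trans (by linarith)
  have h2 : max s (min (k * (T / 2 ^ n) + T / 2 ^ n) t) ≤
      max s (min (k * (T / 2 ^ n)) t) + T / 2 ^ n :=
    max_le ((le_max_left _ _).trans (by linarith))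
      (h1.trans (by gcongr; exact le_max_right _ _))
  linarith

theorem gridPt_two_mul (n k : ℕ) : gridPt T s t (n + 1) (2 * k) = gridPt T s t n k := by
  unfold gridPt
  congr 2
  push_cast
  rw [pow_succ]
  field_simp

theorem sum_range_two_mul {G : Type*} [AddCommMonoid G] (f : ℕ → G) (N : ℕ) :
    ∑ k ∈ Finset.range (2 * N), f k = ∑ k ∈ Finset.range N, (f (2 * k) + f (2 * k + 1)) := by
  induction N with
  | zero => simp
  | succ N ih =>
    rw [show 2 * (N + 1) = 2 * N + 1 + 1 by ring, Finset.sum_range_succ, Finset.sum_range_succ, ih,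
      Finset.sum_range_succ, add_assoc]

theorem two_pow_mul_rpow (hT : 0 ≤ T) (A ρ : ℝ) (n : ℕ) :
    (2 : ℝ) ^ n * (A * (T / 2 ^ n) ^ ρ) = A * T ^ ρ * ((2 : ℝ) ^ (1 - ρ)) ^ n := by
  rw [Real.div_rpow hT (by positivity), Real.rpow_sub two_pos, Real.rpow_one, div_pow,
    ← Real.rpow_natCast (2 ^ ρ) n, ← Real.rpow_mul two_pos.le, mul_comm ρ, Real.rpow_mul two_pos.le,
    Real.rpow_natCast]
  ring

theorem tendsto_two_pow_mul_rpow (hT : 0 ≤ T) (A : ℝ) {ρ : ℝ} (hρ : 1 < ρ) :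
    Tendsto (fun n : ℕ => (2 : ℝ) ^ n * (A * (T / 2 ^ n) ^ ρ)) atTop (𝓝 0) := by
  simp_rw [two_pow_mul_rpow hT]
  simpa using (tendsto_pow_atTop_nhds_zero_of_lt_one (by positivity)
    (two_rpow_one_sub_lt_one hρ)).const_mul (A * T ^ ρ)

theorem norm_sum_cells_le {G : Type*} [SeminormedAddCommGroup G] {f : ℕ → G} {A h ρ : ℝ} {n : ℕ}
    (hf : ∀ k, ‖f k‖ ≤ A * h ^ ρ) :
    ‖∑ k ∈ Finset.range (2 ^ n), f k‖ ≤ (2 : ℝ) ^ n * (A * h ^ ρ) := by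
  refine (norm_sum_le_of_le _ fun k _ => hf k).trans (le_of_eq ?_)
  simp

end Grid

theorem exists_cell_of_mem {p : ℕ → ℝ} {m : ℝ} {a b : ℕ} (hab : a < b) (ha : p a ≤ m)
    (hb : m ≤ p b) : ∃ j, a ≤ j ∧ j < b ∧ p j ≤ m ∧ m ≤ p (j + 1) := by
  induction b with
  | zero => omega
  | succ b ih =>
    rcases le_total (p b) m with h | h
    · exact ⟨b, by omega, by omega, h, hb⟩
    · rcases (show a ≤ b by omega).eq_or_lt with rfl | hlt
      · exact ⟨a, le_rfl, by omega, ha, hb⟩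
      · obtain ⟨j, h1, h2, h3⟩ := ih hlt h
        exact ⟨j, h1, by omega, h3⟩

section Lemma

variable {S D : ℝ → W →L[ℝ] W} {M : ℝ} (h : SmoothingPair S D M) {Ξ : ℝ → ℝ → W}
  {s₀ T L ρ : ℝ}

include h

theorem DefectBound.diag (hΞ : DefectBound S Ξ s₀ T L ρ) (hρ : 0 < ρ) {t : ℝ} (ht : s₀ ≤ t)
    (htT : t ≤ T) : Ξ t t = 0 := by
  have := hΞ t t t ht le_rfl le_rfl htT
  simpa [hatDelta₂, Real.zero_rpow hρ.ne', h.S_zero_apply] using this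

/-- The maximal inequality for Riemann sums over arbitrary partitions. The partition is split at the
cell containing the mid point; carrying the outer factor `S r` along prevents the bound `M` of the
semigroup from accumulating in the recursion. -/
theorem norm_partition_sum_sub_le (hρ : 1 < ρ) (hL : 0 ≤ L) (hΞ : DefectBound S Ξ s₀ T L ρ)
    {p : ℕ → ℝ} (hp : Monotone p) (hp0 : ∀ i, s₀ ≤ p i) (hpT : ∀ i, p i ≤ T) (n : ℕ) :
    ∀ a b : ℕ, a ≤ b → b - a ≤ n → ∀ r : ℝ, 0 ≤ r →
      ‖S r (∑ i ∈ Finset.Ico a b, S (p b - p (i + 1)) (Ξ (p (i + 1)) (p i)) - Ξ (p b) (p a))‖ ≤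
        sewConst M ρ * L * (p b - p a) ^ ρ := by
  have hM := h.pos.le
  have hC := sewConst_nonneg hM hρ
  induction n with
  | zero =>
    intro a b hab hn r hr
    obtain rfl : a = b := by omega
    simp [hΞ.diag h (by linarith) (hp0 a) (hpT a), Real.zero_rpow (show ρ ≠ 0 by linarith)]
  | succ n ih =>
    intro a b hab hn r hr
    rcases hab.eq_or_lt with rfl | hlt
    · simp [hΞ.diag h (by linarith) (hp0 a) (hpT a), Real.zero_rpow (show ρ ≠ 0 by linarith)]
    have hpab := hp hab
    obtain ⟨j, haj, hjb, hj1, hj2⟩ := exists_cell_of_mem (p := p) (m := (p a + p b) / 2) hlt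
      (by linarith) (by linarith)
    have hxy := hp haj
    have hyz := hp (Nat.le_succ j)
    have hzw := hp (show j + 1 ≤ b by omega)
    have i1 := ih a j haj (by omega) (r + (p b - p j)) (by linarith)
    have i2 := ih (j + 1) b (by omega) (by omega) r hr
    have d1 := hΞ (p a) (p j) (p b) (hp0 a) hxy (hyz.trans hzw) (hpT b)
    have d2 := hΞ (p j) (p (j + 1)) (p b) (hp0 j) hyz hzw (hpT b)
    have hsum : ∑ i ∈ Finset.Ico a b, S (p b - p (i + 1)) (Ξ (p (i + 1)) (p i)) =
        S (p b - p j) (∑ i ∈ Finset.Ico a j, S (p j - p (i + 1)) (Ξ (p (i + 1)) (p i))) +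
        S (p b - p (j + 1)) (Ξ (p (j + 1)) (p j)) +
        ∑ i ∈ Finset.Ico (j + 1) b, S (p b - p (i + 1)) (Ξ (p (i + 1)) (p i)) := by
      rw [← Finset.sum_Ico_consecutive _ haj hjb.le, Finset.sum_eq_sum_Ico_succ_bot hjb, ← add_assoc,
        map_sum]
      congr 2
      refine Finset.sum_congr rfl fun i hi => ?_
      have hi' := hp (show i + 1 ≤ j by have := (Finset.mem_Ico.1 hi).2; omega)
      rw [← h.S_add_apply (by linarith) (by linarith)]
      ring_nf
    have key : S r (∑ i ∈ Finset.Ico a b, S (p b - p (i + 1)) (Ξ (p (i + 1)) (p i))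
          - Ξ (p b) (p a)) =
        S (r + (p b - p j)) (∑ i ∈ Finset.Ico a j, S (p j - p (i + 1)) (Ξ (p (i + 1)) (p i))
          - Ξ (p j) (p a)) +
        S r (∑ i ∈ Finset.Ico (j + 1) b, S (p b - p (i + 1)) (Ξ (p (i + 1)) (p i))
          - Ξ (p b) (p (j + 1))) -
        S r (hatDelta₂ S Ξ (p b) (p j) (p a)) - S r (hatDelta₂ S Ξ (p b) (p (j + 1)) (p j)) := by
      rw [hsum, h.S_add_apply hr (by linarith), ← map_add, ← map_sub, ← map_sub]
      congr 1
      simp only [hatDelta₂, map_sub]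
      abel
    set d := p b - p a with hd
    have hd0 : 0 ≤ d := by linarith
    have hhalf : (d / 2) ^ ρ * 2 = d ^ ρ * (2 : ℝ) ^ (1 - ρ) := by
      rw [Real.div_rpow hd0 two_pos.le, Real.rpow_sub two_pos, Real.rpow_one]
      ring
    have b1 : (p j - p a) ^ ρ ≤ (d / 2) ^ ρ :=
      Real.rpow_le_rpow (by linarith) (by linarith) (by linarith)
    have b2 : (p b - p (j + 1)) ^ ρ ≤ (d / 2) ^ ρ :=
      Real.rpow_le_rpow (by linarith) (by linarith) (by linarith)
    have b3 : (p b - p j) ^ ρ ≤ d ^ ρ :=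
      Real.rpow_le_rpow (by linarith) (by linarith) (by linarith)
    have e1 : ‖S r (hatDelta₂ S Ξ (p b) (p j) (p a))‖ ≤ M * (L * d ^ ρ) :=
      (h.norm_S_apply_le hr _).trans (by gcongr)
    have e2 : ‖S r (hatDelta₂ S Ξ (p b) (p (j + 1)) (p j))‖ ≤ M * (L * d ^ ρ) :=
      (h.norm_S_apply_le hr _).trans (by gcongr; exact d2.trans (by gcongr))
    have hq := two_rpow_one_sub_lt_one hρ
    have hfix : sewConst M ρ * (2 : ℝ) ^ (1 - ρ) + 2 * M = sewConst M ρ := by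
      have : (1 - (2 : ℝ) ^ (1 - ρ)) ≠ 0 := by linarith
      unfold sewConst
      field_simp
      ring
    rw [key]
    calc _ ≤ sewConst M ρ * L * (d / 2) ^ ρ + sewConst M ρ * L * (d / 2) ^ ρ + M * (L * d ^ ρ)
          + M * (L * d ^ ρ) := by
          refine (norm_sub_le _ _).trans (add_le_add ((norm_sub_le _ _).trans
            (add_le_add ((norm_add_le _ _).trans (add_le_add ?_ ?_)) e1)) e2)
          · exact i1.trans (by gcongr)
          · exact i2.trans (by gcongr)
      _ = sewConst M ρ * L * ((d / 2) ^ ρ * 2) + 2 * M * L * d ^ ρ := by ring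
      _ = (sewConst M ρ * (2 : ℝ) ^ (1 - ρ) + 2 * M) * L * d ^ ρ := by rw [hhalf]; ring
      _ = _ := by rw [hfix]

theorem norm_gridSum_sub_le (hρ : 1 < ρ) (hL : 0 ≤ L) (hΞ : DefectBound S Ξ s₀ T L ρ)
    (hs₀ : 0 ≤ s₀) {s t : ℝ} (hs : s₀ ≤ s) (hst : s ≤ t) (ht : t ≤ T) (n : ℕ) :
    ‖gridSum S Ξ T n t s - Ξ t s‖ ≤ sewConst M ρ * L * (t - s) ^ ρ := by
  have hT : 0 ≤ T := by linarith
  have := norm_partition_sum_sub_le h hρ hL hΞ (gridPt_mono (s := s) (t := t) hT n)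
    (fun i => hs.trans (le_gridPt n i)) (fun i => (gridPt_le hst n i).trans ht) (2 ^ n) 0 (2 ^ n)
    (Nat.zero_le _) (by simp) 0 le_rfl
  rw [gridPt_zero (hs₀.trans hs) hst, gridPt_last hst ht, h.S_zero_apply] at this
  rw [gridSum, Finset.range_eq_Ico]
  exact this

/-- Refining the grid changes each cell by a defect. -/
theorem norm_gridSum_succ_sub_le (hρ : 1 < ρ) (hL : 0 ≤ L) (hΞ : DefectBound S Ξ s₀ T L ρ)
    (hs₀ : 0 ≤ s₀) {s t : ℝ} (hs : s₀ ≤ s) (hst : s ≤ t) (ht : t ≤ T) (n : ℕ) :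
    ‖gridSum S Ξ T (n + 1) t s - gridSum S Ξ T n t s‖ ≤
      (2 : ℝ) ^ n * (M * L * (T / 2 ^ n) ^ ρ) := by
  have hT : 0 ≤ T := by linarith
  have hM := h.pos.le
  rw [gridSum, gridSum, pow_succ, mul_comm, sum_range_two_mul, ← Finset.sum_sub_distrib]
  refine norm_sum_cells_le fun k => ?_
  have e1 : gridPt T s t (n + 1) (2 * k + 1 + 1) = gridPt T s t n (k + 1) :=
    gridPt_two_mul n (k + 1)
  rw [e1, gridPt_two_mul]
  set x := gridPt T s t n k with hx
  set y := gridPt T s t (n + 1) (2 * k + 1) with hy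
  set z := gridPt T s t n (k + 1) with hz
  have hxy : x ≤ y := by
    rw [hx, ← gridPt_two_mul]; exact gridPt_mono hT _ (Nat.le_succ _)
  have hyz : y ≤ z := by
    rw [← e1]; exact gridPt_mono hT _ (Nat.le_succ _)
  have hzt : z ≤ t := gridPt_le hst n _
  have hsx : s ≤ x := le_gridPt n _
  have e2 : S (t - y) (Ξ y x) + S (t - z) (Ξ z y) - S (t - z) (Ξ z x) =
      - S (t - z) (hatDelta₂ S Ξ z y x) := by
    have : S (t - y) (Ξ y x) = S (t - z) (S (z - y) (Ξ y x)) := by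
      rw [← h.S_add_apply (by linarith) (by linarith)]; ring_nf
    rw [this, hatDelta₂, map_sub, map_sub]
    abel
  rw [e2, norm_neg]
  have hcell : z - x ≤ T / 2 ^ n := gridPt_succ_sub_le hT n k
  calc ‖S (t - z) (hatDelta₂ S Ξ z y x)‖ ≤ M * (L * (z - x) ^ ρ) :=
        (h.norm_S_apply_le (by linarith) _).trans (by
          gcongr
          exact hΞ x y z (hs.trans hsx) hxy hyz (hzt.trans ht))
    _ ≤ M * (L * (T / 2 ^ n) ^ ρ) := by
        gcongr
        linarith
    _ = _ := by ring

/-- Riemann sums over the same grid are additive up to a defect in the single cell that contains `u`. -/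
theorem norm_gridSum_add_sub_le (hρ : 1 < ρ) (hL : 0 ≤ L) (hΞ : DefectBound S Ξ s₀ T L ρ)
    (hs₀ : 0 ≤ s₀) {s u t : ℝ} (hs : s₀ ≤ s) (hsu : s ≤ u) (hut : u ≤ t) (ht : t ≤ T) (n : ℕ) :
    ‖gridSum S Ξ T n t s - gridSum S Ξ T n t u - S (t - u) (gridSum S Ξ T n u s)‖ ≤
      (2 : ℝ) ^ n * (M * L * (T / 2 ^ n) ^ ρ) := by
  have hT : 0 ≤ T := by linarith
  have hM := h.pos.le
  rw [gridSum, gridSum, gridSum, map_sum, ← Finset.sum_sub_distrib, ← Finset.sum_sub_distrib]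
  refine norm_sum_cells_le fun k => ?_
  have hmax : ∀ j, gridPt T u t n j = max u (gridPt T s t n j) := fun j => by
    unfold gridPt
    rw [← max_assoc, max_eq_left hsu]
  have hmin : ∀ j, gridPt T s u n j = min u (gridPt T s t n j) := fun j => by
    unfold gridPt
    rw [min_max_distrib_left, min_eq_right hsu, min_comm u, min_assoc, min_eq_right hut]
  rw [hmax, hmax, hmin, hmin]
  set x := gridPt T s t n k with hx
  set z := gridPt T s t n (k + 1) with hz
  have hxz : x ≤ z := gridPt_mono hT _ (Nat.le_succ _)
  have hzt : z ≤ t := gridPt_le (hsu.trans hut) n _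
  have hsx : s ≤ x := le_gridPt n _
  have hdiag := hΞ.diag h (by linarith) (hs.trans hsu) (hut.trans ht)
  have hbound : 0 ≤ M * L * (T / 2 ^ n) ^ ρ := by positivity
  rcases le_total z u with hzu | huz
  · rw [max_eq_left hzu, max_eq_left (hxz.trans hzu), min_eq_right hzu,
      min_eq_right (hxz.trans hzu), hdiag, map_zero, sub_zero,
      ← h.S_add_apply (by linarith) (by linarith), show t - u + (u - z) = t - z by ring, sub_self,
      norm_zero]
    exact hbound
  rcases le_total u x with hux | hxu
  · rw [max_eq_right hux, max_eq_right huz, min_eq_left hux, min_eq_left huz, hdiag, map_zero,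
      map_zero, sub_zero, sub_self, norm_zero]
    exact hbound
  rw [max_eq_right huz, max_eq_left hxu, min_eq_left huz, min_eq_right hxu, sub_self,
    h.S_zero_apply]
  have e2 : S (t - z) (Ξ z x) - S (t - z) (Ξ z u) - S (t - u) (Ξ u x) =
      S (t - z) (hatDelta₂ S Ξ z u x) := by
    have : S (t - u) (Ξ u x) = S (t - z) (S (z - u) (Ξ u x)) := by
      rw [← h.S_add_apply (by linarith) (by linarith)]; ring_nf
    rw [this, hatDelta₂, map_sub, map_sub]
  rw [e2]
  have hcell : z - x ≤ T / 2 ^ n := gridPt_succ_sub_le hT n k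
  calc ‖S (t - z) (hatDelta₂ S Ξ z u x)‖ ≤ M * (L * (z - x) ^ ρ) :=
        (h.norm_S_apply_le (by linarith) _).trans (by
          gcongr
          exact hΞ x u z (hs.trans hsx) hxu huz (hzt.trans ht))
    _ ≤ M * (L * (T / 2 ^ n) ^ ρ) := by
        gcongr
    _ = _ := by ring

/-- Existence part of the sewing lemma. -/
theorem exists_hatDelta_sub_le [CompleteSpace W] (hρ : 1 < ρ) (hL : 0 ≤ L)
    (hΞ : DefectBound S Ξ s₀ T L ρ) (hs₀ : 0 ≤ s₀) (hs₀T : s₀ ≤ T) :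
    ∃ y : ℝ → W, y s₀ = 0 ∧ ∀ s t : ℝ, s₀ ≤ s → s ≤ t → t ≤ T →
      ‖hatDelta S y t s - Ξ t s‖ ≤ sewConst M ρ * L * (t - s) ^ ρ := by
  have hT : 0 ≤ T := by linarith
  have hlim : ∀ s t : ℝ, s₀ ≤ s → s ≤ t → t ≤ T →
      ∃ I, Tendsto (fun n => gridSum S Ξ T n t s) atTop (𝓝 I) := by
    intro s t hs hst ht
    refine cauchySeq_tendsto_of_complete (cauchySeq_of_le_geometric ((2 : ℝ) ^ (1 - ρ))
      (M * L * T ^ ρ) (two_rpow_one_sub_lt_one hρ) fun n => ?_)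
    rw [dist_comm, dist_eq_norm, ← two_pow_mul_rpow hT]
    exact norm_gridSum_succ_sub_le h hρ hL hΞ hs₀ hs hst ht n
  let I : ℝ → ℝ → W := fun t s => limUnder atTop fun n => gridSum S Ξ T n t s
  have hI : ∀ s t : ℝ, s₀ ≤ s → s ≤ t → t ≤ T →
      Tendsto (fun n => gridSum S Ξ T n t s) atTop (𝓝 (I t s)) :=
    fun s t hs hst ht => tendsto_nhds_limUnder (hlim s t hs hst ht)
  have hadd : ∀ s u t : ℝ, s₀ ≤ s → s ≤ u → u ≤ t → t ≤ T →
      I t s - I t u - S (t - u) (I u s) = 0 := by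
    intro s u t hs hsu hut ht
    have h1 := ((hI s t hs (hsu.trans hut) ht).sub (hI u t (hs.trans hsu) hut ht)).sub
      (((S (t - u)).continuous.tendsto _).comp (hI s u hs hsu (hut.trans ht)))
    have h2 := squeeze_zero_norm (fun n => norm_gridSum_add_sub_le h hρ hL hΞ hs₀ hs hsu hut ht n)
      (tendsto_two_pow_mul_rpow hT (M * L) hρ)
    exact tendsto_nhds_unique h1 h2
  refine ⟨fun t => I t s₀, ?_, fun s t hs hst ht => ?_⟩
  · have := hadd s₀ s₀ s₀ le_rfl le_rfl le_rfl hs₀T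
    simpa [h.S_zero_apply] using this
  · have e : hatDelta S (fun t => I t s₀) t s = I t s := by
      have := hadd s₀ s t le_rfl hs hst ht
      rw [hatDelta]
      rw [sub_sub, sub_eq_zero] at this
      rw [this]
      simp
    rw [e]
    exact le_of_tendsto (((hI s t hs hst ht).sub_const _).norm)
      (Eventually.of_forall fun n => norm_gridSum_sub_le h hρ hL hΞ hs₀ hs hst ht n)

/-- Uniqueness part of the sewing lemma: `z` is the telescoping Riemann sum of its own increments. -/
theorem eq_zero_of_hatDelta_le {z : ℝ → W} {C : ℝ} (hρ : 1 < ρ) (hs₀ : 0 ≤ s₀) (hz0 : z s₀ = 0)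
    (hz : ∀ s t : ℝ, s₀ ≤ s → s ≤ t → t ≤ T → ‖hatDelta S z t s‖ ≤ C * (t - s) ^ ρ) {t : ℝ}
    (hst : s₀ ≤ t) (ht : t ≤ T) : z t = 0 := by
  have hT : 0 ≤ T := by linarith
  have hM := h.pos.le
  have key : ∀ n, z t = gridSum S (hatDelta S z) T n t s₀ := by
    intro n
    have e : ∀ k, S (t - gridPt T s₀ t n (k + 1))
        (hatDelta S z (gridPt T s₀ t n (k + 1)) (gridPt T s₀ t n k)) =
        S (t - gridPt T s₀ t n (k + 1)) (z (gridPt T s₀ t n (k + 1))) -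
        S (t - gridPt T s₀ t n k) (z (gridPt T s₀ t n k)) := by
      intro k
      have h1 := gridPt_mono (s := s₀) (t := t) hT n (Nat.le_succ k)
      have h2 := gridPt_le (T := T) hst n (k + 1)
      rw [hatDelta, map_sub, ← h.S_add_apply (by linarith) (by linarith [h1])]
      ring_nf
    rw [gridSum, Finset.sum_congr rfl fun k _ => e k,
      Finset.sum_range_sub (fun k => S (t - gridPt T s₀ t n k) (z (gridPt T s₀ t n k))),
      gridPt_zero hs₀ hst, gridPt_last hst ht, hz0, map_zero, sub_self, h.S_zero_apply, sub_zero]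
  have hle : ∀ n, ‖gridSum S (hatDelta S z) T n t s₀‖ ≤
      (2 : ℝ) ^ n * (M * max C 0 * (T / 2 ^ n) ^ ρ) := by
    intro n
    refine norm_sum_cells_le fun k => ?_
    have h1 := gridPt_mono (s := s₀) (t := t) hT n (Nat.le_succ k)
    have h2 := gridPt_le (T := T) hst n (k + 1)
    have h3 := gridPt_succ_sub_le (s := s₀) (t := t) hT n k
    have h4 := le_gridPt (T := T) (s := s₀) (t := t) n k
    refine (h.norm_S_apply_le (by linarith) _).trans ?_
    rw [mul_assoc]
    gcongr
    refine (hz _ _ h4 h1 (h2.trans ht)).trans ?_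
    have : 0 ≤ gridPt T s₀ t n (k + 1) - gridPt T s₀ t n k := sub_nonneg.2 h1
    gcongr
    exact le_max_left _ _
  have h2 := squeeze_zero_norm hle (tendsto_two_pow_mul_rpow hT (M * max C 0) hρ)
  simp_rw [← key] at h2
  exact tendsto_nhds_unique tendsto_const_nhds h2

/-- Increments `δ̂` of positive order imply continuity. Continuity from the left needs care, as the
semigroup is not uniformly continuous on vectors varying with the time. -/
theorem continuousOn_of_hatDelta_le {y : ℝ → W} {C α : ℝ} (hα : 0 < α)
    (hy : ∀ s t : ℝ, s₀ ≤ s → s ≤ t → t ≤ T → ‖hatDelta S y t s‖ ≤ C * (t - s) ^ α) :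
    ContinuousOn y (Icc s₀ T) := by
  intro t ht
  rw [Metric.continuousWithinAt_iff]
  intro ε hε
  -- The evolution is restarted at a time `u ≤ t` so close to `t` that both increments are small.
  have hlim : Tendsto (fun r : ℝ => C * r ^ α) (𝓝 0) (𝓝 0) := by
    have : ContinuousAt (fun r : ℝ => C * r ^ α) 0 :=
      continuousAt_const.mul (Real.continuousAt_rpow_const _ _ (Or.inr hα.le))
    simpa [ContinuousAt, Real.zero_rpow hα.ne'] using this
  obtain ⟨η, hη, hη'⟩ := Metric.tendsto_nhds_nhds.1 hlim (ε / 3) (by positivity)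
  have hsmall : ∀ r : ℝ, 0 ≤ r → r < η → C * r ^ α < ε / 3 := fun r hr hrη => by
    have := hη' (x := r) (by rwa [Real.dist_eq, sub_zero, abs_of_nonneg hr])
    rw [Real.dist_eq, sub_zero] at this
    exact (le_abs_self _).trans_lt this
  set u := max s₀ (t - η / 3) with hu
  have hut : u ≤ t := max_le ht.1 (by linarith)
  have hsu : s₀ ≤ u := le_max_left _ _
  have htu : t - η / 3 ≤ u := le_max_right _ _
  have hS : ContinuousWithinAt (fun r : ℝ => S r (y u)) (Ici 0) (t - u) :=
    h.strong_cont (y u) (t - u) (show (0 : ℝ) ≤ t - u by linarith)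
  obtain ⟨η₂, hη₂, hη₂'⟩ := Metric.continuousWithinAt_iff.1 hS (ε / 3) (by positivity)
  refine ⟨min (η / 3) η₂, by positivity, fun {s} hs hst => ?_⟩
  have hst1 : |s - t| < η / 3 := hst.trans_le (min_le_left _ _)
  have hst2 : |s - t| < η₂ := hst.trans_le (min_le_right _ _)
  have hus : u ≤ s := by
    rw [abs_lt] at hst1
    rcases max_choice s₀ (t - η / 3) with h' | h'
    · rw [hu, h']; exact hs.1
    · rw [hu, h']; linarith
  have e : y s - y t = hatDelta S y s u - hatDelta S y t u +
      (S (s - u) (y u) - S (t - u) (y u)) := by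
    simp only [hatDelta]; abel
  have e1 := (hy u s hsu hus hs.2).trans_lt (hsmall (s - u) (by linarith) (by
    rw [abs_lt] at hst1; linarith))
  have e2 := (hy u t hsu hut ht.2).trans_lt (hsmall (t - u) (by linarith) (by linarith))
  have e3 := hη₂' (x := s - u) (show (0 : ℝ) ≤ s - u by linarith) (by
    rw [Real.dist_eq, show s - u - (t - u) = s - t by ring]; exact hst2)
  rw [dist_eq_norm] at e3 ⊢
  rw [e]
  calc _ ≤ _ := (norm_add_le _ _).trans (add_le_add_left (norm_sub_le _ _) _)
    _ < ε := by linarith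

theorem IsSewing.eqOn {κ : ℝ} (hρ : 1 < ρ) (hs₀ : 0 ≤ s₀) {y y' : ℝ → W}
    (hy : IsSewing S Ξ s₀ T κ ρ y) (hy' : IsSewing S Ξ s₀ T κ ρ y') : EqOn y y' (Icc s₀ T) := by
  obtain ⟨-, h0, C, hC⟩ := hy
  obtain ⟨-, h0', C', hC'⟩ := hy'
  intro t ht
  refine sub_eq_zero.1 (eq_zero_of_hatDelta_le h (z := fun r => y r - y' r) (C := C + C') hρ hs₀
    (by simp [h0, h0']) (fun s t hs hst ht => ?_) ht.1 ht.2)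
  have e : hatDelta S (fun r => y r - y' r) t s =
      (hatDelta S y t s - Ξ t s) - (hatDelta S y' t s - Ξ t s) := by
    simp only [hatDelta, map_sub]; abel
  rw [e, add_mul]
  exact (norm_sub_le _ _).trans (add_le_add (hC s t hs hst ht).2 (hC' s t hs hst ht).2)

/-- The sewing lemma, with the constant of the approximation. -/
theorem isSewing_sew [CompleteSpace W] {α L' : ℝ} (hρ : 1 < ρ) (hα : 0 < α) (hαρ : α ≤ ρ)
    (hL : 0 ≤ L) (hs₀ : 0 ≤ s₀) (hs₀T : s₀ ≤ T) (hΞ : DefectBound S Ξ s₀ T L ρ)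
    (hΞ' : ∀ s t : ℝ, s₀ ≤ s → s ≤ t → t ≤ T → ‖Ξ t s‖ ≤ L' * (t - s) ^ α) :
    IsSewing S Ξ s₀ T α ρ (sew S Ξ s₀ T α ρ) ∧
    ∀ s t : ℝ, s₀ ≤ s → s ≤ t → t ≤ T →
      ‖hatDelta S (sew S Ξ s₀ T α ρ) t s - Ξ t s‖ ≤ sewConst M ρ * L * (t - s) ^ ρ := by
  obtain ⟨y, hy0, hy⟩ := exists_hatDelta_sub_le h hρ hL hΞ hs₀ hs₀T
  have hC := sewConst_nonneg h.pos.le hρ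
  have hT : 0 ≤ T := by linarith
  have hyα : ∀ s t : ℝ, s₀ ≤ s → s ≤ t → t ≤ T →
      ‖hatDelta S y t s‖ ≤ (|L'| + sewConst M ρ * L * T ^ (ρ - α)) * (t - s) ^ α := by
    intro s t hs hst ht
    have h0 : 0 ≤ t - s := by linarith
    have e : (t - s) ^ ρ ≤ T ^ (ρ - α) * (t - s) ^ α := by
      rcases h0.eq_or_lt with h00 | h00
      · rw [← h00, Real.zero_rpow (by linarith), Real.zero_rpow hα.ne', mul_zero]
      · calc (t - s) ^ ρ = (t - s) ^ (ρ - α) * (t - s) ^ α := by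
              rw [← Real.rpow_add h00]; ring_nf
          _ ≤ _ := by gcongr; linarith
    calc ‖hatDelta S y t s‖ = ‖Ξ t s + (hatDelta S y t s - Ξ t s)‖ := by rw [add_sub_cancel]
      _ ≤ |L'| * (t - s) ^ α + sewConst M ρ * L * (T ^ (ρ - α) * (t - s) ^ α) := by
        refine (norm_add_le _ _).trans (add_le_add ((hΞ' s t hs hst ht).trans ?_)
          ((hy s t hs hst ht).trans ?_))
        · gcongr; exact le_abs_self _
        · gcongr
      _ = _ := by ring
  have hsew : IsSewing S Ξ s₀ T α ρ y := by
    refine ⟨continuousOn_of_hatDelta_le h hα hyα, hy0,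
      max (|L'| + sewConst M ρ * L * T ^ (ρ - α)) (sewConst M ρ * L), fun s t hs hst ht => ?_⟩
    have h0 : 0 ≤ t - s := by linarith
    exact ⟨(hyα s t hs hst ht).trans (by gcongr; exact le_max_left _ _),
      (hy s t hs hst ht).trans (by gcongr; exact le_max_right _ _)⟩
  have hsew' : IsSewing S Ξ s₀ T α ρ (sew S Ξ s₀ T α ρ) := Classical.epsilon_spec ⟨y, hsew⟩
  refine ⟨hsew', fun s t hs hst ht => ?_⟩
  have heq := hsew'.eqOn h hρ hs₀ hsew
  rw [hatDelta, heq ⟨hs.trans hst, ht⟩, heq ⟨hs, hst.trans ht⟩]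
  exact hy s t hs hst ht

end Lemma

end Sewing

/-! ### Convolutions integrated by parts -/

section Ibp

variable {W : Type u} [NormedAddCommGroup W] [NormedSpace ℝ W]
  {V : Type v} [NormedAddCommGroup V] [NormedSpace ℝ V]

section RpowIntegrals

variable {s t A γ : ℝ} {f : ℝ → W}

theorem intervalIntegrable_sub_rpow (hγ : -1 < γ) :
    IntervalIntegrable (fun r : ℝ => (t - r) ^ γ) volume s t := by
  have := (intervalIntegral.intervalIntegrable_rpow' (a := t - s) (b := 0) hγ).comp_sub_left t
  simpa using this

theorem integral_sub_rpow (hγ : -1 < γ) :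
    ∫ r in s..t, (t - r) ^ γ = (t - s) ^ (γ + 1) / (γ + 1) := by
  rw [intervalIntegral.integral_comp_sub_left (fun r => r ^ γ) t, integral_rpow (Or.inl hγ), sub_self,
    Real.zero_rpow (by linarith), sub_zero]

theorem ae_mem_Ioc_imp {p : ℝ → Prop} (hp : ∀ r ∈ Ioo s t, p r) :
    ∀ᵐ r ∂volume, r ∈ Ioc s t → p r := by
  filter_upwards [compl_mem_ae_iff.2 (measure_singleton t)] with r hr hr'
  exact hp r ⟨hr'.1, lt_of_le_of_ne hr'.2 hr⟩

theorem norm_integral_le_sub_rpow (hst : s ≤ t) (hγ : -1 < γ)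
    (hf : ∀ r ∈ Ioo s t, ‖f r‖ ≤ A * (t - r) ^ γ) :
    ‖∫ r in s..t, f r‖ ≤ A * ((t - s) ^ (γ + 1) / (γ + 1)) := by
  rw [← integral_sub_rpow hγ, ← intervalIntegral.integral_const_mul]
  exact intervalIntegral.norm_integral_le_of_norm_le hst (ae_mem_Ioc_imp hf)
    ((intervalIntegrable_sub_rpow hγ).const_mul A)

omit [NormedSpace ℝ W] in
theorem intervalIntegrable_of_norm_le (hst : s ≤ t) (hc : ContinuousOn f (Ioo s t)) {g : ℝ → ℝ}
    (hg : IntervalIntegrable g volume s t) (hf : ∀ r ∈ Ioo s t, ‖f r‖ ≤ g r) :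
    IntervalIntegrable f volume s t := by
  rw [intervalIntegrable_iff_integrableOn_Ioo_of_le hst] at hg ⊢
  exact Integrable.mono' hg (hc.aestronglyMeasurable measurableSet_Ioo)
    ((ae_restrict_iff' measurableSet_Ioo).2 (Eventually.of_forall hf))

end RpowIntegrals

/-- `S(t-s) f(s) - ∫_s^t A S(t-r) f(r) dr`. With `f(r) = K (ω_t - ω_r)` this is `∫_s^t S(t-r) K dω_r`
after an integration by parts; in general it is `-∫_s^t S(t-r) df(r)` for `f` vanishing at `t`. -/
noncomputable def ibp (S D : ℝ → W →L[ℝ] W) (t s : ℝ) (f : ℝ → W) : W :=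
  S (t - s) (f s) - ∫ r in s..t, D (t - r) (f r)

/-- `f` is continuous on `[s,t]` and vanishes at `t` to the order `γ`. -/
structure VanishesAt (f : ℝ → W) (t s F γ : ℝ) : Prop where
  cont : ContinuousOn f (Icc s t)
  norm_le : ∀ r ∈ Icc s t, ‖f r‖ ≤ F * (t - r) ^ γ

section Lemmas

variable {S D : ℝ → W →L[ℝ] W} {M : ℝ} (h : SmoothingPair S D M)
  {f g : ℝ → W} {t s u F γ β : ℝ}

omit [NormedSpace ℝ W] in
theorem VanishesAt.eq_zero (hf : VanishesAt f t s F γ) (hγ : 0 < γ) (hst : s ≤ t) : f t = 0 := by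
  have := hf.norm_le t ⟨hst, le_rfl⟩
  simpa [Real.zero_rpow hγ.ne'] using this

include h

theorem continuousOn_D_sub_apply (hf : ContinuousOn f (Icc s t)) :
    ContinuousOn (fun r => D (t - r) (f r)) (Ioo s t) := by
  refine ContinuousOn.clm_apply ?_ (hf.mono Ioo_subset_Icc_self)
  exact h.continuousOn_D.comp (by fun_prop) fun r hr => by simpa using hr.2

theorem VanishesAt.norm_D_le (hf : VanishesAt f t s F γ) {r : ℝ} (hr : r ∈ Ioo s t) :
    ‖D (t - r) (f r)‖ ≤ M * F * (t - r) ^ (γ - 1) := by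
  have hr' : 0 < t - r := by linarith [hr.2]
  have hM := h.pos
  calc ‖D (t - r) (f r)‖ ≤ M / (t - r) * (F * (t - r) ^ γ) :=
        (h.norm_D_apply_le hr' _).trans (by
          gcongr; exact hf.norm_le r ⟨hr.1.le, hr.2.le⟩)
    _ = _ := by rw [Real.rpow_sub_one hr'.ne']; ring

theorem VanishesAt.intervalIntegrable (hf : VanishesAt f t s F γ) (hγ : 0 < γ) (hst : s ≤ t) :
    IntervalIntegrable (fun r => D (t - r) (f r)) volume s t :=
  intervalIntegrable_of_norm_le hst (continuousOn_D_sub_apply h hf.cont)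
    ((intervalIntegrable_sub_rpow (by linarith)).const_mul (M * F)) fun _ hr => hf.norm_D_le h hr

theorem norm_ibp_le (hf : VanishesAt f t s F γ) (hγ : 0 < γ) (hst : s ≤ t) :
    ‖ibp S D t s f‖ ≤ M * (1 + 1 / γ) * F * (t - s) ^ γ := by
  have hM := h.pos.le
  have e1 : ‖S (t - s) (f s)‖ ≤ M * (F * (t - s) ^ γ) :=
    (h.norm_S_apply_le (by linarith) _).trans (by
      gcongr; exact hf.norm_le s ⟨le_rfl, hst⟩)
  have e2 := norm_integral_le_sub_rpow hst (by linarith) fun r hr => hf.norm_D_le h hr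
  rw [sub_add_cancel] at e2
  calc _ ≤ _ := (norm_sub_le _ _).trans (add_le_add e1 e2)
    _ = _ := by ring

omit h in
theorem ibp_smul_add (c : ℝ) (hf : IntervalIntegrable (fun r => D (t - r) (f r)) volume s t)
    (hg : IntervalIntegrable (fun r => D (t - r) (g r)) volume s t) :
    ibp S D t s (fun r => c • f r + g r) = c • ibp S D t s f + ibp S D t s g := by
  simp only [ibp, map_add, map_smul]
  have hcf : IntervalIntegrable (fun r => c • D (t - r) (f r)) volume s t := hf.smul c
  rw [intervalIntegral.integral_add hcf hg, intervalIntegral.integral_smul]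
  simp only [smul_sub]
  abel

theorem integral_D_sub [CompleteSpace W] (hsu : s ≤ u) (hut : u < t) (x : W) :
    ∫ r in s..u, D (t - r) x = S (t - s) x - S (t - u) x := by
  have hmem : ∀ r ∈ uIcc s u, 0 < t - r := fun r hr => by
    rw [uIcc_of_le hsu] at hr
    linarith [hr.2]
  have hd : ∀ r ∈ uIcc s u, HasDerivAt (fun r => - S (t - r) x) (D (t - r) x) r := fun r hr => by
    have h1 : HasDerivAt (fun q => S q x) (D (t - r) x) (t - r) := h.hasDerivAt_apply (hmem r hr) x
    have h2 := (h1.comp_const_sub t r).neg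
    rw [neg_neg] at h2
    exact h2
  have hc : ContinuousOn (fun r => D (t - r) x) (uIcc s u) := by
    refine ContinuousOn.clm_apply ?_ continuousOn_const
    exact h.continuousOn_D.comp (by fun_prop) hmem
  rw [intervalIntegral.integral_eq_sub_of_hasDerivAt hd hc.intervalIntegrable]
  abel

/-- Splitting of the convolution at `u`, where `g` is the increment of `f` on `[s,u]`. All relations between
the supporting processes are instances of it. -/
theorem ibp_split [CompleteSpace W] (hγ : 0 < γ) (hsu : s ≤ u) (hut : u ≤ t)
    (hf : VanishesAt f t s F γ) {F' γ' : ℝ} (hγ' : 0 < γ') (hg : VanishesAt g u s F' γ')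
    (hfg : ∀ r ∈ Icc s u, f r = f u + g r) :
    ibp S D t s f = ibp S D t u f + S (t - u) (ibp S D u s g) := by
  rcases hut.eq_or_lt with rfl | hut'
  · have hfu := hf.eq_zero hγ hsu
    have hfg' : ∀ r ∈ Icc s u, f r = g r := fun r hr => by rw [hfg r hr, hfu, zero_add]
    have e1 : ibp S D u s f = ibp S D u s g := by
      unfold ibp
      rw [hfg' s ⟨le_rfl, hsu⟩]
      congr 1
      refine intervalIntegral.integral_congr fun r hr => ?_
      rw [uIcc_of_le hsu] at hr
      simp only [hfg' r hr]
    have e2 : ibp S D u u f = 0 := by simp [ibp, hfu]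
    rw [e1, e2, sub_self, h.S_zero_apply, zero_add]
  have hgu := hg.eq_zero hγ' hsu
  have hi := hf.intervalIntegrable h hγ (hsu.trans hut)
  have hi1 : IntervalIntegrable (fun r => D (t - r) (f r)) volume s u :=
    hi.mono_set (by rw [uIcc_of_le hsu, uIcc_of_le (hsu.trans hut)]; exact Icc_subset_Icc_right hut)
  have hi2 : IntervalIntegrable (fun r => D (t - r) (f r)) volume u t :=
    hi.mono_set (by rw [uIcc_of_le hut, uIcc_of_le (hsu.trans hut)]; exact Icc_subset_Icc_left hsu)
  have hig := hg.intervalIntegrable h hγ' hsu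
  have hic : IntervalIntegrable (fun r => D (t - r) (f u)) volume s u := by
    refine ContinuousOn.intervalIntegrable (ContinuousOn.clm_apply ?_ continuousOn_const)
    refine h.continuousOn_D.comp (by fun_prop) fun r hr => ?_
    rw [uIcc_of_le hsu] at hr
    exact sub_pos.2 (hr.2.trans_lt hut')
  have e2 : ∫ r in s..u, D (t - r) (f r) =
      (S (t - s) (f u) - S (t - u) (f u)) + S (t - u) (∫ r in s..u, D (u - r) (g r)) := by
    rw [← integral_D_sub h hsu hut', ← ContinuousLinearMap.intervalIntegral_comp_comm _ hig,
      ← intervalIntegral.integral_add hic (by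
        have := hig
        rw [intervalIntegrable_iff] at this ⊢
        exact (S (t - u)).integrable_comp this)]
    refine intervalIntegral.integral_congr fun r hr => ?_
    rw [uIcc_of_le hsu] at hr
    have e3 : D (t - r) (g r) = S (t - u) (D (u - r) (g r)) := by
      rcases hr.2.eq_or_lt with rfl | hlt
      · simp [hgu]
      · rw [← h.D_add_apply (by linarith) (by linarith)]; ring_nf
    simp only [hfg r hr, map_add, e3]
  have e4 : S (t - s) (g s) = S (t - u) (S (u - s) (g s)) := by
    rw [← h.S_add_apply (by linarith) (by linarith)]; ring_nf
  rw [ibp, ← intervalIntegral.integral_add_adjacent_intervals hi1 hi2, e2, hfg s ⟨le_rfl, hsu⟩,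
    map_add, e4, ibp, ibp, map_sub]
  abel

/-- The convolution gains `β` derivatives: `A S(σ)` of it has only the singularity `σ^{2β-1}`. -/
theorem norm_D_ibp_le [CompleteSpace W] (hβ : 0 < β) (hβ2 : 2 * β ≤ 1) (hβγ : β < γ)
    (hst : s ≤ t) (hF : 0 ≤ F) (hf : VanishesAt f t s F γ)
    (hreg : ∀ r ∈ Icc s t, ∀ τ : ℝ, 0 < τ → ‖D τ (f r)‖ ≤ F * (t - r) ^ γ * τ ^ (β - 1))
    {σ : ℝ} (hσ : 0 < σ) :
    ‖D σ (ibp S D t s f)‖ ≤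
      (1 + 8 * M / (γ - β)) * F * (t - s) ^ (γ - β) * σ ^ (2 * β - 1) := by
  have hM := h.pos.le
  rcases hst.eq_or_lt with rfl | hst'
  · have : f s = 0 := hf.eq_zero (hβ.trans hβγ) le_rfl
    simp [ibp, this, Real.zero_rpow (show γ - β ≠ 0 by linarith)]
  have hts : 0 < t - s := by linarith
  have e1 : ‖D σ (S (t - s) (f s))‖ ≤ F * (t - s) ^ (γ - β) * σ ^ (2 * β - 1) := by
    rw [← h.D_add_apply' hts.le hσ]
    refine (hreg s ⟨le_rfl, hst⟩ _ (by positivity)).trans ?_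
    have e : (t - s + σ) ^ (β - 1) ≤ (t - s) ^ (-β) * σ ^ (2 * β - 1) := by
      rw [show β - 1 = -β + (2 * β - 1) by ring, Real.rpow_add (by positivity)]
      gcongr ?_ * ?_
      · exact Real.rpow_le_rpow_of_nonpos hts (by linarith) (by linarith)
      · exact Real.rpow_le_rpow_of_nonpos hσ (by linarith) (by linarith)
    calc F * (t - s) ^ γ * (t - s + σ) ^ (β - 1)
        ≤ F * (t - s) ^ γ * ((t - s) ^ (-β) * σ ^ (2 * β - 1)) := by gcongr
      _ = F * ((t - s) ^ γ * (t - s) ^ (-β)) * σ ^ (2 * β - 1) := by ring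
      _ = _ := by rw [← Real.rpow_add hts]; ring_nf
  have hpt : ∀ r ∈ Ioo s t, ‖D σ (D (t - r) (f r))‖ ≤
      (8 * M * F * σ ^ (2 * β - 1)) * (t - r) ^ (γ - β - 1) := by
    intro r hr
    have hρ : 0 < t - r := by linarith [hr.2]
    set m := (σ + (t - r)) / 2 with hm
    have hmp : 0 < m := by positivity
    -- With `m` the mean of `σ` and `t - r`, `(A S(m))²` shares the total singularity `m^{β-2}` between `σ` and
    -- `t - r`.
    rw [h.D_comp_D hσ hρ]
    have a1 : m ^ (2 * β - 1) ≤ 2 * σ ^ (2 * β - 1) := by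
      calc m ^ (2 * β - 1) ≤ (2⁻¹ * σ) ^ (2 * β - 1) :=
            Real.rpow_le_rpow_of_nonpos (by positivity) (by linarith) (by linarith)
        _ = (2 : ℝ) ^ (1 - 2 * β) * σ ^ (2 * β - 1) := by
            rw [Real.mul_rpow (by norm_num) hσ.le, Real.inv_rpow two_pos.le, ← Real.rpow_neg two_pos.le]
            ring_nf
        _ ≤ 2 * σ ^ (2 * β - 1) := by
            gcongr
            calc (2 : ℝ) ^ (1 - 2 * β) ≤ 2 ^ (1 : ℝ) :=
                  Real.rpow_le_rpow_of_exponent_le one_le_two (by linarith)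
              _ = 2 := Real.rpow_one 2
    have a2 : m ^ (-1 - β) ≤ 4 * (t - r) ^ (-1 - β) := by
      calc m ^ (-1 - β) ≤ (2⁻¹ * (t - r)) ^ (-1 - β) :=
            Real.rpow_le_rpow_of_nonpos (by positivity) (by linarith) (by linarith)
        _ = (2 : ℝ) ^ (1 + β) * (t - r) ^ (-1 - β) := by
            rw [Real.mul_rpow (by norm_num) hρ.le, Real.inv_rpow two_pos.le, ← Real.rpow_neg two_pos.le]
            ring_nf
        _ ≤ 4 * (t - r) ^ (-1 - β) := by
            gcongr
            calc (2 : ℝ) ^ (1 + β) ≤ 2 ^ (2 : ℝ) :=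
                  Real.rpow_le_rpow_of_exponent_le one_le_two (by linarith)
              _ = 4 := by norm_num
    calc ‖D m (D m (f r))‖ ≤ M / m * (F * (t - r) ^ γ * m ^ (β - 1)) :=
          (h.norm_D_apply_le hmp _).trans (by
            gcongr; exact hreg r ⟨hr.1.le, hr.2.le⟩ m hmp)
      _ = M * F * (t - r) ^ γ * (m ^ (2 * β - 1) * m ^ (-1 - β)) := by
          rw [← Real.rpow_add hmp, show 2 * β - 1 + (-1 - β) = β - 1 - 1 by ring,
            Real.rpow_sub_one hmp.ne' (β - 1)]
          ring
      _ ≤ M * F * (t - r) ^ γ * ((2 * σ ^ (2 * β - 1)) * (4 * (t - r) ^ (-1 - β))) := by gcongr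
      _ = (8 * M * F * σ ^ (2 * β - 1)) * ((t - r) ^ γ * (t - r) ^ (-1 - β)) := by ring
      _ = _ := by rw [← Real.rpow_add hρ]; ring_nf
  have e2 := norm_integral_le_sub_rpow hst (by linarith) hpt
  rw [ContinuousLinearMap.intervalIntegral_comp_comm _
    (hf.intervalIntegrable h (hβ.trans hβγ) hst), sub_add_cancel] at e2
  rw [ibp, map_sub]
  calc _ ≤ _ := (norm_sub_le _ _).trans (add_le_add e1 e2)
    _ = _ := by ring

/-- On regular integrands the convolution is close to its first order approximation. -/
theorem norm_ibp_sub_le [CompleteSpace W] (hβ : 0 < β) (hγ : 0 < γ) (hst : s ≤ t)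
    (hf : VanishesAt f t s F γ)
    (hreg : ∀ r ∈ Icc s t, ∀ τ : ℝ, 0 < τ → ‖D τ (f r)‖ ≤ F * (t - r) ^ γ * τ ^ (β - 1)) :
    ‖ibp S D t s f - f s‖ ≤ (1 / β + 1 / (γ + β)) * F * (t - s) ^ (γ + β) := by
  rcases hst.eq_or_lt with rfl | hst'
  · have : f s = 0 := hf.eq_zero hγ le_rfl
    simp [ibp, this, Real.zero_rpow (show γ + β ≠ 0 by linarith)]
  have hts : 0 < t - s := by linarith
  have e1 := h.norm_S_sub_le hβ (fun σ hσ => hreg s ⟨le_rfl, hst⟩ σ hσ) hts.le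
  have e2 := norm_integral_le_sub_rpow (f := fun r => D (t - r) (f r)) (A := F) (γ := γ + β - 1)
    hst (by linarith) (fun r hr => by
      have hρ : 0 < t - r := by linarith [hr.2]
      refine (hreg r ⟨hr.1.le, hr.2.le⟩ _ hρ).trans (le_of_eq ?_)
      rw [mul_assoc, ← Real.rpow_add hρ]
      ring_nf)
  rw [sub_add_cancel] at e2
  have e3 : ibp S D t s f - f s = (S (t - s) (f s) - f s) - ∫ r in s..t, D (t - r) (f r) := by
    rw [ibp]; abel
  rw [e3]
  calc _ ≤ _ := (norm_sub_le _ _).trans (add_le_add e1 e2)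
    _ = _ := by rw [Real.rpow_add hts]; ring

end Lemmas

end Ibp

/-! ### The process `ω^S` -/

section OmegaS

variable {W : Type u} [NormedAddCommGroup W] [NormedSpace ℝ W]
  {V : Type v} [NormedAddCommGroup V] [NormedSpace ℝ V]

/-- `ω` is `α`-Hölder continuous on `[0,T]` with constant `L`. -/
def HolderPath (T α L : ℝ) (ω : ℝ → V) : Prop :=
  ∀ s t : ℝ, 0 ≤ s → s ≤ t → t ≤ T → ‖ω t - ω s‖ ≤ L * (t - s) ^ α

variable {T α L β κ : ℝ} {ω ω' : ℝ → V} {K K' : V →L[ℝ] W} {s u t : ℝ}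

theorem continuousOn_of_forall_le {X : Type*} [SeminormedAddCommGroup X] {f : ℝ → X} {a b : ℝ}
    (hα : 0 < α) (hf : ∀ s t : ℝ, a ≤ s → s ≤ t → t ≤ b → ‖f t - f s‖ ≤ L * (t - s) ^ α) :
    ContinuousOn f (Icc a b) := by
  intro t ht
  have hlim : Tendsto (fun r : ℝ => L * |r - t| ^ α) (𝓝[Icc a b] t) (𝓝 0) := by
    have : ContinuousAt (fun r : ℝ => L * |r - t| ^ α) t :=
      continuousAt_const.mul ((by fun_prop : ContinuousAt (fun r : ℝ => |r - t|) t).rpow_const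
        (Or.inr hα.le))
    simpa [ContinuousAt, Real.zero_rpow hα.ne'] using this.mono_left nhdsWithin_le_nhds
  refine tendsto_iff_norm_sub_tendsto_zero.2 (squeeze_zero' (Eventually.of_forall fun _ =>
    norm_nonneg _) ?_ hlim)
  filter_upwards [self_mem_nhdsWithin] with r hr
  rcases le_total r t with hrt | hrt
  · rw [norm_sub_rev, abs_sub_comm, abs_of_nonneg (sub_nonneg.2 hrt)]
    exact hf r t hr.1 hrt ht.2
  · rw [abs_of_nonneg (sub_nonneg.2 hrt)]
    exact hf t r ht.1 hrt hr.2

omit [NormedSpace ℝ V] in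
theorem HolderPath.continuousOn (hω : HolderPath T α L ω) (hα : 0 < α) :
    ContinuousOn ω (Icc 0 T) :=
  continuousOn_of_forall_le hα hω

omit [NormedSpace ℝ V] in
theorem HolderPath.nonneg (hω : HolderPath T α L ω) (hT : 0 < T) : 0 ≤ L := by
  have h1 := (norm_nonneg _).trans (hω 0 T le_rfl hT.le le_rfl)
  rw [sub_zero] at h1
  exact nonneg_of_mul_nonneg_left h1 (Real.rpow_pos_of_pos hT α)

theorem HolderPath.vanishesAt (hω : HolderPath T α L ω) (hα : 0 < α) (K : V →L[ℝ] W) (hs : 0 ≤ s)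
    (ht : t ≤ T) : VanishesAt (fun r => K (ω t - ω r)) t s (‖K‖ * L) α where
  cont := K.continuous.comp_continuousOn (continuousOn_const.sub
    ((hω.continuousOn hα).mono (Icc_subset_Icc hs ht)))
  norm_le r hr := by
    rw [mul_assoc]
    exact (K.le_opNorm _).trans (by gcongr; exact hω r t (hs.trans hr.1) hr.2 ht)

section

variable {S D : ℝ → W →L[ℝ] W} {M : ℝ} (h : SmoothingPair S D M)
include h

/-- At `r = t`, where `A S(0)` is not defined on all of `W`, both sides vanish. -/
theorem gen_S_sub_apply {f : ℝ → W} (hft : f t = 0) {r : ℝ} (hr : r ≤ t) :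
    gen S (S (t - r) (f r)) = D (t - r) (f r) := by
  rcases hr.eq_or_lt with rfl | hlt
  · simp [hft, gen_zero]
  · exact h.gen_eq (by linarith) _

theorem omegaS_eq_ibp (ω : ℝ → V) (hst : s ≤ t) (K : V →L[ℝ] W) :
    omegaS S ω t s K = ibp S D t s fun r => K (ω t - ω r) := by
  unfold omegaS ibp
  congr 1
  refine intervalIntegral.integral_congr fun r hr => ?_
  rw [uIcc_of_le hst] at hr
  exact gen_S_sub_apply h (f := fun r => K (ω t - ω r)) (by simp) hr.2

theorem omegaS_self (ω : ℝ → V) (K : V →L[ℝ] W) : omegaS S ω t t K = 0 := by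
  simp [omegaS_eq_ibp h ω le_rfl, ibp]

theorem norm_omegaS_le (hω : HolderPath T α L ω) (hα : 0 < α) (hs : 0 ≤ s) (hst : s ≤ t)
    (ht : t ≤ T) (K : V →L[ℝ] W) :
    ‖omegaS S ω t s K‖ ≤ M * (1 + 1 / α) * L * ‖K‖ * (t - s) ^ α := by
  rw [omegaS_eq_ibp h ω hst]
  exact (norm_ibp_le h (hω.vanishesAt hα K hs ht) hα hst).trans (le_of_eq (by ring))

theorem omegaS_split [CompleteSpace W] (hω : HolderPath T α L ω) (hα : 0 < α) (hs : 0 ≤ s)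
    (hsu : s ≤ u) (hut : u ≤ t) (ht : t ≤ T) (K : V →L[ℝ] W) :
    omegaS S ω t s K = omegaS S ω t u K + S (t - u) (omegaS S ω u s K) := by
  rw [omegaS_eq_ibp h ω hut, omegaS_eq_ibp h ω hsu, omegaS_eq_ibp h ω (hsu.trans hut)]
  refine ibp_split h hα hsu hut (hω.vanishesAt hα K hs ht) hα
    (hω.vanishesAt hα K hs (hut.trans ht)) fun r hr => ?_
  rw [← map_add]
  congr 1
  abel

theorem omegaS_smul_add (hω : HolderPath T α L ω) (hα : 0 < α) (hs : 0 ≤ s) (hst : s ≤ t)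
    (ht : t ≤ T) (c : ℝ) (K K' : V →L[ℝ] W) :
    omegaS S ω t s (c • K + K') = c • omegaS S ω t s K + omegaS S ω t s K' := by
  rw [omegaS_eq_ibp h ω hst, omegaS_eq_ibp h ω hst, omegaS_eq_ibp h ω hst]
  exact ibp_smul_add c ((hω.vanishesAt hα K hs ht).intervalIntegrable h hα hst)
    ((hω.vanishesAt hα K' hs ht).intervalIntegrable h hα hst)

theorem omegaS_add (hω : HolderPath T α L ω) (hα : 0 < α) (hs : 0 ≤ s) (hst : s ≤ t)
    (ht : t ≤ T) (K K' : V →L[ℝ] W) :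
    omegaS S ω t s (K + K') = omegaS S ω t s K + omegaS S ω t s K' := by
  simpa using omegaS_smul_add h hω hα hs hst ht 1 K K'

theorem omegaS_sub (hω : HolderPath T α L ω) (hα : 0 < α) (hs : 0 ≤ s) (hst : s ≤ t)
    (ht : t ≤ T) (K K' : V →L[ℝ] W) :
    omegaS S ω t s (K - K') = omegaS S ω t s K - omegaS S ω t s K' := by
  rw [eq_sub_iff_add_eq, ← omegaS_add h hω hα hs hst ht, sub_add_cancel]

theorem omegaS_path_sub {L' : ℝ} (hω : HolderPath T α L ω) (hω' : HolderPath T α L' ω') (hα : 0 < α)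
    (hs : 0 ≤ s) (hst : s ≤ t) (ht : t ≤ T) (K : V →L[ℝ] W) :
    omegaS S (fun r => ω r - ω' r) t s K = omegaS S ω t s K - omegaS S ω' t s K := by
  rw [omegaS_eq_ibp h _ hst, omegaS_eq_ibp h ω hst, omegaS_eq_ibp h ω' hst]
  have := ibp_smul_add (S := S) (-1 : ℝ)
    ((hω'.vanishesAt hα K hs ht).intervalIntegrable h hα hst)
    ((hω.vanishesAt hα K hs ht).intervalIntegrable h hα hst)
  rw [neg_one_smul, neg_add_eq_sub] at this
  rw [← this]
  congr 1
  ext r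
  simp only [map_sub, neg_smul, one_smul]
  abel

/-- For regular `K` the process `ω^S(K)` takes its values in `D_{2β}`, with a singular norm. -/
theorem norm_D_omegaS_le [CompleteSpace W] (hβ : 0 < β) (hβ2 : 2 * β ≤ 1) (hβα : β < α)
    (hω : HolderPath T α L ω) (hL : 0 ≤ L) (hK : RegularOp D β κ K) (hs : 0 ≤ s) (hst : s ≤ t)
    (ht : t ≤ T) {σ : ℝ} (hσ : 0 < σ) :
    ‖D σ (omegaS S ω t s K)‖ ≤
      (1 + 8 * M / (α - β)) * (κ * L) * (t - s) ^ (α - β) * σ ^ (2 * β - 1) := by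
  have hκ := hK.nonneg
  have hα := hβ.trans hβα
  rw [omegaS_eq_ibp h ω hst]
  refine norm_D_ibp_le h hβ hβ2 hβα hst (by positivity) ⟨(hω.vanishesAt hα K hs ht).cont,
    fun r hr => ?_⟩ (fun r hr τ hτ => ?_) hσ
  · rw [mul_assoc]
    exact (hK.norm_le _).trans (by gcongr; exact hω r t (hs.trans hr.1) hr.2 ht)
  · refine (hK.norm_D_le τ hτ _).trans ?_
    calc κ * τ ^ (β - 1) * ‖ω t - ω r‖ ≤ κ * τ ^ (β - 1) * (L * (t - r) ^ α) := by
          gcongr; exact hω r t (hs.trans hr.1) hr.2 ht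
      _ = _ := by ring

/-- For regular `K`, `ω^S(K)` is the increment `K δω` up to order `α + β`. -/
theorem norm_omegaS_sub_le [CompleteSpace W] (hβ : 0 < β) (hα : 0 < α)
    (hω : HolderPath T α L ω) (hK : RegularOp D β κ K) (hs : 0 ≤ s) (hst : s ≤ t)
    (ht : t ≤ T) :
    ‖omegaS S ω t s K - K (ω t - ω s)‖ ≤
      (1 / β + 1 / (α + β)) * (κ * L) * (t - s) ^ (α + β) := by
  have hκ := hK.nonneg
  rw [omegaS_eq_ibp h ω hst]
  refine norm_ibp_sub_le h hβ hα hst ⟨(hω.vanishesAt hα K hs ht).cont,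
    fun r hr => ?_⟩ (fun r hr τ hτ => ?_)
  · rw [mul_assoc]
    exact (hK.norm_le _).trans (by gcongr; exact hω r t (hs.trans hr.1) hr.2 ht)
  · refine (hK.norm_D_le τ hτ _).trans ?_
    calc κ * τ ^ (β - 1) * ‖ω t - ω r‖ ≤ κ * τ ^ (β - 1) * (L * (t - r) ^ α) := by
          gcongr; exact hω r t (hs.trans hr.1) hr.2 ht
      _ = _ := by ring

end

end OmegaS

/-! ### Contractions in the completed tensor products -/

section Contractions

variable {V : Type v} {W : Type u} [NormedAddCommGroup V] [NormedSpace ℝ V]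
  [NormedAddCommGroup W] [NormedSpace ℝ W] (N : TensorNorms V W)

/-- `(v, w) ↦ v ⊗ w` as a bounded bilinear map into the completed `V ⊗ V`. -/
noncomputable def TensorNorms.tmulVVL (N : TensorNorms V W) : V →L[ℝ] V →L[ℝ] N.VV :=
  LinearMap.mkContinuous₂
    ((TensorProduct.mk ℝ V V).compr₂
      (show V ⊗[ℝ] V →ₗ[ℝ] N.VV from
        (UniformSpace.Completion.toComplL (𝕜 := ℝ) (E := SeminormedBy N.normVV)).toLinearMap))
    1 (fun x v => by
      have h := UniformSpace.Completion.norm_coe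
        (show SeminormedBy N.normVV from x ⊗ₜ[ℝ] v)
      have h2 := N.normVV_tmul x v
      rw [one_mul]
      exact (h.trans h2).le)

theorem tmulVVL_apply (v w : V) : N.tmulVVL v w = N.tmulVV v w := rfl

theorem norm_tmulVV (v w : V) : ‖N.tmulVV v w‖ = ‖v‖ * ‖w‖ :=
  (UniformSpace.Completion.norm_coe (show SeminormedBy N.normVV from v ⊗ₜ[ℝ] w)).trans
    (N.normVV_tmul v w)

theorem norm_tmulWV_le (x : W) : ‖N.tmulWV x‖ ≤ ‖x‖ := by
  have h1 : ‖N.tmulWV‖ ≤ 1 := LinearMap.mkContinuous₂_norm_le _ zero_le_one _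
  simpa using N.tmulWV.le_of_opNorm_le h1 x

theorem mapId_coe (K : V →L[ℝ] W) (z : SeminormedBy N.normVV) :
    N.mapId K (z : N.VV) = ((N.mapIdAlg K z : SeminormedBy N.normWV) : N.WV) := by
  unfold TensorNorms.mapId
  exact ContinuousLinearMap.extend_eq _ UniformSpace.Completion.denseRange_coe
    (UniformSpace.Completion.isUniformInducing_coe _) z

theorem mapId_tmulVV (K : V →L[ℝ] W) (v w : V) :
    N.mapId K (N.tmulVV v w) = N.tmulWV (K v) w := by
  unfold TensorNorms.tmulVV
  rw [mapId_coe]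
  rfl

theorem norm_mapId_apply_le (K : V →L[ℝ] W) (z : N.VV) : ‖N.mapId K z‖ ≤ ‖K‖ * ‖z‖ := by
  induction z using UniformSpace.Completion.induction_on with
  | hp => exact isClosed_le (by fun_prop) (by fun_prop)
  | ih z =>
    rw [mapId_coe, UniformSpace.Completion.norm_coe, UniformSpace.Completion.norm_coe]
    exact N.map_le K z

theorem mapId_smul_add (c : ℝ) (K K' : V →L[ℝ] W) (z : N.VV) :
    N.mapId (c • K + K') z = c • N.mapId K z + N.mapId K' z := by
  induction z using UniformSpace.Completion.induction_on with
  | hp =>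
    exact isClosed_eq (N.mapId _).continuous
      (((N.mapId K).continuous.const_smul c).add (N.mapId K').continuous)
  | ih z =>
    rw [mapId_coe, mapId_coe, mapId_coe, ← UniformSpace.Completion.coe_smul,
      ← UniformSpace.Completion.coe_add]
    congr 1
    have : TensorProduct.map ((c • K + K' : V →L[ℝ] W) : V →ₗ[ℝ] W) (LinearMap.id (M := V)) =
        c • TensorProduct.map (K : V →ₗ[ℝ] W) LinearMap.id +
          TensorProduct.map (K' : V →ₗ[ℝ] W) LinearMap.id := by
      rw [← TensorProduct.map_smul_left, ← TensorProduct.map_add_left]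
      rfl
    exact LinearMap.congr_fun this z

variable {N}

theorem contract_apply (E : N.WV →L[ℝ] W) (x : W) (v : V) :
    contract N E x v = E (N.tmulWV x v) := rfl

theorem contract_add (E : N.WV →L[ℝ] W) (x y : W) :
    contract N E (x + y) = contract N E x + contract N E y := by
  ext v; simp [contract_apply]

theorem contract_smul (E : N.WV →L[ℝ] W) (c : ℝ) (x : W) :
    contract N E (c • x) = c • contract N E x := by
  ext v; simp [contract_apply]

theorem contract_sub (E : N.WV →L[ℝ] W) (x y : W) :
    contract N E (x - y) = contract N E x - contract N E y := by
  ext v; simp [contract_apply]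

theorem contract_zero (E : N.WV →L[ℝ] W) : contract N E 0 = 0 := by
  ext v; simp [contract_apply]

theorem contract_op_smul_add (c : ℝ) (E E' : N.WV →L[ℝ] W) (x : W) :
    contract N (c • E + E') x = c • contract N E x + contract N E' x := by
  ext v; simp [contract_apply]

theorem norm_contract_le (E : N.WV →L[ℝ] W) (x : W) : ‖contract N E x‖ ≤ ‖E‖ * ‖x‖ :=
  (ContinuousLinearMap.opNorm_comp_le _ _).trans (by gcongr; exact norm_tmulWV_le N x)

theorem contractOp_apply (E : N.WV →L[ℝ] W) (K : V →L[ℝ] W) (z : N.VV) :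
    contractOp N E K z = E (N.mapId K z) := rfl

theorem contractOp_tmulVV (E : N.WV →L[ℝ] W) (K : V →L[ℝ] W) (v w : V) :
    contractOp N E K (N.tmulVV v w) = contract N E (K v) w := by
  rw [contractOp_apply, mapId_tmulVV, contract_apply]

theorem norm_contractOp_apply_le (E : N.WV →L[ℝ] W) {K : V →L[ℝ] W} {κ : ℝ}
    (hκ : 0 ≤ κ) (hK : ∀ v, ‖K v‖ ≤ κ * ‖v‖) (z : N.VV) :
    ‖contractOp N E K z‖ ≤ ‖E‖ * κ * ‖z‖ := by
  rw [contractOp_apply, mul_assoc]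
  refine (E.le_opNorm _).trans ?_
  gcongr
  exact (norm_mapId_apply_le N K z).trans (by
    gcongr; exact K.opNorm_le_bound hκ hK)

theorem contractOp_smul_add (E : N.WV →L[ℝ] W) (c : ℝ) (K K' : V →L[ℝ] W) (z : N.VV) :
    contractOp N E (c • K + K') z = c • contractOp N E K z + contractOp N E K' z := by
  simp [contractOp_apply, mapId_smul_add]

end Contractions

/-! ### The process `c` -/

section ProcessC

variable {V : Type v} {W : Type u} [NormedAddCommGroup V] [NormedSpace ℝ V]
  [NormedAddCommGroup W] [NormedSpace ℝ W]

/-- A rough path together with Hölder constants `L` and `L₂` of its two levels. -/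
structure RoughBound (N : TensorNorms V W) (T α L L₂ : ℝ) (ω : ℝ → V) (ω₂ : ℝ → ℝ → N.VV) :
    Prop where
  path : HolderPath T α L ω
  area : ∀ s t : ℝ, 0 ≤ s → s ≤ t → t ≤ T → ‖ω₂ t s‖ ≤ L₂ * (t - s) ^ (2 * α)
  chen : ∀ s r t : ℝ, 0 ≤ s → s ≤ r → r ≤ t → t ≤ T →
    ω₂ t s - ω₂ r s - ω₂ t r = N.tmulVV (ω r - ω s) (ω t - ω r)

variable {N : TensorNorms V W} {T α L L₂ β κ : ℝ} {ω : ℝ → V} {ω₂ : ℝ → ℝ → N.VV}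
  {s u t : ℝ}

theorem RoughBound.zero (N : TensorNorms V W) (T α : ℝ) {L L₂ : ℝ} (hL : 0 ≤ L) (hL₂ : 0 ≤ L₂) :
    RoughBound N T α L L₂ (fun _ => (0 : V)) (fun _ _ => 0) where
  path s t _ hst _ := by
    simpa using mul_nonneg hL (Real.rpow_nonneg (sub_nonneg.2 hst) α)
  area s t _ hst _ := by
    simpa using mul_nonneg hL₂ (Real.rpow_nonneg (sub_nonneg.2 hst) (2 * α))
  chen s r t _ _ _ _ := by simp [← tmulVVL_apply]

theorem RoughBound.area_nonneg (hR : RoughBound N T α L L₂ ω ω₂) (hT : 0 < T) : 0 ≤ L₂ := by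
  have h1 := (norm_nonneg _).trans (hR.area 0 T le_rfl hT.le le_rfl)
  rw [sub_zero] at h1
  exact nonneg_of_mul_nonneg_left h1 (Real.rpow_pos_of_pos hT (2 * α))

theorem rpow_le_rpow_sub_mul {x T a b : ℝ} (ha : 0 < a) (hab : a ≤ b) (hx : 0 ≤ x) (hxT : x ≤ T) :
    x ^ b ≤ T ^ (b - a) * x ^ a := by
  rcases hx.eq_or_lt with rfl | hx
  · rw [Real.zero_rpow (by linarith), Real.zero_rpow ha.ne', mul_zero]
  · calc x ^ b = x ^ (b - a) * x ^ a := by rw [← Real.rpow_add hx]; ring_nf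
      _ ≤ _ := by gcongr

theorem RoughBound.continuousOn_coArea (hR : RoughBound N T α L L₂ ω ω₂) (hT : 0 < T) (hα : 0 < α)
    (ht : t ≤ T) : ContinuousOn (fun r => coArea N ω ω₂ t r) (Icc 0 t) := by
  have hL := hR.path.nonneg hT
  have hL₂ := hR.area_nonneg hT
  have hω : ContinuousOn ω (Icc 0 t) := (hR.path.continuousOn hα).mono (Icc_subset_Icc_right ht)
  have h1 : ContinuousOn (fun r => N.tmulVVL (ω t - ω r) (ω t - ω r)) (Icc 0 t) :=
    (N.tmulVVL.continuous.comp_continuousOn (continuousOn_const.sub hω)).clm_apply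
      (continuousOn_const.sub hω)
  refine h1.sub (continuousOn_of_forall_le (L := L₂ * T ^ α + L * (L * T ^ α)) hα
    fun r r' hr hrr' hr't => ?_)
  have e : ω₂ t r' - ω₂ t r = -(ω₂ r' r + N.tmulVV (ω r' - ω r) (ω t - ω r')) := by
    rw [← hR.chen r r' t hr hrr' hr't ht]; abel
  have hd : 0 ≤ r' - r := by linarith
  have e1 := hR.area r r' hr hrr' (hr't.trans ht)
  have e2 := hR.path r r' hr hrr' (hr't.trans ht)
  have e3 := hR.path r' t (hr.trans hrr') hr't ht
  have e4 : (r' - r) ^ (2 * α) ≤ T ^ α * (r' - r) ^ α := by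
    have := rpow_le_rpow_sub_mul (T := T) (a := α) (b := 2 * α) hα (by linarith) hd (by linarith)
    rwa [show 2 * α - α = α by ring] at this
  have e5 : (t - r') ^ α ≤ T ^ α :=
    Real.rpow_le_rpow (by linarith) (by linarith) hα.le
  rw [e, norm_neg]
  calc _ ≤ ‖ω₂ r' r‖ + ‖ω r' - ω r‖ * ‖ω t - ω r'‖ := by
        rw [← norm_tmulVV N]; exact norm_add_le _ _
    _ ≤ L₂ * (T ^ α * (r' - r) ^ α) + (L * (r' - r) ^ α) * (L * T ^ α) := by
        gcongr
        · exact e1.trans (by gcongr)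
        · exact e3.trans (by gcongr)
    _ = _ := by ring

theorem RoughBound.norm_coArea_le (hR : RoughBound N T α L L₂ ω ω₂) (hT : 0 < T)
    (hs : 0 ≤ s) (hst : s ≤ t) (ht : t ≤ T) :
    ‖coArea N ω ω₂ t s‖ ≤ (L * L + L₂) * (t - s) ^ (2 * α) := by
  have hL := hR.path.nonneg hT
  have e2 := hR.path s t hs hst ht
  have e0 : (t - s) ^ (2 * α) = (t - s) ^ α * (t - s) ^ α := by
    rw [mul_comm 2 α, Real.rpow_mul (by linarith), Real.rpow_two, sq]
  have e3 : ‖ω t - ω s‖ * ‖ω t - ω s‖ ≤ (L * (t - s) ^ α) * (L * (t - s) ^ α) := by gcongr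
  calc _ ≤ ‖ω t - ω s‖ * ‖ω t - ω s‖ + ‖ω₂ t s‖ := by
        rw [← norm_tmulVV N]; exact norm_sub_le _ _
    _ ≤ L * L * (t - s) ^ (2 * α) + L₂ * (t - s) ^ (2 * α) := by
        refine add_le_add (e3.trans (le_of_eq ?_)) (hR.area s t hs hst ht)
        rw [e0]; ring
    _ = _ := by ring

theorem RoughBound.vanishesAt (hR : RoughBound N T α L L₂ ω ω₂) (hT : 0 < T) (hα : 0 < α)
    (E : N.WV →L[ℝ] W) (K : V →L[ℝ] W) (hs : 0 ≤ s) (ht : t ≤ T) :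
    VanishesAt (fun r => contractOp N E K (coArea N ω ω₂ t r)) t s (‖E‖ * ‖K‖ * (L * L + L₂))
      (2 * α) where
  cont := (contractOp N E K).continuous.comp_continuousOn
    ((hR.continuousOn_coArea hT hα ht).mono (Icc_subset_Icc_left hs))
  norm_le r hr := by
    rw [mul_assoc]
    exact (norm_contractOp_apply_le E (norm_nonneg K) K.le_opNorm _).trans (by
      gcongr; exact hR.norm_coArea_le hT (hs.trans hr.1) hr.2 ht)

/-- Chen's relation for `ω̃`. -/
theorem RoughBound.coArea_add (hR : RoughBound N T α L L₂ ω ω₂) (hs : 0 ≤ s) (hsu : s ≤ u)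
    (hut : u ≤ t) (ht : t ≤ T) :
    coArea N ω ω₂ t s =
      coArea N ω ω₂ t u + (coArea N ω ω₂ u s + N.tmulVV (ω t - ω u) (ω u - ω s)) := by
  have hc : ω₂ t s = N.tmulVV (ω u - ω s) (ω t - ω u) + ω₂ u s + ω₂ t u := by
    rw [← hR.chen s u t hs hsu hut ht]; abel
  simp only [coArea, hc, ← tmulVVL_apply, map_sub, sub_apply]
  abel

section

variable {S D : ℝ → W →L[ℝ] W} {M : ℝ} (h : SmoothingPair S D M)
include h

theorem processC_eq (hR : RoughBound N T α L L₂ ω ω₂) (hT : 0 < T) (hα : 0 < α)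
    (hs : 0 ≤ s) (hst : s ≤ t) (ht : t ≤ T) (E : N.WV →L[ℝ] W) (K : V →L[ℝ] W) :
    processC S N ω ω₂ t s E K = omegaS S ω t s (contract N E (K (ω t - ω s))) -
      ibp S D t s fun r => contractOp N E K (coArea N ω ω₂ t r) := by
  have hz := (hR.vanishesAt hT hα E K hs ht).eq_zero (by linarith) hst
  have e : ∫ r in s..t, gen S (S (t - r) (contractOp N E K (coArea N ω ω₂ t r))) =
      ∫ r in s..t, D (t - r) (contractOp N E K (coArea N ω ω₂ t r)) := by
    refine intervalIntegral.integral_congr fun r hr => ?_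
    rw [uIcc_of_le hst] at hr
    exact gen_S_sub_apply h (f := fun r => contractOp N E K (coArea N ω ω₂ t r)) hz hr.2
  rw [processC, e, ibp]
  abel

/-- `(δ̂₂ c)_{tus} = ω^S_{tu}(E K (ω_u - ω_s))`. -/
theorem hatDelta₂_processC [CompleteSpace W] (hR : RoughBound N T α L L₂ ω ω₂) (hT : 0 < T)
    (hα : 0 < α) (hs : 0 ≤ s) (hsu : s ≤ u) (hut : u ≤ t) (ht : t ≤ T)
    (E : N.WV →L[ℝ] W) (K : V →L[ℝ] W) :
    hatDelta₂ S (fun t s => processC S N ω ω₂ t s E K) t u s =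
      omegaS S ω t u (contract N E (K (ω u - ω s))) := by
  have hu := hs.trans hsu
  have hst := hsu.trans hut
  have huT := hut.trans ht
  have hα2 : 0 < 2 * α := by linarith
  set e : V →L[ℝ] W := contract N E (K (ω t - ω u)) with he
  have hω := hR.path
  have v1 := hR.vanishesAt hT hα E K hs huT
  have v2 := hω.vanishesAt hα e hs huT
  -- On `[s,u]` the integrand `E K ω̃_{tr}` has the increment `E K ω̃_{ur} + E K ((ω_t - ω_u) ⊗ (ω_u - ω_r))`.
  have hL := hω.nonneg hT
  have hL₂ := hR.area_nonneg hT
  have v3 : VanishesAt (fun r => (1 : ℝ) • contractOp N E K (coArea N ω ω₂ u r) + e (ω u - ω r)) u s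
      (‖E‖ * ‖K‖ * (L * L + L₂) * T ^ α + ‖e‖ * L) α := by
    refine ⟨(v1.cont.const_smul (1 : ℝ)).add v2.cont, fun r hr => ?_⟩
    have hd : 0 ≤ u - r := by linarith [hr.2]
    have e4 : (u - r) ^ (2 * α) ≤ T ^ α * (u - r) ^ α := by
      have := rpow_le_rpow_sub_mul (T := T) (a := α) (b := 2 * α) hα (by linarith) hd
        (by linarith [hr.1])
      rwa [show 2 * α - α = α by ring] at this
    rw [one_smul]
    calc _ ≤ _ := (norm_add_le _ _).trans (add_le_add (v1.norm_le r hr) (v2.norm_le r hr))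
      _ ≤ ‖E‖ * ‖K‖ * (L * L + L₂) * (T ^ α * (u - r) ^ α) + ‖e‖ * L * (u - r) ^ α := by gcongr
      _ = _ := by ring
  have hsplit := ibp_split h hα2 hsu hut (hR.vanishesAt hT hα E K hs ht) hα v3 fun r hr => by
    rw [hR.coArea_add (hs.trans hr.1) hr.2 hut ht, map_add, map_add, contractOp_tmulVV, one_smul]
  rw [ibp_smul_add 1 (v1.intervalIntegrable h hα2 hsu) (v2.intervalIntegrable h hα hsu), one_smul,
    ← omegaS_eq_ibp h ω hsu e] at hsplit
  rw [hatDelta₂, processC_eq h hR hT hα hs hst ht, processC_eq h hR hT hα hu hut ht,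
    processC_eq h hR hT hα hs hsu huT, hsplit, omegaS_split h hω hα hs hsu hut ht]
  have ea : contract N E (K (ω t - ω s)) = e + contract N E (K (ω u - ω s)) := by
    rw [← contract_add, ← map_add]
    congr 2
    abel
  rw [← he]
  clear_value e
  rw [ea, omegaS_add h hω hα hu hut ht, omegaS_add h hω hα hs hsu huT]
  simp only [map_add, map_sub]
  abel

end

end ProcessC

/-! ### The process `b` and its dependence on the rough path -/

section ProcessB

variable {V : Type v} {W : Type u} [NormedAddCommGroup V] [NormedSpace ℝ V]
  [NormedAddCommGroup W] [NormedSpace ℝ W]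

/-- The constant of the convolution estimate `‖ω^S_{ts}(K)‖ ≤ C |||ω|||_α ‖K‖ (t-s)^α`. -/
noncomputable def convConst (M α : ℝ) : ℝ := M * (1 + 1 / α)

/-- The constant in the bound of `remainder`. -/
noncomputable def remConst (M T α β : ℝ) : ℝ :=
  T ^ (α - β) * (1 / β + 1 / (α + β) + (1 + 8 * M / (α - β)) / (2 * β))

/-- The constant in the Lipschitz dependence of `c` on the rough path. -/
noncomputable def processCConst (M α : ℝ) : ℝ := 2 * convConst M α + 2 * convConst M (2 * α)

/-- The constant in the Lipschitz dependence of `b` on the rough path. -/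
noncomputable def processBConst (M T α β : ℝ) : ℝ :=
  sewConst M (α + 2 * β) * (2 * convConst M α * remConst M T α β) * T ^ (α + 2 * β - 2 * α) +
    processCConst M α

/-- `ω^S_{us}(K) - ω^S_{τs}(K) - K (ω_u - ω_τ)`. -/
noncomputable def remainder (S : ℝ → W →L[ℝ] W) (ω : ℝ → V) (s u τ : ℝ) (K : V →L[ℝ] W) : W :=
  omegaS S ω u s K - omegaS S ω τ s K - K (ω u - ω τ)

variable {N : TensorNorms V W} {T α L L₂ β κ : ℝ} {ω ω' : ℝ → V} {ω₂ ω₂' : ℝ → ℝ → N.VV}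
  {s τ u t : ℝ} {S D : ℝ → W →L[ℝ] W} {M : ℝ}

theorem convConst_nonneg (hM : 0 ≤ M) (hα : 0 < α) : 0 ≤ convConst M α := by
  unfold convConst; positivity

theorem remConst_nonneg (hM : 0 ≤ M) (hT : 0 ≤ T) (hβ : 0 < β) (hβα : β < α) :
    0 ≤ remConst M T α β := by
  have : 0 < α - β := by linarith
  have : 0 < α := by linarith
  unfold remConst; positivity

theorem processCConst_nonneg (hM : 0 ≤ M) (hα : 0 < α) : 0 ≤ processCConst M α := by
  have := convConst_nonneg hM hα
  have := convConst_nonneg hM (show 0 < 2 * α by linarith)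
  unfold processCConst; positivity

theorem processBConst_nonneg (hM : 0 ≤ M) (hT : 0 ≤ T) (hβ : 0 < β) (hβα : β < α)
    (hρ : 1 < α + 2 * β) : 0 ≤ processBConst M T α β := by
  have := convConst_nonneg hM (hβ.trans hβα)
  have := remConst_nonneg hM hT hβ hβα
  have := processCConst_nonneg hM (hβ.trans hβα)
  have := sewConst_nonneg hM hρ
  unfold processBConst; positivity

theorem IsSewing.smul_add {Ξ Ξ' : ℝ → ℝ → W} {ρ : ℝ} {y y' : ℝ → W} (hy : IsSewing S Ξ s T α ρ y)
    (hy' : IsSewing S Ξ' s T α ρ y') (c : ℝ) :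
    IsSewing S (fun t τ => c • Ξ t τ + Ξ' t τ) s T α ρ (fun t => c • y t + y' t) := by
  obtain ⟨h1, h2, C, hC⟩ := hy
  obtain ⟨h1', h2', C', hC'⟩ := hy'
  refine ⟨(h1.const_smul c).add h1', by simp [h2, h2'], |c| * C + C', fun r t hr hrt ht => ?_⟩
  have e1 : hatDelta S (fun t => c • y t + y' t) t r = c • hatDelta S y t r + hatDelta S y' t r := by
    simp only [hatDelta, map_add, map_smul, smul_sub]; abel
  have e2 : hatDelta S (fun t => c • y t + y' t) t r - (c • Ξ t r + Ξ' t r) =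
      c • (hatDelta S y t r - Ξ t r) + (hatDelta S y' t r - Ξ' t r) := by
    rw [e1, smul_sub]; abel
  obtain ⟨a1, a2⟩ := hC r t hr hrt ht
  obtain ⟨b1, b2⟩ := hC' r t hr hrt ht
  rw [e2, e1]
  constructor
  · refine (norm_add_le _ _).trans ?_
    rw [norm_smul, Real.norm_eq_abs, add_mul, mul_assoc]
    gcongr
  · refine (norm_add_le _ _).trans ?_
    rw [norm_smul, Real.norm_eq_abs, add_mul, mul_assoc]
    gcongr

theorem IsSewing.congr {Ξ Ξ' : ℝ → ℝ → W} {ρ : ℝ} {y : ℝ → W} (hy : IsSewing S Ξ s T α ρ y)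
    (hΞ : ∀ r t : ℝ, s ≤ r → r ≤ t → t ≤ T → Ξ t r = Ξ' t r) : IsSewing S Ξ' s T α ρ y := by
  obtain ⟨h1, h2, C, hC⟩ := hy
  refine ⟨h1, h2, C, fun r t hr hrt ht => ?_⟩
  rw [← hΞ r t hr hrt ht]
  exact hC r t hr hrt ht

theorem xiB_zero (S : ℝ → W →L[ℝ] W) (N : TensorNorms V W) (E : N.WV →L[ℝ] W) (K : V →L[ℝ] W)
    (s : ℝ) : xiB S N (fun _ => (0 : V)) (fun _ _ => 0) E K s = fun _ _ => 0 := by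
  ext t τ
  have h1 : ∀ (t s : ℝ) (K : V →L[ℝ] W), omegaS S (fun _ => (0 : V)) t s K = 0 := fun t s K => by
    simp [omegaS, gen_zero]
  have h2 : ∀ r, coArea N (fun _ => (0 : V)) (fun _ _ => (0 : N.VV)) t r = 0 := fun r => by
    simp [coArea, ← tmulVVL_apply]
  simp [xiB, processC, h1, h2, gen_zero]

variable (h : SmoothingPair S D M)
include h

/-- The remainder is of order `2β`: it consists of the first order error of `ω^S_{uτ}(K)` and of the
increment of the orbit of `ω^S_{τs}(K) ∈ D_{2β}`. -/
theorem norm_remainder_le [CompleteSpace W] (hβ : 0 < β) (hβ2 : 2 * β ≤ 1) (hβα : β < α)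
    (hω : HolderPath T α L ω) (hL : 0 ≤ L) {K : V →L[ℝ] W} (hK : RegularOp D β κ K) (hs : 0 ≤ s)
    (hsτ : s ≤ τ) (hτu : τ ≤ u) (hu : u ≤ T) :
    ‖remainder S ω s u τ K‖ ≤ remConst M T α β * (κ * L) * (u - τ) ^ (2 * β) := by
  have hα := hβ.trans hβα
  have hM := h.pos.le
  have hκ := hK.nonneg
  have hαβ : 0 < α - β := by linarith
  have e0 : remainder S ω s u τ K = (omegaS S ω u τ K - K (ω u - ω τ)) +
      (S (u - τ) (omegaS S ω τ s K) - omegaS S ω τ s K) := by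
    rw [remainder, omegaS_split h hω hα hs hsτ hτu hu]; abel
  have e1 := norm_omegaS_sub_le h hβ hα hω hK (hs.trans hsτ) hτu hu
  have e2 := h.norm_S_sub_le (γ := 2 * β) (by linarith) (fun σ hσ =>
    norm_D_omegaS_le h hβ hβ2 hβα hω hL hK hs hsτ (hτu.trans hu) hσ) (sub_nonneg.2 hτu)
  have e3 : (u - τ) ^ (α + β) ≤ T ^ (α - β) * (u - τ) ^ (2 * β) := by
    have := rpow_le_rpow_sub_mul (T := T) (x := u - τ) (a := 2 * β) (b := α + β) (by linarith)
      (by linarith) (by linarith) (by linarith)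
    rwa [show α + β - 2 * β = α - β by ring] at this
  have e4 : (τ - s) ^ (α - β) ≤ T ^ (α - β) :=
    Real.rpow_le_rpow (by linarith) (by linarith) hαβ.le
  have hn : 0 ≤ (u - τ) ^ (2 * β) := Real.rpow_nonneg (by linarith) _
  rw [e0]
  calc _ ≤ _ := (norm_add_le _ _).trans (add_le_add e1 e2)
    _ ≤ (1 / β + 1 / (α + β)) * (κ * L) * (T ^ (α - β) * (u - τ) ^ (2 * β)) +
        (1 + 8 * M / (α - β)) * (κ * L) * T ^ (α - β) / (2 * β) * (u - τ) ^ (2 * β) := by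
      gcongr
    _ = _ := by unfold remConst; ring

theorem remainder_path_sub {L' : ℝ} (hω : HolderPath T α L ω) (hω' : HolderPath T α L' ω')
    (hα : 0 < α) (hs : 0 ≤ s) (hsτ : s ≤ τ) (hτu : τ ≤ u) (hu : u ≤ T) (K : V →L[ℝ] W) :
    remainder S (fun r => ω r - ω' r) s u τ K = remainder S ω s u τ K - remainder S ω' s u τ K := by
  simp only [remainder, omegaS_path_sub h hω hω' hα hs (hsτ.trans hτu) hu,
    omegaS_path_sub h hω hω' hα hs hsτ (hτu.trans hu), map_sub]
  abel

/-- In the defect of `Ξ^{(b),s}`, the first order part of the increment of `ω^S_{·s}(K)` cancels against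
the defect of `c`. -/
theorem hatDelta₂_xiB [CompleteSpace W] (hR : RoughBound N T α L L₂ ω ω₂) (hT : 0 < T)
    (hα : 0 < α) (hs : 0 ≤ s) (hsτ : s ≤ τ) (hτu : τ ≤ u) (hut : u ≤ t) (ht : t ≤ T)
    (E : N.WV →L[ℝ] W) (K : V →L[ℝ] W) :
    hatDelta₂ S (xiB S N ω ω₂ E K s) t u τ =
      - omegaS S ω t u (contract N E (remainder S ω s u τ K)) := by
  have hτ := hs.trans hsτ
  have h1 := hatDelta₂_processC h hR hT hα hτ hτu hut ht E K
  have h2 := omegaS_split h hR.path hα hτ hτu hut ht (contract N E (omegaS S ω τ s K))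
  rw [remainder, contract_sub, contract_sub, omegaS_sub h hR.path hα (hτ.trans hτu) hut ht,
    omegaS_sub h hR.path hα (hτ.trans hτu) hut ht, ← h1]
  simp only [hatDelta₂, xiB, map_add, h2]
  abel

/-- The defect of `Ξ^{(b),s}` is Lipschitz in the path; it does not see the area. -/
theorem defectBound_xiB_sub [CompleteSpace W] (hβ : 0 < β) (hβ2 : 2 * β ≤ 1) (hβα : β < α)
    {L₂' ε : ℝ} (hT : 0 < T) (hR : RoughBound N T α L L₂ ω ω₂) (hR' : RoughBound N T α L L₂' ω' ω₂')
    (hd : HolderPath T α ε fun r => ω r - ω' r) (E : N.WV →L[ℝ] W) {K : V →L[ℝ] W}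
    (hK : RegularOp D β κ K) (hs : 0 ≤ s) :
    DefectBound S (fun t τ => xiB S N ω ω₂ E K s t τ - xiB S N ω' ω₂' E K s t τ) s T
      (2 * convConst M α * remConst M T α β * (‖E‖ * κ * (L * ε))) (α + 2 * β) := by
  intro τ u t hsτ hτu hut ht
  have hα := hβ.trans hβα
  have hL := hR.path.nonneg hT
  have hε := hd.nonneg hT
  have hκ := hK.nonneg
  have hτ := hs.trans hsτ
  have hu := hτ.trans hτu
  have huT := hut.trans ht
  have hM := h.pos.le
  have hC := convConst_nonneg hM hα
  have hC' := remConst_nonneg hM hT.le hβ hβα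
  have e0 : hatDelta₂ S (fun t τ => xiB S N ω ω₂ E K s t τ - xiB S N ω' ω₂' E K s t τ) t u τ =
      - (omegaS S (fun r => ω r - ω' r) t u (contract N E (remainder S ω s u τ K)) +
        omegaS S ω' t u (contract N E (remainder S (fun r => ω r - ω' r) s u τ K))) := by
    rw [omegaS_path_sub h hR.path hR'.path hα hu hut ht,
      remainder_path_sub h hR.path hR'.path hα hs hsτ hτu huT, contract_sub,
      omegaS_sub h hR'.path hα hu hut ht]
    have h1 := hatDelta₂_xiB h hR hT hα hs hsτ hτu hut ht E K
    have h2 := hatDelta₂_xiB h hR' hT hα hs hsτ hτu hut ht E K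
    calc _ = hatDelta₂ S (xiB S N ω ω₂ E K s) t u τ - hatDelta₂ S (xiB S N ω' ω₂' E K s) t u τ := by
          simp only [hatDelta₂, map_sub]; abel
      _ = _ := by rw [h1, h2]; abel
  have f1 := norm_remainder_le h hβ hβ2 hβα hR.path hL hK hs hsτ hτu huT
  have f2 := norm_remainder_le h hβ hβ2 hβα hd hε hK hs hsτ hτu huT
  have htτ : 0 ≤ t - τ := by linarith
  have ht' : 0 ≤ t - u := by linarith
  have hu' : 0 ≤ u - τ := by linarith
  have p1 : (t - u) ^ α ≤ (t - τ) ^ α := Real.rpow_le_rpow ht' (by linarith) hα.le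
  have p2 : (u - τ) ^ (2 * β) ≤ (t - τ) ^ (2 * β) :=
    Real.rpow_le_rpow hu' (by linarith) (by linarith)
  have g1 : ‖contract N E (remainder S ω s u τ K)‖ ≤
      ‖E‖ * (remConst M T α β * (κ * L) * (t - τ) ^ (2 * β)) :=
    (norm_contract_le _ _).trans (by gcongr; exact f1.trans (by gcongr))
  have g2 : ‖contract N E (remainder S (fun r => ω r - ω' r) s u τ K)‖ ≤
      ‖E‖ * (remConst M T α β * (κ * ε) * (t - τ) ^ (2 * β)) :=
    (norm_contract_le _ _).trans (by gcongr; exact f2.trans (by gcongr))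
  have k1 := norm_omegaS_le h hd hα hu hut ht (contract N E (remainder S ω s u τ K))
  have k2 := norm_omegaS_le h hR'.path hα hu hut ht
    (contract N E (remainder S (fun r => ω r - ω' r) s u τ K))
  have p3 : (t - τ) ^ (α + 2 * β) = (t - τ) ^ α * (t - τ) ^ (2 * β) := by
    rcases (show 0 ≤ t - τ by linarith).eq_or_lt with h0 | h0
    · rw [← h0, Real.zero_rpow hα.ne', Real.zero_rpow (by linarith), zero_mul]
    · exact Real.rpow_add h0 _ _
  have hp := Real.rpow_nonneg (show 0 ≤ t - τ by linarith) α
  rw [e0, norm_neg, p3]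
  calc _ ≤ _ := (norm_add_le _ _).trans (add_le_add k1 k2)
    _ ≤ convConst M α * ε * (‖E‖ * (remConst M T α β * (κ * L) * (t - τ) ^ (2 * β))) * (t - τ) ^ α +
        convConst M α * L * (‖E‖ * (remConst M T α β * (κ * ε) * (t - τ) ^ (2 * β))) *
          (t - τ) ^ α := by
      have hC2 : 0 ≤ M * (1 + 1 / α) := hC
      unfold convConst
      gcongr
    _ = _ := by ring

theorem norm_processC_sub_le {L₂' ε ε₂ : ℝ} (hα : 0 < α) (hT : 0 < T)
    (hR : RoughBound N T α L L₂ ω ω₂) (hR' : RoughBound N T α L L₂' ω' ω₂')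
    (hd : HolderPath T α ε fun r => ω r - ω' r)
    (hd₂ : ∀ s t : ℝ, 0 ≤ s → s ≤ t → t ≤ T → ‖ω₂ t s - ω₂' t s‖ ≤ ε₂ * (t - s) ^ (2 * α))
    (E : N.WV →L[ℝ] W) {K : V →L[ℝ] W} (hκ : 0 ≤ κ) (hK : ∀ v, ‖K v‖ ≤ κ * ‖v‖) (hs : 0 ≤ s)
    (hst : s ≤ t) (ht : t ≤ T) :
    ‖processC S N ω ω₂ t s E K - processC S N ω' ω₂' t s E K‖ ≤
      processCConst M α * (‖E‖ * κ * (L * ε + ε₂)) * (t - s) ^ (2 * α) := by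
  have hM := h.pos.le
  have hL := hR.path.nonneg hT
  have hε := hd.nonneg hT
  have hε₂ : 0 ≤ ε₂ := by
    have h1 := (norm_nonneg _).trans (hd₂ 0 T le_rfl hT.le le_rfl)
    rw [sub_zero] at h1
    exact nonneg_of_mul_nonneg_left h1 (Real.rpow_pos_of_pos hT (2 * α))
  have hα2 : 0 < 2 * α := by linarith
  have hdiff : ∀ a b : ℝ, (ω a - ω' a) - (ω b - ω' b) = (ω a - ω b) - (ω' a - ω' b) :=
    fun a b => by abel
  have hsq : ∀ {x : ℝ}, 0 ≤ x → x ^ (2 * α) = x ^ α * x ^ α := fun {x} hx => by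
    rw [mul_comm 2 α, Real.rpow_mul hx, Real.rpow_two, sq]
  -- The terms `ω^S(E K δω)`.
  have e1 : omegaS S ω t s (contract N E (K (ω t - ω s))) -
      omegaS S ω' t s (contract N E (K (ω' t - ω' s))) =
      omegaS S (fun r => ω r - ω' r) t s (contract N E (K (ω t - ω s))) +
      omegaS S ω' t s (contract N E (K ((ω t - ω' t) - (ω s - ω' s)))) := by
    have e0 : K ((ω t - ω' t) - (ω s - ω' s)) = K (ω t - ω s) - K (ω' t - ω' s) := by
      rw [hdiff, map_sub]
    rw [e0, omegaS_path_sub h hR.path hR'.path hα hs hst ht, contract_sub,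
      omegaS_sub h hR'.path hα hs hst ht]
    abel
  have hts : 0 ≤ t - s := by linarith
  have n1 : ‖contract N E (K (ω t - ω s))‖ ≤ ‖E‖ * (κ * (L * (t - s) ^ α)) :=
    (norm_contract_le _ _).trans (by
      gcongr; exact (hK _).trans (by gcongr; exact hR.path s t hs hst ht))
  have n2 : ‖contract N E (K ((ω t - ω' t) - (ω s - ω' s)))‖ ≤ ‖E‖ * (κ * (ε * (t - s) ^ α)) :=
    (norm_contract_le _ _).trans (by
      gcongr; exact (hK _).trans (by gcongr; exact hd s t hs hst ht))
  have hC := convConst_nonneg hM hα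
  have hC2 := convConst_nonneg hM hα2
  have b1 : ‖omegaS S ω t s (contract N E (K (ω t - ω s))) -
      omegaS S ω' t s (contract N E (K (ω' t - ω' s)))‖ ≤
      2 * convConst M α * (‖E‖ * κ * (L * ε)) * (t - s) ^ (2 * α) := by
    rw [e1, hsq hts]
    have k1 := norm_omegaS_le h hd hα hs hst ht (contract N E (K (ω t - ω s)))
    have k2 := norm_omegaS_le h hR'.path hα hs hst ht
      (contract N E (K ((ω t - ω' t) - (ω s - ω' s))))
    calc _ ≤ _ := (norm_add_le _ _).trans (add_le_add k1 k2)
      _ ≤ convConst M α * ε * (‖E‖ * (κ * (L * (t - s) ^ α))) * (t - s) ^ α +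
          convConst M α * L * (‖E‖ * (κ * (ε * (t - s) ^ α))) * (t - s) ^ α := by
        have : 0 ≤ M * (1 + 1 / α) := hC
        unfold convConst
        gcongr
      _ = _ := by ring
  -- The convolutions of `E K ω̃`.
  have v := hR.vanishesAt hT hα E K hs ht
  have v' := hR'.vanishesAt hT hα E K hs ht
  have e2 := ibp_smul_add (S := S) (-1 : ℝ) (v'.intervalIntegrable h hα2 hst)
    (v.intervalIntegrable h hα2 hst)
  rw [neg_one_smul, neg_add_eq_sub] at e2
  have w : VanishesAt (fun r => (-1 : ℝ) • contractOp N E K (coArea N ω' ω₂' t r) +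
      contractOp N E K (coArea N ω ω₂ t r)) t s (‖E‖ * κ * (2 * (L * ε) + ε₂)) (2 * α) := by
    refine ⟨(v'.cont.const_smul (-1 : ℝ)).add v.cont, fun r hr => ?_⟩
    have hr0 := hs.trans hr.1
    have hrt : 0 ≤ t - r := sub_nonneg.2 hr.2
    have e3 : coArea N ω ω₂ t r - coArea N ω' ω₂' t r =
        N.tmulVV ((ω t - ω' t) - (ω r - ω' r)) (ω t - ω r) +
        N.tmulVV (ω' t - ω' r) ((ω t - ω' t) - (ω r - ω' r)) - (ω₂ t r - ω₂' t r) := by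
      rw [hdiff]
      simp only [coArea, ← tmulVVL_apply, map_sub, sub_apply]
      abel
    have e4 : ‖coArea N ω ω₂ t r - coArea N ω' ω₂' t r‖ ≤
        (2 * (L * ε) + ε₂) * (t - r) ^ (2 * α) := by
      rw [e3]
      have d1 := hd r t hr0 hr.2 ht
      have d2 := hR.path r t hr0 hr.2 ht
      have d3 := hR'.path r t hr0 hr.2 ht
      calc _ ≤ ‖(ω t - ω' t) - (ω r - ω' r)‖ * ‖ω t - ω r‖ +
            ‖ω' t - ω' r‖ * ‖(ω t - ω' t) - (ω r - ω' r)‖ + ‖ω₂ t r - ω₂' t r‖ := by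
            rw [← norm_tmulVV N, ← norm_tmulVV N]
            exact (norm_sub_le _ _).trans (by gcongr; exact norm_add_le _ _)
        _ ≤ (ε * (t - r) ^ α) * (L * (t - r) ^ α) + (L * (t - r) ^ α) * (ε * (t - r) ^ α) +
            ε₂ * (t - r) ^ (2 * α) := by
            gcongr
            exact hd₂ r t hr0 hr.2 ht
        _ = _ := by rw [hsq hrt]; ring
    rw [neg_one_smul, neg_add_eq_sub, ← map_sub, mul_assoc]
    exact (norm_contractOp_apply_le E hκ hK _).trans (by gcongr)
  have b2 := norm_ibp_le h w hα2 hst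
  rw [e2] at b2
  rw [processC_eq h hR hT hα hs hst ht, processC_eq h hR' hT hα hs hst ht, sub_sub_sub_comm]
  have hp := Real.rpow_nonneg hts (2 * α)
  calc _ ≤ _ := (norm_sub_le _ _).trans (add_le_add b1 b2)
    _ = (2 * convConst M α * (‖E‖ * κ * (L * ε)) +
          convConst M (2 * α) * (‖E‖ * κ * (2 * (L * ε) + ε₂))) * (t - s) ^ (2 * α) := by
        unfold convConst; ring
    _ ≤ (2 * convConst M α * (‖E‖ * κ * (L * ε + ε₂)) +
          convConst M (2 * α) * (‖E‖ * κ * (2 * (L * ε + ε₂)))) * (t - s) ^ (2 * α) := by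
        gcongr <;> linarith
    _ = _ := by unfold processCConst; ring

theorem norm_processC_le (hα : 0 < α) (hT : 0 < T) (hR : RoughBound N T α L L₂ ω ω₂)
    (E : N.WV →L[ℝ] W) {K : V →L[ℝ] W} (hκ : 0 ≤ κ) (hK : ∀ v, ‖K v‖ ≤ κ * ‖v‖) (hs : 0 ≤ s)
    (hst : s ≤ t) (ht : t ≤ T) :
    ‖processC S N ω ω₂ t s E K‖ ≤
      processCConst M α * (‖E‖ * κ * (L * L + L₂)) * (t - s) ^ (2 * α) := by
  have hR0 : RoughBound N T α L L₂ (fun _ => (0 : V)) (fun _ _ => 0) :=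
    .zero N T α (hR.path.nonneg hT) (hR.area_nonneg hT)
  have h1 := norm_processC_sub_le h hα hT hR hR0 (ε := L) (ε₂ := L₂) (by simpa using hR.path)
    (by simpa using hR.area) E hκ hK hs hst ht
  have h2 : processC S N (fun _ => (0 : V)) (fun _ _ => 0) t s E K = 0 := by
    have := congrFun (congrFun (xiB_zero S N E K s) t) s
    rwa [xiB, omegaS_self h, contract_zero, show omegaS S (fun _ => (0 : V)) t s
      (0 : V →L[ℝ] W) = 0 by simp [omegaS, gen_zero], zero_add] at this
  rwa [h2, sub_zero] at h1

/-- `Ξ^{(b),s}` satisfies the hypotheses of the sewing lemma; the defect is compared with that of the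
zero rough path. -/
theorem isSewing_xiB [CompleteSpace W] (hβ : 0 < β) (hβ2 : 2 * β ≤ 1) (hβα : β < α)
    (hρ : 1 < α + 2 * β) (hT : 0 < T) (hR : RoughBound N T α L L₂ ω ω₂)
    (E : N.WV →L[ℝ] W) {K : V →L[ℝ] W} (hK : RegularOp D β κ K) (hs : s ∈ Icc 0 T) :
    IsSewing S (xiB S N ω ω₂ E K s) s T α (α + 2 * β)
      (sew S (xiB S N ω ω₂ E K s) s T α (α + 2 * β)) := by
  have hα := hβ.trans hβα
  have hL := hR.path.nonneg hT
  have hL₂ := hR.area_nonneg hT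
  have hM := h.pos.le
  have hκ := hK.nonneg
  have hC := convConst_nonneg hM hα
  have hC' := remConst_nonneg hM hT.le hβ hβα
  have hCc := processCConst_nonneg hM hα
  have hR0 : RoughBound N T α L L₂ (fun _ => (0 : V)) (fun _ _ => 0) := .zero N T α hL hL₂
  have hd : HolderPath T α L (fun r => ω r - 0) := by simpa using hR.path
  have hdef := defectBound_xiB_sub h hβ hβ2 hβα hT hR hR0 hd E hK hs.1
  simp only [xiB_zero, sub_zero] at hdef
  refine (isSewing_sew h (L' := convConst M α * L * (‖E‖ * (convConst M α * L * κ * T ^ α)) +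
    processCConst M α * (‖E‖ * κ * (L * L + L₂)) * T ^ α) hρ hα (by linarith) (by positivity) hs.1
    hs.2 hdef fun τ t hsτ hτt ht => ?_).1
  have hτ := hs.1.trans hsτ
  have hτt' : 0 ≤ t - τ := by linarith
  have k0 : ‖omegaS S ω τ s K‖ ≤ convConst M α * L * κ * T ^ α := by
    refine (norm_omegaS_le h hR.path hα hs.1 hsτ (hτt.trans ht) K).trans ?_
    have h1 : ‖K‖ ≤ κ := K.opNorm_le_bound hκ hK.norm_le
    have h2 : (τ - s) ^ α ≤ T ^ α := Real.rpow_le_rpow (by linarith) (by linarith [hs.1]) hα.le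
    have h3 : 0 ≤ (τ - s) ^ α := Real.rpow_nonneg (by linarith) _
    have : 0 ≤ M * (1 + 1 / α) := hC
    unfold convConst
    gcongr
  have k1 : ‖omegaS S ω t τ (contract N E (omegaS S ω τ s K))‖ ≤
      convConst M α * L * (‖E‖ * (convConst M α * L * κ * T ^ α)) * (t - τ) ^ α := by
    refine (norm_omegaS_le h hR.path hα hτ hτt ht _).trans ?_
    have : 0 ≤ M * (1 + 1 / α) := hC
    have h1 : ‖contract N E (omegaS S ω τ s K)‖ ≤ ‖E‖ * (convConst M α * L * κ * T ^ α) :=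
      (norm_contract_le _ _).trans (by gcongr)
    have h2 : M * (1 + 1 / α) = convConst M α := rfl
    rw [h2]
    gcongr
  have k2 : ‖processC S N ω ω₂ t τ E K‖ ≤
      processCConst M α * (‖E‖ * κ * (L * L + L₂)) * (T ^ α * (t - τ) ^ α) := by
    have h1 := norm_processC_le h hα hT hR E hκ hK.norm_le hτ hτt ht
    refine h1.trans ?_
    gcongr
    have := rpow_le_rpow_sub_mul (T := T) (x := t - τ) (a := α) (b := 2 * α) hα (by linarith) hτt'
      (by linarith)
    rwa [show 2 * α - α = α by ring] at this
  calc _ ≤ _ := (norm_add_le _ _).trans (add_le_add k1 k2)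
    _ = _ := by ring

theorem processB_eq_sew [CompleteSpace W] (hβ : 0 < β) (hβ2 : 2 * β ≤ 1) (hβα : β < α)
    (hρ : 1 < α + 2 * β) (hT : 0 < T) (hR : RoughBound N T α L L₂ ω ω₂)
    (E : N.WV →L[ℝ] W) {K : V →L[ℝ] W} (hK : RegularOp D β κ K) (hs : s ∈ Icc 0 T) (t : ℝ) :
    processB S N T α β ω ω₂ t s E K = sew S (xiB S N ω ω₂ E K s) s T α (α + 2 * β) t := by
  rw [processB, hatDelta, (isSewing_xiB h hβ hβ2 hβα hρ hT hR E hK hs).2.1, map_zero, sub_zero]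

/-- `b` is locally Lipschitz in the rough path. -/
theorem norm_processB_sub_le [CompleteSpace W] (hβ : 0 < β) (hβ2 : 2 * β ≤ 1) (hβα : β < α)
    (hρ : 1 < α + 2 * β) (hα2 : α ≤ 1 / 2) {L₂' ε ε₂ : ℝ} (hT : 0 < T)
    (hR : RoughBound N T α L L₂ ω ω₂) (hR' : RoughBound N T α L L₂' ω' ω₂')
    (hd : HolderPath T α ε fun r => ω r - ω' r)
    (hd₂ : ∀ s t : ℝ, 0 ≤ s → s ≤ t → t ≤ T → ‖ω₂ t s - ω₂' t s‖ ≤ ε₂ * (t - s) ^ (2 * α))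
    (E : N.WV →L[ℝ] W) {K : V →L[ℝ] W} (hK : RegularOp D β κ K) (hs : 0 ≤ s)
    (hst : s ≤ t) (ht : t ≤ T) :
    ‖processB S N T α β ω ω₂ t s E K - processB S N T α β ω' ω₂' t s E K‖ ≤
      processBConst M T α β * (‖E‖ * κ * (L * ε + ε₂)) * (t - s) ^ (2 * α) := by
  have hα := hβ.trans hβα
  have hsT : s ∈ Icc 0 T := ⟨hs, hst.trans ht⟩
  have hL := hR.path.nonneg hT
  have hε := hd.nonneg hT
  have hM := h.pos.le
  have hκ := hK.nonneg
  have hC := convConst_nonneg hM hα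
  have hC' := remConst_nonneg hM hT.le hβ hβα
  have hCc := processCConst_nonneg hM hα
  have hCs := sewConst_nonneg hM hρ
  have hts : 0 ≤ t - s := by linarith
  have hε₂ : 0 ≤ ε₂ := by
    have h1 := (norm_nonneg _).trans (hd₂ 0 T le_rfl hT.le le_rfl)
    rw [sub_zero] at h1
    exact nonneg_of_mul_nonneg_left h1 (Real.rpow_pos_of_pos hT (2 * α))
  have hy := isSewing_xiB h hβ hβ2 hβα hρ hT hR E hK hsT
  have hy' := isSewing_xiB h hβ hβ2 hβα hρ hT hR' E hK hsT
  have hdef := defectBound_xiB_sub h hβ hβ2 hβα hT hR hR' hd E hK hs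
  obtain ⟨z, hz0, hz⟩ := exists_hatDelta_sub_le h hρ (by positivity) hdef hs hsT.2
  -- the difference of the two sewings is the sewing of the difference
  set C₀ := sewConst M (α + 2 * β) * (2 * convConst M α * remConst M T α β * (‖E‖ * κ * (L * ε)))
    with hC₀
  have hzy : ∀ r, s ≤ r → r ≤ T → sew S (xiB S N ω ω₂ E K s) s T α (α + 2 * β) r -
      sew S (xiB S N ω' ω₂' E K s) s T α (α + 2 * β) r - z r = 0 := by
    obtain ⟨-, h0, C, hC⟩ := hy
    obtain ⟨-, h0', C', hC'⟩ := hy'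
    intro r hr hrT
    refine eq_zero_of_hatDelta_le h (z := fun r => sew S (xiB S N ω ω₂ E K s) s T α (α + 2 * β) r -
      sew S (xiB S N ω' ω₂' E K s) s T α (α + 2 * β) r - z r) (C := C + C' + C₀) hρ hs
      (by simp [h0, h0', hz0]) (fun a b ha hab hb => ?_) hr hrT
    rw [add_mul, add_mul]
    refine le_trans (le_of_eq ?_) ((norm_sub_le _ _).trans (add_le_add ((norm_sub_le _ _).trans
      (add_le_add (hC a b ha hab hb).2 (hC' a b ha hab hb).2)) (hz a b ha hab hb)))
    congr 1
    simp only [hatDelta, map_sub]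
    abel
  have e1 : processB S N T α β ω ω₂ t s E K - processB S N T α β ω' ω₂' t s E K =
      (hatDelta S z t s - (xiB S N ω ω₂ E K s t s - xiB S N ω' ω₂' E K s t s)) +
      (processC S N ω ω₂ t s E K - processC S N ω' ω₂' t s E K) := by
    rw [processB_eq_sew h hβ hβ2 hβα hρ hT hR E hK hsT,
      processB_eq_sew h hβ hβ2 hβα hρ hT hR' E hK hsT, sub_eq_zero.1 (hzy t hst ht), hatDelta, hz0]
    have h0 : ∀ ω : ℝ → V, omegaS S ω t s (0 : V →L[ℝ] W) = 0 := fun ω => by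
      simp [omegaS, gen_zero]
    simp only [xiB, omegaS_self h, contract_zero, h0, map_zero]
    abel
  have b1 := hz s t le_rfl hst ht
  have b2 := norm_processC_sub_le h hα hT hR hR' hd hd₂ E hκ hK.norm_le hs hst ht
  have b3 : (t - s) ^ (α + 2 * β) ≤ T ^ (α + 2 * β - 2 * α) * (t - s) ^ (2 * α) :=
    rpow_le_rpow_sub_mul (by linarith) (by linarith) hts (by linarith)
  have hp := Real.rpow_nonneg hts (2 * α)
  have hC₀' : C₀ ≤ sewConst M (α + 2 * β) * (2 * convConst M α * remConst M T α β *
      (‖E‖ * κ * (L * ε + ε₂))) := by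
    rw [hC₀]
    gcongr
    linarith
  rw [e1]
  calc _ ≤ _ := (norm_add_le _ _).trans (add_le_add b1 b2)
    _ ≤ sewConst M (α + 2 * β) * (2 * convConst M α * remConst M T α β *
          (‖E‖ * κ * (L * ε + ε₂))) * (T ^ (α + 2 * β - 2 * α) * (t - s) ^ (2 * α)) +
        processCConst M α * (‖E‖ * κ * (L * ε + ε₂)) * (t - s) ^ (2 * α) := by
      gcongr
    _ = _ := by unfold processBConst; ring

/-- The bound of `b`, by comparison with the zero rough path. -/
theorem norm_processB_le [CompleteSpace W] (hβ : 0 < β) (hβ2 : 2 * β ≤ 1) (hβα : β < α)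
    (hρ : 1 < α + 2 * β) (hα2 : α ≤ 1 / 2) (hT : 0 < T)
    (hR : RoughBound N T α L L₂ ω ω₂)
    (E : N.WV →L[ℝ] W) {K : V →L[ℝ] W} (hK : RegularOp D β κ K) (hs : 0 ≤ s)
    (hst : s ≤ t) (ht : t ≤ T) :
    ‖processB S N T α β ω ω₂ t s E K‖ ≤
      processBConst M T α β * (‖E‖ * κ * (L ^ 2 + L₂)) * (t - s) ^ (2 * α) := by
  have hL := hR.path.nonneg hT
  have hL₂ := hR.area_nonneg hT
  have hR0 : RoughBound N T α L L₂ (fun _ => (0 : V)) (fun _ _ => 0) := .zero N T α hL hL₂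
  have hsT : s ∈ Icc 0 T := ⟨hs, hst.trans ht⟩
  have h1 := norm_processB_sub_le h hβ hβ2 hβα hρ hα2 hT hR hR0 (ε := L) (ε₂ := L₂)
    (by simpa using hR.path) (by simpa using hR.area) E hK hs hst ht
  have h0 : processB S N T α β (fun _ => (0 : V)) (fun _ _ => 0) t s E K = 0 := by
    have hy := isSewing_xiB h hβ hβ2 hβα hρ hT hR0 E hK hsT
    rw [processB_eq_sew h hβ hβ2 hβα hρ hT hR0 E hK hsT]
    refine hy.eqOn h hρ hs ?_ ⟨hst, ht⟩ (y' := fun _ => 0)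
    rw [xiB_zero]
    refine ⟨continuousOn_const, rfl, 0, fun r t _ _ _ => ?_⟩
    simp [hatDelta]
  rw [h0, sub_zero] at h1
  rwa [sq]

theorem processC_smul_add_left (hR : RoughBound N T α L L₂ ω ω₂) (hT : 0 < T) (hα : 0 < α)
    (hs : 0 ≤ s) (hst : s ≤ t) (ht : t ≤ T) (c : ℝ) (E E' : N.WV →L[ℝ] W) (K : V →L[ℝ] W) :
    processC S N ω ω₂ t s (c • E + E') K =
      c • processC S N ω ω₂ t s E K + processC S N ω ω₂ t s E' K := by
  have hα2 : 0 < 2 * α := by linarith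
  rw [processC_eq h hR hT hα hs hst ht, processC_eq h hR hT hα hs hst ht,
    processC_eq h hR hT hα hs hst ht, contract_op_smul_add, omegaS_smul_add h hR.path hα hs hst ht]
  have := ibp_smul_add (S := S) c
    ((hR.vanishesAt hT hα E K hs ht).intervalIntegrable h hα2 hst)
    ((hR.vanishesAt hT hα E' K hs ht).intervalIntegrable h hα2 hst)
  have e : (fun r => contractOp N (c • E + E') K (coArea N ω ω₂ t r)) = fun r =>
      c • contractOp N E K (coArea N ω ω₂ t r) + contractOp N E' K (coArea N ω ω₂ t r) := rfl
  rw [e, this, smul_sub]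
  abel

theorem processC_smul_add_right (hR : RoughBound N T α L L₂ ω ω₂) (hT : 0 < T) (hα : 0 < α)
    (hs : 0 ≤ s) (hst : s ≤ t) (ht : t ≤ T) (c : ℝ) (E : N.WV →L[ℝ] W) (K K' : V →L[ℝ] W) :
    processC S N ω ω₂ t s E (c • K + K') =
      c • processC S N ω ω₂ t s E K + processC S N ω ω₂ t s E K' := by
  have hα2 : 0 < 2 * α := by linarith
  have ec : contract N E ((c • K + K') (ω t - ω s)) =
      c • contract N E (K (ω t - ω s)) + contract N E (K' (ω t - ω s)) := by
    rw [← contract_smul, ← contract_add]; rfl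
  rw [processC_eq h hR hT hα hs hst ht, processC_eq h hR hT hα hs hst ht,
    processC_eq h hR hT hα hs hst ht, ec, omegaS_smul_add h hR.path hα hs hst ht]
  have := ibp_smul_add (S := S) c
    ((hR.vanishesAt hT hα E K hs ht).intervalIntegrable h hα2 hst)
    ((hR.vanishesAt hT hα E K' hs ht).intervalIntegrable h hα2 hst)
  simp only [contractOp_smul_add]
  rw [this, smul_sub]
  abel

theorem processB_smul_add_left [CompleteSpace W] (hβ : 0 < β) (hβ2 : 2 * β ≤ 1) (hβα : β < α)
    (hρ : 1 < α + 2 * β) (hT : 0 < T) (hR : RoughBound N T α L L₂ ω ω₂) (c : ℝ)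
    (E E' : N.WV →L[ℝ] W) {K : V →L[ℝ] W} (hK : RegularOp D β κ K) (hs : 0 ≤ s) (hst : s ≤ t)
    (ht : t ≤ T) :
    processB S N T α β ω ω₂ t s (c • E + E') K =
      c • processB S N T α β ω ω₂ t s E K + processB S N T α β ω ω₂ t s E' K := by
  have hα := hβ.trans hβα
  have hsT : s ∈ Icc 0 T := ⟨hs, hst.trans ht⟩
  have hy := fun E => isSewing_xiB h hβ hβ2 hβα hρ hT hR E hK hsT
  rw [processB_eq_sew h hβ hβ2 hβα hρ hT hR _ hK hsT,
    processB_eq_sew h hβ hβ2 hβα hρ hT hR _ hK hsT, processB_eq_sew h hβ hβ2 hβα hρ hT hR _ hK hsT]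
  refine ((hy (c • E + E')).eqOn h hρ hs (((hy E).smul_add (hy E') c).congr
    fun r t hr hrt ht => ?_)) ⟨hst, ht⟩
  have hr0 := hs.trans hr
  rw [xiB, xiB, xiB, processC_smul_add_left h hR hT hα hr0 hrt ht, contract_op_smul_add,
    omegaS_smul_add h hR.path hα hr0 hrt ht, smul_add]
  abel

theorem processB_smul_add_right [CompleteSpace W] (hβ : 0 < β) (hβ2 : 2 * β ≤ 1) (hβα : β < α)
    (hρ : 1 < α + 2 * β) (hT : 0 < T) (hR : RoughBound N T α L L₂ ω ω₂) (c : ℝ)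
    (E : N.WV →L[ℝ] W) {κ' : ℝ} {K K' : V →L[ℝ] W} (hK : RegularOp D β κ K)
    (hK' : RegularOp D β κ' K') (hs : 0 ≤ s) (hst : s ≤ t) (ht : t ≤ T) :
    processB S N T α β ω ω₂ t s E (c • K + K') =
      c • processB S N T α β ω ω₂ t s E K + processB S N T α β ω ω₂ t s E K' := by
  have hα := hβ.trans hβα
  have hsT : s ∈ Icc 0 T := ⟨hs, hst.trans ht⟩
  have hy := fun {κ} {K : V →L[ℝ] W} (hK : RegularOp D β κ K) =>
    isSewing_xiB h hβ hβ2 hβα hρ hT hR E hK hsT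
  rw [processB_eq_sew h hβ hβ2 hβα hρ hT hR _ (hK.smul_add hK' c) hsT,
    processB_eq_sew h hβ hβ2 hβα hρ hT hR _ hK hsT, processB_eq_sew h hβ hβ2 hβα hρ hT hR _ hK' hsT]
  refine ((hy (hK.smul_add hK' c)).eqOn h hρ hs (((hy hK).smul_add (hy hK') c).congr
    fun r t hr hrt ht => ?_)) ⟨hst, ht⟩
  have hr0 := hs.trans hr
  have ec : contract N E (omegaS S ω r s (c • K + K')) =
      c • contract N E (omegaS S ω r s K) + contract N E (omegaS S ω r s K') := by
    rw [← contract_smul, ← contract_add, omegaS_smul_add h hR.path hα hs hr (hrt.trans ht)]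
  rw [xiB, xiB, xiB, processC_smul_add_right h hR hT hα hr0 hrt ht, ec,
    omegaS_smul_add h hR.path hα hr0 hrt ht, smul_add]
  abel

end ProcessB

/-! ### Regular paths -/

section Regular

variable {V : Type v} {W : Type u} [NormedAddCommGroup V] [NormedSpace ℝ V]
  [NormedAddCommGroup W] [NormedSpace ℝ W]

/-- `f` is strongly measurable and bounded by `B` on `[a,b]`. -/
structure BddMeasurableOn {X : Type*} [NormedAddCommGroup X] (a b B : ℝ) (f : ℝ → X) : Prop where
  meas : AEStronglyMeasurable f (volume.restrict (Icc a b))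
  norm_le : ∀ r ∈ Icc a b, ‖f r‖ ≤ B

/-- The convolution `∫_s^t S(t-r) f(r) dr`. -/
noncomputable def conv (S : ℝ → W →L[ℝ] W) (t s : ℝ) (f : ℝ → W) : W := ∫ r in s..t, S (t - r) (f r)

section BddMeasurableOn

variable {X : Type*} [NormedAddCommGroup X] {a b B : ℝ} {f : ℝ → X} {s t : ℝ}

theorem BddMeasurableOn.mono (hf : BddMeasurableOn a b B f) {a' b' : ℝ} (ha : a ≤ a') (hb : b' ≤ b) :
    BddMeasurableOn a' b' B f :=
  ⟨hf.meas.mono_set (Icc_subset_Icc ha hb), fun r hr => hf.norm_le r (Icc_subset_Icc ha hb hr)⟩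

theorem BddMeasurableOn.intervalIntegrable (hf : BddMeasurableOn s t B f) (hst : s ≤ t) :
    IntervalIntegrable f volume s t := by
  rw [intervalIntegrable_iff_integrableOn_Icc_of_le hst]
  exact Integrable.of_bound hf.meas B
    ((ae_restrict_iff' measurableSet_Icc).2 (Eventually.of_forall hf.norm_le))

theorem BddMeasurableOn.norm_integral_le [NormedSpace ℝ X] (hf : BddMeasurableOn s t B f)
    (hst : s ≤ t) : ‖∫ r in s..t, f r‖ ≤ B * (t - s) := by
  have := intervalIntegral.norm_integral_le_of_norm_le_const (a := s) (b := t) (f := f) (C := B)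
    fun r hr => by
      rw [uIoc_of_le hst] at hr
      exact hf.norm_le r ⟨hr.1.le, hr.2⟩
  rwa [abs_of_nonneg (sub_nonneg.2 hst)] at this

theorem BddMeasurableOn.clm_apply [NormedSpace ℝ X] {Y : Type*} [NormedAddCommGroup Y]
    [NormedSpace ℝ Y] (hf : BddMeasurableOn s t B f) {A : ℝ → X →L[ℝ] Y} {C : ℝ}
    (hA : ContinuousOn A (Ico s t)) (hAC : ∀ r ∈ Icc s t, ‖A r‖ ≤ C) :
    BddMeasurableOn s t (C * B) fun r => A r (f r) where
  meas := by
    have h1 : AEStronglyMeasurable A (volume.restrict (Icc s t)) := by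
      rw [← restrict_Ico_eq_restrict_Icc]
      exact hA.aestronglyMeasurable measurableSet_Ico
    exact (ContinuousLinearMap.id ℝ (X →L[ℝ] Y)).aestronglyMeasurable_comp₂ h1 hf.meas
  norm_le r hr := (A r).le_of_opNorm_le_of_le (hAC r hr) (hf.norm_le r hr)

end BddMeasurableOn

section Conv

variable {S D : ℝ → W →L[ℝ] W} {M : ℝ} (h : SmoothingPair S D M) {f g : ℝ → W} {s u t B : ℝ}
include h

theorem BddMeasurableOn.conv_integrand (hf : BddMeasurableOn s t B f) :
    BddMeasurableOn s t (M * B) fun r => S (t - r) (f r) :=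
  hf.clm_apply (A := fun r => S (t - r))
    (h.continuousOn_S.comp (by fun_prop) fun _ hr => sub_pos.2 hr.2)
    fun _ hr => h.norm_le _ (sub_nonneg.2 hr.2)

theorem norm_conv_le (hf : BddMeasurableOn s t B f) (hst : s ≤ t) :
    ‖conv S t s f‖ ≤ M * B * (t - s) :=
  (hf.conv_integrand h).norm_integral_le hst

theorem conv_sub (hf : BddMeasurableOn s t B f) {B' : ℝ} (hg : BddMeasurableOn s t B' g)
    (hst : s ≤ t) : conv S t s (fun r => f r - g r) = conv S t s f - conv S t s g := by
  simp only [conv, map_sub]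
  exact intervalIntegral.integral_sub ((hf.conv_integrand h).intervalIntegrable hst)
    ((hg.conv_integrand h).intervalIntegrable hst)

theorem conv_split [CompleteSpace W] (hf : BddMeasurableOn s t B f) (hsu : s ≤ u) (hut : u ≤ t) :
    conv S t s f = conv S t u f + S (t - u) (conv S u s f) := by
  have h1 := (hf.conv_integrand h)
  have h2 := ((hf.mono le_rfl hut).conv_integrand h).intervalIntegrable hsu
  rw [conv, ← intervalIntegral.integral_add_adjacent_intervals
    ((h1.mono le_rfl hut).intervalIntegrable hsu) ((h1.mono hsu le_rfl).intervalIntegrable hut),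
    conv, conv, ← ContinuousLinearMap.intervalIntegral_comp_comm _ h2, add_comm]
  congr 1
  refine intervalIntegral.integral_congr fun r hr => ?_
  rw [uIcc_of_le hsu] at hr
  change S (t - r) (f r) = S (t - u) (S (u - r) (f r))
  rw [← h.S_add_apply (by linarith) (by linarith [hr.2])]
  ring_nf

end Conv

section Paths

variable {T : ℝ} {w g : ℝ → V} {s u t : ℝ}

theorem IsRegularPath.exists_bddMeasurableOn (hw : IsRegularPath T w g) :
    ∃ B : ℝ, 0 ≤ B ∧ BddMeasurableOn 0 T B g := by
  obtain ⟨B, hB⟩ := hw.bdd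
  exact ⟨max B 0, le_max_right _ _, hw.meas, fun r hr => (hB r hr).trans (le_max_left _ _)⟩

theorem IsRegularPath.sub_eq (hw : IsRegularPath T w g) {B : ℝ} (hg : BddMeasurableOn 0 T B g)
    (hs : 0 ≤ s) (hst : s ≤ t) (ht : t ≤ T) : w t - w s = ∫ r in s..t, g r := by
  rw [hw.primitive t ⟨hs.trans hst, ht⟩, hw.primitive s ⟨hs, hst.trans ht⟩, add_sub_add_left_eq_sub]
  exact intervalIntegral.integral_interval_sub_left
    ((hg.mono le_rfl ht).intervalIntegrable (hs.trans hst))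
    ((hg.mono le_rfl (hst.trans ht)).intervalIntegrable hs)

theorem IsRegularPath.holderPath (hw : IsRegularPath T w g) {B : ℝ} (hg : BddMeasurableOn 0 T B g) :
    HolderPath T 1 B w := fun s t hs hst ht => by
  rw [hw.sub_eq hg hs hst ht, Real.rpow_one]
  exact (hg.mono hs ht).norm_integral_le hst

variable {N : TensorNorms V W} {B : ℝ}

theorem regularArea_integrand (hw : IsRegularPath T w g) (hB : 0 ≤ B) (hg : BddMeasurableOn 0 T B g)
    (hs : 0 ≤ s) (hst : s ≤ t) (ht : t ≤ T) :
    BddMeasurableOn s t (B * (t - s) * B) fun r => N.tmulVV (w r - w s) (g r) := by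
  have hωc : ContinuousOn w (Icc 0 T) := (hw.holderPath hg).continuousOn one_pos
  refine (hg.mono hs ht).clm_apply (A := fun r => N.tmulVVL (w r - w s)) ?_ fun r hr => ?_
  · refine N.tmulVVL.continuous.comp_continuousOn (ContinuousOn.sub ?_ continuousOn_const)
    exact hωc.mono fun r hr => ⟨hs.trans hr.1, hr.2.le.trans ht⟩
  · refine ContinuousLinearMap.opNorm_le_bound _ (mul_nonneg hB (by linarith)) fun v => ?_
    rw [tmulVVL_apply, norm_tmulVV]
    gcongr
    have := hw.holderPath hg s r hs hr.1 (hr.2.trans ht)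
    rw [Real.rpow_one] at this
    exact this.trans (by gcongr; exact hr.2)

/-- A regular path with its iterated integral is a Lipschitz rough path. -/
theorem IsRegularPath.roughBound_one [CompleteSpace V] (hw : IsRegularPath T w g) (hB : 0 ≤ B)
    (hg : BddMeasurableOn 0 T B g) : RoughBound N T 1 B (B * B) w (regularArea N w g) where
  path := hw.holderPath hg
  area s t hs hst ht := by
    have := (regularArea_integrand (N := N) hw hB hg hs hst ht).norm_integral_le hst
    refine this.trans (le_of_eq ?_)
    rw [mul_one, Real.rpow_two]
    ring
  chen s r t hs hsr hrt ht := by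
    have i1 := regularArea_integrand (N := N) hw hB hg hs (hsr.trans hrt) ht
    have i2 := (i1.mono le_rfl hrt).intervalIntegrable hsr
    have i3 := (i1.mono hsr le_rfl).intervalIntegrable hrt
    have i4 := (regularArea_integrand (N := N) hw hB hg (hs.trans hsr) hrt
      ht).intervalIntegrable hrt
    have i5 := ((hg.mono (hs.trans hsr) ht).intervalIntegrable hrt)
    rw [regularArea, regularArea, regularArea,
      ← intervalIntegral.integral_add_adjacent_intervals i2 i3, add_sub_cancel_left,
      ← intervalIntegral.integral_sub i3 i4, hw.sub_eq hg (hs.trans hsr) hrt ht, ← tmulVVL_apply,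
      ← ContinuousLinearMap.intervalIntegral_comp_comm _ i5]
    refine intervalIntegral.integral_congr fun q _ => ?_
    simp only [← tmulVVL_apply, ← sub_apply, ← map_sub]
    congr 2
    abel

theorem RoughBound.of_one {α L L₂ : ℝ} {ω₂ : ℝ → ℝ → N.VV} (hR : RoughBound N T 1 L L₂ w ω₂)
    (hT : 0 < T) (hα : 0 < α) (hα1 : α ≤ 1) :
    RoughBound N T α (L * T ^ (1 - α)) (L₂ * T ^ (2 * 1 - 2 * α)) w ω₂ where
  path s t hs hst ht := by
    have := hR.path.nonneg hT
    refine (hR.path s t hs hst ht).trans ?_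
    rw [mul_assoc]
    gcongr
    exact rpow_le_rpow_sub_mul hα hα1 (by linarith) (by linarith)
  area s t hs hst ht := by
    have := hR.area_nonneg hT
    refine (hR.area s t hs hst ht).trans ?_
    rw [mul_assoc]
    gcongr
    exact rpow_le_rpow_sub_mul (by linarith) (by linarith) (by linarith) (by linarith)
  chen := hR.chen

variable {S D : ℝ → W →L[ℝ] W} {M : ℝ} (h : SmoothingPair S D M)
include h

/-- Any `K` becomes regular, with `β = 1`, after smoothing by `S(ε)`. -/
theorem SmoothingPair.regularOp_comp {ε : ℝ} (hε : 0 < ε) (K : V →L[ℝ] W) :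
    RegularOp D 1 (M * ‖K‖ + M / ε * (M * ‖K‖)) (S ε ∘L K) := by
  have hM := h.pos.le
  have e : ∀ v, ∀ τ : ℝ, 0 ≤ τ → ‖S τ (K v)‖ ≤ M * ‖K‖ * ‖v‖ := fun v τ hτ => by
    rw [mul_assoc]
    exact (h.norm_S_apply_le hτ _).trans (by gcongr; exact K.le_opNorm v)
  refine ⟨by positivity, fun v => (e v ε hε.le).trans ?_, fun t ht v => ?_⟩
  · gcongr
    have : 0 ≤ M / ε * (M * ‖K‖) := by positivity
    linarith
  · have e1 : D t (S ε (K v)) = D ε (S t (K v)) := by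
      rw [← h.D_add_apply' hε.le ht, ← h.D_add_apply' ht.le hε, add_comm]
    rw [ContinuousLinearMap.comp_apply, e1, sub_self, Real.rpow_zero, mul_one]
    calc _ ≤ M / ε * (M * ‖K‖ * ‖v‖) :=
          (h.norm_D_apply_le hε _).trans (by gcongr; exact e v t ht.le)
      _ ≤ _ := by
          have : 0 ≤ M * ‖K‖ * ‖v‖ := by positivity
          linarith

theorem omegaS_comp [CompleteSpace W] {α L ε : ℝ} (hε : 0 ≤ ε) (hω : HolderPath T α L w)
    (hα : 0 < α) (hs : 0 ≤ s) (hst : s ≤ t) (ht : t ≤ T) (K : V →L[ℝ] W) :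
    omegaS S w t s (S ε ∘L K) = S ε (omegaS S w t s K) := by
  have hi := (hω.vanishesAt hα K hs ht).intervalIntegrable h hα hst
  rw [omegaS_eq_ibp h w hst, omegaS_eq_ibp h w hst, ibp, ibp, map_sub (S ε),
    ← ContinuousLinearMap.intervalIntegral_comp_comm _ hi]
  congr 1
  · rw [ContinuousLinearMap.comp_apply, ← h.S_add_apply (by linarith) hε,
      ← h.S_add_apply hε (by linarith), add_comm]
  · refine intervalIntegral.integral_congr fun r hr => ?_
    rw [uIcc_of_le hst] at hr
    rcases hr.2.eq_or_lt with rfl | hlt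
    · simp
    · change D (t - r) (S ε (K (w t - w r))) = S ε (D (t - r) (K (w t - w r)))
      rw [← h.D_add_apply hε (by linarith), ← h.D_add_apply' hε (by linarith)]

/-- Integration by parts: for a regular path `ω^S_{ts}(K) = ∫_s^t S(t-r) K g(r) dr`. Both sides satisfy
the same cocycle identity, and after smoothing by `S(ε)` both have the first order part
`S(ε) K (w_t - w_s)`, up to `O((t-s)²)`. -/
theorem omegaS_eq_conv [CompleteSpace V] [CompleteSpace W] (hw : IsRegularPath T w g) (hB : 0 ≤ B)
    (hg : BddMeasurableOn 0 T B g) (hs : 0 ≤ s) (hst : s ≤ t) (ht : t ≤ T) (K : V →L[ℝ] W) :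
    omegaS S w t s K = conv S t s fun r => K (g r) := by
  have hω := hw.holderPath hg
  have hKg : BddMeasurableOn 0 T (‖K‖ * B) fun r => K (g r) :=
    hg.clm_apply (A := fun _ => K) continuousOn_const fun _ _ => le_rfl
  have key : ∀ ε : ℝ, 0 < ε → S ε (omegaS S w t s K - conv S t s fun r => K (g r)) = 0 := by
    intro ε hε
    have hreg := h.regularOp_comp hε K
    set κ := M * ‖K‖ + M / ε * (M * ‖K‖)
    have hκ := hreg.nonneg
    refine eq_zero_of_hatDelta_le h (T := T) (C := (1 / 1 + 1 / (1 + 1)) * (κ * B) + κ * B)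
      (z := fun r => S ε (omegaS S w r s K - conv S r s fun r => K (g r)))
      (show (1 : ℝ) < 1 + 1 by norm_num) hs (by simp [omegaS_self h, conv])
      (fun a b hsa hab hb => ?_) hst ht
    have ha := hs.trans hsa
    have e1 : hatDelta S (fun r => S ε (omegaS S w r s K - conv S r s fun r => K (g r))) b a =
        S ε (omegaS S w b a K - conv S b a fun r => K (g r)) := by
      have hcomm : ∀ x, S (b - a) (S ε x) = S ε (S (b - a) x) := fun x => by
        rw [← h.S_add_apply (by linarith) hε.le, ← h.S_add_apply hε.le (by linarith), add_comm]
      simp only [hatDelta]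
      rw [hcomm, ← map_sub, omegaS_split h hω one_pos hs hsa hab hb,
        conv_split h (hKg.mono hs hb) hsa hab, map_sub (S (b - a))]
      congr 1
      abel
    have b1 := norm_omegaS_sub_le h one_pos one_pos hω hreg ha hab hb
    rw [omegaS_comp h hε.le hω one_pos ha hab hb] at b1
    have hKgab := hKg.mono ha hb
    have i1 := (hKgab.conv_integrand h).intervalIntegrable hab
    have i2 := hKgab.intervalIntegrable hab
    have e2 : S ε (conv S b a fun r => K (g r)) - (S ε ∘L K) (w b - w a) =
        ∫ r in a..b, S (b - r) (S ε (K (g r))) - S ε (K (g r)) := by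
      have hcomm : ∀ r ∈ uIcc a b, S (b - r) (S ε (K (g r))) - S ε (K (g r)) =
          S ε (S (b - r) (K (g r)) - K (g r)) := fun r hr => by
        rw [uIcc_of_le hab] at hr
        rw [map_sub, ← h.S_add_apply (by linarith [hr.2]) hε.le,
          ← h.S_add_apply hε.le (by linarith [hr.2]), add_comm]
      rw [intervalIntegral.integral_congr hcomm,
        ContinuousLinearMap.intervalIntegral_comp_comm _ (i1.sub i2),
        intervalIntegral.integral_sub i1 i2, map_sub (S ε), hw.sub_eq hg ha hab hb,
        ContinuousLinearMap.comp_apply, ContinuousLinearMap.intervalIntegral_comp_comm _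
          ((hg.mono ha hb).intervalIntegrable hab)]
      rfl
    have b2 : ‖S ε (conv S b a fun r => K (g r)) - (S ε ∘L K) (w b - w a)‖ ≤
        κ * B * (b - a) * (b - a) := by
      rw [e2]
      have := intervalIntegral.norm_integral_le_of_norm_le_const (a := a) (b := b)
        (f := fun r => S (b - r) (S ε (K (g r))) - S ε (K (g r))) (C := κ * B * (b - a))
        fun r hr => by
          rw [uIoc_of_le hab] at hr
          have hr' : 0 ≤ b - r := by linarith [hr.2]
          have hgr := hg.norm_le r ⟨ha.trans hr.1.le, hr.2.trans hb⟩
          have := h.norm_S_sub_le (y := S ε (K (g r))) (B := κ * B) (γ := 1) one_pos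
            (fun σ hσ => (hreg.norm_D_le σ hσ (g r)).trans (le_of_le_of_eq
              (mul_le_mul_of_nonneg_left hgr (by positivity)) (by ring))) hr'
          rw [div_one, Real.rpow_one] at this
          refine this.trans ?_
          gcongr
          exact hr.1.le
      rwa [abs_of_nonneg (sub_nonneg.2 hab)] at this
    have e3 : (b - a) ^ ((1 : ℝ) + 1) = (b - a) * (b - a) := by
      rw [show (1 : ℝ) + 1 = 2 by norm_num, Real.rpow_two, sq]
    rw [e1, map_sub]
    calc _ = ‖(S ε (omegaS S w b a K) - (S ε ∘L K) (w b - w a)) -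
          (S ε (conv S b a fun r => K (g r)) - (S ε ∘L K) (w b - w a))‖ := by congr 1; abel
      _ ≤ _ := (norm_sub_le _ _).trans (add_le_add b1 b2)
      _ = _ := by rw [e3]; ring
  have hlim : Tendsto (fun q => S q (omegaS S w t s K - conv S t s fun r => K (g r))) (𝓝[>] 0)
      (𝓝 (S 0 (omegaS S w t s K - conv S t s fun r => K (g r)))) :=
    (h.strong_cont _ 0 self_mem_Ici).mono_left (nhdsWithin_mono 0 Ioi_subset_Ici_self)
  rw [h.S_zero_apply] at hlim
  refine sub_eq_zero.1 (tendsto_nhds_unique hlim (tendsto_const_nhds.congr' ?_))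
  filter_upwards [self_mem_nhdsWithin] with ε hε using (key ε hε).symm

theorem continuousOn_omegaS [CompleteSpace W] {α L : ℝ} (hω : HolderPath T α L w) (hα : 0 < α)
    (hs : 0 ≤ s) (K : V →L[ℝ] W) : ContinuousOn (fun r => omegaS S w r s K) (Icc s T) := by
  refine continuousOn_of_hatDelta_le h (C := M * (1 + 1 / α) * L * ‖K‖) hα fun a b hsa hab hb => ?_
  have e : hatDelta S (fun r => omegaS S w r s K) b a = omegaS S w b a K := by
    rw [hatDelta, omegaS_split h hω hα hs hsa hab hb, add_sub_cancel_right]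
  rw [e]
  exact norm_omegaS_le h hω hα (hs.trans hsa) hab hb K

/-- For a regular path, `b` is the iterated integral. -/
theorem regularB_eq_processB [CompleteSpace V] [CompleteSpace W] {α β κ : ℝ} (hβ : 0 < β)
    (hβ2 : 2 * β ≤ 1) (hβα : β < α) (hρ : 1 < α + 2 * β) (hα2 : α ≤ 1 / 2) (hT : 0 < T)
    (hw : IsRegularPath T w g) (E : N.WV →L[ℝ] W) {K : V →L[ℝ] W} (hK : RegularOp D β κ K)
    (hs : 0 ≤ s) (hst : s ≤ t) (ht : t ≤ T) :
    regularB S N g t s E K = processB S N T α β w (regularArea N w g) t s E K := by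
  obtain ⟨B, hB, hg⟩ := hw.exists_bddMeasurableOn
  have hR1 := hw.roughBound_one (N := N) hB hg
  have hR := hR1.of_one hT (hβ.trans hβα) (by linarith)
  have hω := hw.holderPath hg
  have hM := h.pos.le
  have hκ := hK.nonneg
  have hsT : s ∈ Icc 0 T := ⟨hs, hst.trans ht⟩
  have hrem := remConst_nonneg hM hT.le hβ (show β < 1 by linarith)
  have hCc := processCConst_nonneg hM one_pos
  -- The integrand is `E x_r g_r` with `x_r = ω^S_{rs}(K)`; `x` is `2β`-Hölder continuous.
  have hx := continuousOn_omegaS h hω one_pos hs K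
  have hE : Continuous fun x => contract N E x := by
    have : (fun x => contract N E x) = fun x => ContinuousLinearMap.compL ℝ V N.WV W E (N.tmulWV x) :=
      rfl
    rw [this]
    fun_prop
  have hosc : ∀ a r : ℝ, s ≤ a → a ≤ r → r ≤ T → ‖omegaS S w r s K - omegaS S w a s K‖ ≤
      (remConst M T 1 β * (κ * B) + κ * B * T ^ (1 - 2 * β)) * (r - a) ^ (2 * β) := by
    intro a r hsa har hr
    have e : omegaS S w r s K - omegaS S w a s K = remainder S w s r a K + K (w r - w a) := by
      rw [remainder]; abel
    have b1 := norm_remainder_le h hβ hβ2 (by linarith) hω hB hK hs hsa har hr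
    have b2 : ‖K (w r - w a)‖ ≤ κ * (B * (T ^ (1 - 2 * β) * (r - a) ^ (2 * β))) := by
      refine (hK.norm_le _).trans ?_
      gcongr
      refine (hω a r (hs.trans hsa) har hr).trans ?_
      gcongr
      exact rpow_le_rpow_sub_mul (by linarith) (by linarith) (by linarith) (by linarith)
    rw [e]
    calc _ ≤ _ := (norm_add_le _ _).trans (add_le_add b1 b2)
      _ = _ := by ring
  set O := remConst M T 1 β * (κ * B) + κ * B * T ^ (1 - 2 * β) with hO
  have hO0 : 0 ≤ O := by positivity
  have hF : ∀ a b : ℝ, s ≤ a → a ≤ b → b ≤ T → BddMeasurableOn a b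
      (‖E‖ * (O * (b - a) ^ (2 * β)) * B)
      (fun r => contract N E (omegaS S w r s K - omegaS S w a s K) (g r)) := by
    intro a b hsa hab hb
    have hba : 0 ≤ b - a := by linarith
    refine (hg.mono (hs.trans hsa) hb).clm_apply
      (A := fun r => contract N E (omegaS S w r s K - omegaS S w a s K)) ?_ ?_
    · exact hE.comp_continuousOn ((hx.mono fun r hr => ⟨hsa.trans hr.1, hr.2.le.trans hb⟩).sub
        continuousOn_const)
    · intro r hr
      refine (norm_contract_le _ _).trans ?_
      gcongr
      refine (hosc a r hsa hr.1 (hr.2.trans hb)).trans ?_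
      have hra : 0 ≤ r - a := by linarith [hr.1]
      gcongr
      exact hr.2
  have hF0 := hF s T le_rfl hsT.2 le_rfl
  simp only [omegaS_self h, sub_zero] at hF0
  have hreg : ∀ r, s ≤ r → r ≤ T → regularB S N g r s E K =
      conv S r s fun q => contract N E (omegaS S w q s K) (g q) := by
    intro r hr hrT
    refine intervalIntegral.integral_congr fun q hq => ?_
    rw [uIcc_of_le hr] at hq
    simp only [omegaS_eq_conv h hw hB hg hs hq.1 (hq.2.trans hrT) K]
    rfl
  -- `regularB` is approximated by `Ξ` with the better exponent `1 + 2β`.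
  have hdel : ∀ a b : ℝ, s ≤ a → a ≤ b → b ≤ T →
      ‖hatDelta S (fun r => regularB S N g r s E K) b a -
        xiB S N w (regularArea N w g) E K s b a‖ ≤
      (M * (‖E‖ * O * B) + processCConst M 1 * (‖E‖ * κ * (B * B + B * B)) * T ^ (1 - 2 * β)) *
        (b - a) ^ (1 + 2 * β) := by
    intro a b hsa hab hb
    have ha := hs.trans hsa
    have hba : 0 ≤ b - a := by linarith
    have hFab := hF a b hsa hab hb
    have hc : BddMeasurableOn a b (‖contract N E (omegaS S w a s K)‖ * B)
        fun r => contract N E (omegaS S w a s K) (g r) :=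
      (hg.mono ha hb).clm_apply (A := fun _ => contract N E (omegaS S w a s K))
        continuousOn_const fun _ _ => le_rfl
    have e1 : hatDelta S (fun r => regularB S N g r s E K) b a -
        xiB S N w (regularArea N w g) E K s b a =
        conv S b a (fun r => contract N E (omegaS S w r s K - omegaS S w a s K) (g r)) -
        processC S N w (regularArea N w g) b a E K := by
      rw [hatDelta, hreg b (hsa.trans hab) hb, hreg a hsa (hab.trans hb),
        conv_split h (hF0.mono le_rfl hb) hsa hab, add_sub_cancel_right, xiB,
        omegaS_eq_conv h hw hB hg ha hab hb, ← sub_sub,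
        ← conv_sub h (hF0.mono hsa hb) hc hab]
      simp only [contract_sub, sub_apply]
    have b1 := norm_conv_le h hFab hab
    have b2 := norm_processC_le h one_pos hT hR1 E hκ hK.norm_le ha hab hb
    have p1 : (b - a) ^ (1 + 2 * β) = (b - a) ^ (2 * β) * (b - a) := by
      rw [add_comm, Real.rpow_add_one' hba (by positivity)]
    have p2 : (b - a) ^ ((2 : ℝ) * 1) ≤ T ^ (1 - 2 * β) * (b - a) ^ (1 + 2 * β) := by
      have := rpow_le_rpow_sub_mul (T := T) (x := b - a) (a := 1 + 2 * β) (b := 2 * 1)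
        (by linarith) (by linarith) hba (by linarith)
      rwa [show 2 * 1 - (1 + 2 * β) = 1 - 2 * β by ring] at this
    rw [e1]
    calc _ ≤ _ := (norm_sub_le _ _).trans (add_le_add b1 b2)
      _ ≤ M * (‖E‖ * (O * (b - a) ^ (2 * β)) * B) * (b - a) +
          processCConst M 1 * (‖E‖ * κ * (B * B + B * B)) *
            (T ^ (1 - 2 * β) * (b - a) ^ (1 + 2 * β)) := by gcongr
      _ = _ := by rw [p1]; ring
  have hsew := isSewing_xiB h hβ hβ2 hβα hρ hT hR E hK hsT
  rw [processB_eq_sew h hβ hβ2 hβα hρ hT hR E hK hsT]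
  obtain ⟨-, h0, C, hC⟩ := hsew
  set A := M * (‖E‖ * O * B) + processCConst M 1 * (‖E‖ * κ * (B * B + B * B)) * T ^ (1 - 2 * β)
  have hA : 0 ≤ A := by positivity
  refine sub_eq_zero.1 (eq_zero_of_hatDelta_le h (z := fun r => regularB S N g r s E K -
    sew S (xiB S N w (regularArea N w g) E K s) s T α (α + 2 * β) r)
    (C := A * T ^ (1 - α) + C) hρ hs ?_ (fun a b hsa hab hb => ?_) hst ht)
  · simp [h0, regularB]
  · have hba : 0 ≤ b - a := by linarith
    have p : (b - a) ^ (1 + 2 * β) ≤ T ^ (1 - α) * (b - a) ^ (α + 2 * β) := by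
      have := rpow_le_rpow_sub_mul (T := T) (x := b - a) (a := α + 2 * β) (b := 1 + 2 * β)
        (by linarith) (by linarith) hba (by linarith)
      rwa [show 1 + 2 * β - (α + 2 * β) = 1 - α by ring] at this
    have e : ∀ y y' : ℝ → W, hatDelta S (fun r => y r - y' r) b a =
        (hatDelta S y b a - xiB S N w (regularArea N w g) E K s b a) -
        (hatDelta S y' b a - xiB S N w (regularArea N w g) E K s b a) := fun y y' => by
      simp only [hatDelta, map_sub]; abel
    rw [e, add_mul, mul_assoc]
    exact (norm_sub_le _ _).trans (add_le_add ((hdel a b hsa hab hb).trans (by gcongr))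
      (hC a b hsa hab hb).2)

end Paths

end Regular

/-! ### The process `a` and the algebraic relation -/

section ProcessA

variable {V : Type v} {W : Type u} [NormedAddCommGroup V] [NormedSpace ℝ V]
  [NormedAddCommGroup W] [NormedSpace ℝ W]
  {N : TensorNorms V W} {T α L β γ κ B : ℝ} {ω : ℝ → V} {s τ u t : ℝ}
  {S D : ℝ → W →L[ℝ] W} {M : ℝ}

theorem intervalIntegrable_rpow_sub (hγ : 0 < γ) :
    IntervalIntegrable (fun r : ℝ => (r - s) ^ (γ - 1)) volume s t := by
  have := (intervalIntegral.intervalIntegrable_rpow' (a := 0) (b := t - s) (r := γ - 1)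
    (by linarith)).comp_sub_right s
  simpa using this

theorem integral_rpow_sub (hγ : 0 < γ) :
    ∫ r in s..t, (r - s) ^ (γ - 1) = (t - s) ^ γ / γ := by
  rw [intervalIntegral.integral_comp_sub_right (fun r => r ^ (γ - 1)) s,
    integral_rpow (Or.inl (by linarith)), sub_self, sub_add_cancel, Real.zero_rpow hγ.ne', sub_zero]

variable (h : SmoothingPair S D M)
include h

/-- `K ↦ ω^S_{tr}(K)` is a bounded operator, depending continuously on `r` in operator norm. -/
theorem exists_omegaS_clm [CompleteSpace W] (hω : HolderPath T α L ω) (hα : 0 < α) (hT : 0 < T)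
    (ht : t ≤ T) :
    ∃ Λ : ℝ → (V →L[ℝ] W) →L[ℝ] W, (∀ r ∈ Icc 0 t, ∀ K, Λ r K = omegaS S ω t r K) ∧
      ContinuousOn Λ (Icc 0 t) := by
  have hM := h.pos.le
  have hL := hω.nonneg hT
  have hex : ∀ r ∈ Icc 0 t, ∃ A : (V →L[ℝ] W) →L[ℝ] W, ∀ K, A K = omegaS S ω t r K := by
    intro r hr
    let A : (V →L[ℝ] W) →ₗ[ℝ] W :=
      { toFun := omegaS S ω t r
        map_add' := omegaS_add h hω hα hr.1 hr.2 ht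
        map_smul' := fun c K => by
          have h1 := omegaS_smul_add h hω hα hr.1 hr.2 ht c K 0
          have h2 : omegaS S ω t r (0 : V →L[ℝ] W) = 0 := by simp [omegaS, gen_zero]
          simpa [h2] using h1 }
    refine ⟨A.mkContinuous (M * (1 + 1 / α) * L * (t - r) ^ α) fun K => ?_, fun K => rfl⟩
    exact (norm_omegaS_le h hω hα hr.1 hr.2 ht K).trans (le_of_eq (by ring))
  choose! Λ hΛ using hex
  suffices hc : ∀ r r' : ℝ, 0 ≤ r → r ≤ r' → r' ≤ t →
      ‖Λ r' - Λ r‖ ≤ M * (M * (1 + 1 / α) * L) * (r' - r) ^ α by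
    refine ⟨Λ, hΛ, ?_⟩
    have := continuousOn_of_forall_le (X := (V →L[ℝ] W) →L[ℝ] W) (f := Λ) hα hc
    exact this
  intro r r' hr hrr' hr't
  have hp : 0 ≤ (r' - r) ^ α := Real.rpow_nonneg (by linarith) _
  refine ContinuousLinearMap.opNorm_le_bound _ (by positivity) fun K => ?_
  rw [sub_apply, hΛ r' ⟨hr.trans hrr', hr't⟩, hΛ r ⟨hr, hrr'.trans hr't⟩,
    omegaS_split h hω hα hr hrr' hr't ht, sub_add_cancel_left, norm_neg]
  refine (h.norm_S_apply_le (by linarith) _).trans ?_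
  calc _ ≤ M * (M * (1 + 1 / α) * L * ‖K‖ * (r' - r) ^ α) := by
        gcongr; exact norm_omegaS_le h hω hα hr hrr' (hr't.trans ht) K
    _ = _ := by ring

/-- The integrand of the second term of `a`, for a vector `x` whose orbit has an integrable
singularity. -/
theorem processA_integrand_le (hω : HolderPath T α L ω) (hα : 0 < α) (hT : 0 < T)
    {x : W} (hx : ∀ σ : ℝ, 0 < σ → ‖D σ x‖ ≤ B * σ ^ (γ - 1)) (E : N.WV →L[ℝ] W) (hτ : 0 ≤ τ)
    (ht : t ≤ T) {r : ℝ} (hr : r ∈ Ioo τ t) :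
    ‖omegaS S ω t r (contract N E (D (r - τ) x))‖ ≤
      M * (1 + 1 / α) * L * (‖E‖ * (B * (r - τ) ^ (γ - 1))) * (t - r) ^ α := by
  have hM := h.pos.le
  have hL := hω.nonneg hT
  refine (norm_omegaS_le h hω hα (hτ.trans hr.1.le) hr.2.le ht _).trans ?_
  have : 0 ≤ (t - r) ^ α := Real.rpow_nonneg (by linarith [hr.2]) _
  gcongr
  refine (norm_contract_le _ _).trans ?_
  gcongr
  exact hx _ (by linarith [hr.1])

theorem processA_intervalIntegrable [CompleteSpace W] (hω : HolderPath T α L ω) (hα : 0 < α)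
    (hγ : 0 < γ) (hT : 0 < T) {x : W} (hx : ∀ σ : ℝ, 0 < σ → ‖D σ x‖ ≤ B * σ ^ (γ - 1))
    (E : N.WV →L[ℝ] W) (hτ : 0 ≤ τ) (hτt : τ ≤ t) (ht : t ≤ T) :
    IntervalIntegrable (fun r => omegaS S ω t r (contract N E (D (r - τ) x))) volume τ t := by
  have hM := h.pos.le
  have hL := hω.nonneg hT
  have hB : 0 ≤ B := by simpa using (norm_nonneg _).trans (hx 1 one_pos)
  obtain ⟨Λ, hΛ, hΛc⟩ := exists_omegaS_clm h hω hα hT ht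
  refine intervalIntegrable_of_norm_le hτt ?_
    ((intervalIntegrable_rpow_sub hγ).const_mul (M * (1 + 1 / α) * L * (‖E‖ * B) * (t - τ) ^ α))
    fun r hr => (processA_integrand_le h hω hα hT hx E hτ ht hr).trans ?_
  · have hc : ContinuousOn (fun r => Λ r (contract N E (D (r - τ) x))) (Ioo τ t) := by
      refine (hΛc.mono fun r hr => ⟨hτ.trans hr.1.le, hr.2.le⟩).clm_apply ?_
      refine continuousOn_const.clm_comp (N.tmulWV.continuous.comp_continuousOn ?_)
      refine ContinuousOn.clm_apply ?_ continuousOn_const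
      exact h.continuousOn_D.comp (by fun_prop) fun r hr => sub_pos.2 hr.1
    exact hc.congr fun r hr => (hΛ r ⟨hτ.trans hr.1.le, hr.2.le⟩ _).symm
  · have h1 : 0 ≤ r - τ := by linarith [hr.1]
    have h2 : 0 ≤ t - r := by linarith [hr.2]
    calc _ ≤ M * (1 + 1 / α) * L * (‖E‖ * (B * (r - τ) ^ (γ - 1))) * (t - τ) ^ α := by
          gcongr; exact hr.1.le
      _ = _ := by ring

/-- For regular `x` the improper integral in `a` is absolutely convergent. -/
theorem processA_eq [CompleteSpace W] (hω : HolderPath T α L ω) (hα : 0 < α) (hγ : 0 < γ)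
    (hT : 0 < T) {x : W} (hx : ∀ σ : ℝ, 0 < σ → ‖D σ x‖ ≤ B * σ ^ (γ - 1)) (E : N.WV →L[ℝ] W)
    (hτ : 0 ≤ τ) (hτt : τ ≤ t) (ht : t ≤ T) :
    processA S N ω t τ E x = omegaS S ω t τ (contract N E x) +
      ∫ r in τ..t, omegaS S ω t r (contract N E (D (r - τ) x)) := by
  rw [processA]
  congr 1
  refine Tendsto.limUnder_eq ?_
  rcases hτt.eq_or_lt with rfl | hlt
  · rw [intervalIntegral.integral_same]
    refine tendsto_const_nhds.congr' ?_
    filter_upwards [self_mem_nhdsWithin] with ε hε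
    have hε' : (0 : ℝ) < ε := hε
    rw [Ioc_eq_empty (by linarith), Measure.restrict_empty, integral_zero_measure]
  have hint := processA_intervalIntegrable h hω hα hγ hT hx E hτ hτt ht
  have hint' : IntegrableOn (fun r => omegaS S ω t r (contract N E (D (r - τ) x))) (uIcc τ t) := by
    rwa [uIcc_of_le hτt, ← intervalIntegrable_iff_integrableOn_Icc_of_le hτt]
  have hc := intervalIntegral.continuousOn_primitive_interval_left hint' τ left_mem_uIcc
  rw [uIcc_of_le hτt] at hc
  have hadd : Tendsto (fun ε : ℝ => τ + ε) (𝓝[>] 0) (𝓝[Icc τ t] τ) := by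
    refine tendsto_nhdsWithin_iff.2 ⟨?_, ?_⟩
    · have : Tendsto (fun ε : ℝ => τ + ε) (𝓝 0) (𝓝 (τ + 0)) :=
        (continuous_const.add continuous_id).tendsto 0
      rw [add_zero] at this
      exact this.mono_left nhdsWithin_le_nhds
    · filter_upwards [Ioc_mem_nhdsGT (sub_pos.2 hlt)] with ε hε
      exact ⟨by linarith [hε.1], by linarith [hε.2]⟩
  refine (hc.tendsto.comp hadd).congr' ?_
  filter_upwards [Ioc_mem_nhdsGT (sub_pos.2 hlt)] with ε hε
  have hε1 := hε.1
  simp only [Function.comp_apply]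
  rw [intervalIntegral.integral_of_le (by linarith [hε.2])]
  refine setIntegral_congr_fun measurableSet_Ioc fun r hr => ?_
  simp only [h.gen_eq (show 0 < r - τ by linarith [hr.1])]

theorem integral_D_eq [CompleteSpace W] (hγ : 0 < γ) {x : W}
    (hx : ∀ σ : ℝ, 0 < σ → ‖D σ x‖ ≤ B * σ ^ (γ - 1)) (hτu : τ ≤ u) :
    IntervalIntegrable (fun r => D (r - τ) x) volume τ u ∧
      ∫ r in τ..u, D (r - τ) x = S (u - τ) x - x := by
  have hint : IntervalIntegrable (fun r => D (r - τ) x) volume τ u := by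
    refine intervalIntegrable_of_norm_le hτu ?_ ((intervalIntegrable_rpow_sub hγ).const_mul B)
      fun r hr => hx _ (sub_pos.2 hr.1)
    refine ContinuousOn.clm_apply ?_ continuousOn_const
    exact h.continuousOn_D.comp (by fun_prop) fun r hr => sub_pos.2 hr.1
  refine ⟨hint, ?_⟩
  have := intervalIntegral.integral_eq_sub_of_hasDerivAt_of_le hτu (f := fun r => S (r - τ) x)
    (f' := fun r => D (r - τ) x) ?_ (fun r hr => ?_) hint
  · simpa [h.S_zero_apply] using this
  · exact (h.strong_cont x).comp (by fun_prop) fun r hr => sub_nonneg.2 hr.1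
  · have h1 : HasDerivAt (fun q => S q x) (D (r - τ) x) (r - τ) :=
      h.hasDerivAt_apply (sub_pos.2 hr.1) x
    exact h1.comp_sub_const r τ

/-- `(δ̂ a_{·τ})_{tu}` is `ω^S_{tu}(E S(u-τ)x)` up to the convolution over `[u,t]`. -/
theorem hatDelta_processA [CompleteSpace W] (hω : HolderPath T α L ω) (hα : 0 < α) (hγ : 0 < γ)
    (hT : 0 < T) {x : W} (hx : ∀ σ : ℝ, 0 < σ → ‖D σ x‖ ≤ B * σ ^ (γ - 1)) (E : N.WV →L[ℝ] W)
    (hτ : 0 ≤ τ) (hτu : τ ≤ u) (hut : u ≤ t) (ht : t ≤ T) :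
    hatDelta S (fun r => processA S N ω r τ E x) t u = omegaS S ω t u (contract N E (S (u - τ) x)) +
      ∫ r in u..t, omegaS S ω t r (contract N E (D (r - τ) x)) := by
  have hu := hτ.trans hτu
  have huT := hut.trans ht
  have i0 := processA_intervalIntegrable h hω hα hγ hT hx E hτ (hτu.trans hut) ht
  have i1 : IntervalIntegrable (fun r => omegaS S ω t r (contract N E (D (r - τ) x))) volume τ u :=
    i0.mono_set (by rw [uIcc_of_le hτu, uIcc_of_le (hτu.trans hut)]; exact Icc_subset_Icc_right hut)
  have i2 : IntervalIntegrable (fun r => omegaS S ω t r (contract N E (D (r - τ) x))) volume u t :=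
    i0.mono_set (by rw [uIcc_of_le hut, uIcc_of_le (hτu.trans hut)]; exact Icc_subset_Icc_left hτu)
  have i3 := processA_intervalIntegrable h hω hα hγ hT hx E hτ hτu huT
  obtain ⟨Λ, hΛ, -⟩ := exists_omegaS_clm h hω hα hT ht
  have hΛu := hΛ u ⟨hu, hut⟩
  obtain ⟨hD, hDeq⟩ := integral_D_eq h (τ := τ) hγ hx hτu
  let A : W →L[ℝ] W := Λ u ∘L (ContinuousLinearMap.compL ℝ V N.WV W E) ∘L N.tmulWV
  have hA : ∀ y, A y = omegaS S ω t u (contract N E y) := fun y => hΛu _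
  have i4 : IntervalIntegrable (fun r => A (D (r - τ) x)) volume τ u := by
    rw [intervalIntegrable_iff] at hD ⊢
    exact A.integrable_comp hD
  have i5 : IntervalIntegrable (fun r => S (t - u) (omegaS S ω u r (contract N E (D (r - τ) x))))
      volume τ u := by
    rw [intervalIntegrable_iff] at i3 ⊢
    exact (S (t - u)).integrable_comp i3
  have e1 : ∫ r in τ..u, omegaS S ω t r (contract N E (D (r - τ) x)) =
      A (S (u - τ) x - x) + S (t - u) (∫ r in τ..u, omegaS S ω u r (contract N E (D (r - τ) x))) := by
    rw [← hDeq, ← ContinuousLinearMap.intervalIntegral_comp_comm _ hD,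
      ← ContinuousLinearMap.intervalIntegral_comp_comm _ i3, ← intervalIntegral.integral_add i4 i5]
    refine intervalIntegral.integral_congr fun r hr => ?_
    rw [uIcc_of_le hτu] at hr
    simp only [hA]
    exact omegaS_split h hω hα (hτ.trans hr.1) hr.2 hut ht _
  rw [hatDelta, processA_eq h hω hα hγ hT hx E hτ (hτu.trans hut) ht,
    processA_eq h hω hα hγ hT hx E hτ hτu huT,
    ← intervalIntegral.integral_add_adjacent_intervals i1 i2, e1,
    omegaS_split h hω hα hτ hτu hut ht, map_sub, hA, hA, map_add]
  abel

/-- With `γ = 2β` the convolution over `[u,t]` in the increments of `a` is of the order `α + 2β` of the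
sewing lemma. -/
theorem norm_processA_tail_le (hω : HolderPath T α L ω) (hα : 0 < α)
    (hγ : 0 < γ) (hγ1 : γ ≤ 1) (hT : 0 < T) {x : W}
    (hx : ∀ σ : ℝ, 0 < σ → ‖D σ x‖ ≤ B * σ ^ (γ - 1)) (E : N.WV →L[ℝ] W)
    (hτ : 0 ≤ τ) (hτu : τ ≤ u) (hut : u ≤ t) (ht : t ≤ T) :
    ‖∫ r in u..t, omegaS S ω t r (contract N E (D (r - τ) x))‖ ≤
      M * (1 + 1 / α) * L * (‖E‖ * B) / γ * (t - u) ^ (α + γ) := by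
  have hM := h.pos.le
  have hL := hω.nonneg hT
  have hB : 0 ≤ B := by simpa using (norm_nonneg _).trans (hx 1 one_pos)
  have hpt : ∀ r ∈ Ioo u t, ‖omegaS S ω t r (contract N E (D (r - τ) x))‖ ≤
      M * (1 + 1 / α) * L * (‖E‖ * B) * (t - u) ^ α * (r - u) ^ (γ - 1) := by
    intro r hr
    refine (processA_integrand_le h hω hα hT hx E hτ ht ⟨hτu.trans_lt hr.1, hr.2⟩).trans ?_
    have h1 : 0 < r - u := sub_pos.2 hr.1
    have h2 : 0 ≤ t - r := sub_nonneg.2 hr.2.le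
    have h3 : (r - τ) ^ (γ - 1) ≤ (r - u) ^ (γ - 1) :=
      Real.rpow_le_rpow_of_nonpos h1 (by linarith) (by linarith)
    have h4 : (t - r) ^ α ≤ (t - u) ^ α := Real.rpow_le_rpow h2 (by linarith [hr.1]) hα.le
    calc _ ≤ M * (1 + 1 / α) * L * (‖E‖ * (B * (r - u) ^ (γ - 1))) * (t - u) ^ α := by gcongr
      _ = _ := by ring
  refine (intervalIntegral.norm_integral_le_of_norm_le hut (ae_mem_Ioc_imp hpt)
    ((intervalIntegrable_rpow_sub hγ).const_mul _)).trans (le_of_eq ?_)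
  rw [intervalIntegral.integral_const_mul, integral_rpow_sub hγ]
  have : (t - u) ^ (α + γ) = (t - u) ^ α * (t - u) ^ γ := by
    rcases (sub_nonneg.2 hut).eq_or_lt with h0 | h0
    · rw [← h0, Real.zero_rpow hα.ne', Real.zero_rpow (by linarith), zero_mul]
    · exact Real.rpow_add h0 _ _
  rw [this]
  ring

/-- `(δ̂₂ b)_{tτs}(E,K) = a_{tτ}(E, ω^S_{τs}(K))`: as functions of `t` both sides vanish at `τ` and have
the same increments `δ̂` up to `O((t-u)^{α+2β})`. -/
theorem hatDelta₂_processB [CompleteSpace W] {L₂ : ℝ} {ω₂ : ℝ → ℝ → N.VV} (hβ : 0 < β)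
    (hβ2 : 2 * β ≤ 1) (hβα : β < α) (hρ : 1 < α + 2 * β) (hT : 0 < T)
    (hR : RoughBound N T α L L₂ ω ω₂) (E : N.WV →L[ℝ] W) {K : V →L[ℝ] W} (hK : RegularOp D β κ K)
    (hs : 0 ≤ s) (hsτ : s ≤ τ) (hτt : τ ≤ t) (ht : t ≤ T) :
    hatDelta₂ S (fun t' s' => processB S N T α β ω ω₂ t' s' E K) t τ s =
      processA S N ω t τ E (omegaS S ω τ s K) := by
  have hα := hβ.trans hβα
  have hω := hR.path
  have hL := hω.nonneg hT
  have hτ := hs.trans hsτ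
  have hτT := hτt.trans ht
  have hsT : s ∈ Icc 0 T := ⟨hs, hsτ.trans hτT⟩
  have hτTm : τ ∈ Icc 0 T := ⟨hτ, hτT⟩
  have hx := fun σ hσ => norm_D_omegaS_le h hβ hβ2 hβα hω hL hK hs hsτ hτT (σ := σ) hσ
  set x := omegaS S ω τ s K with hxdef
  set B := (1 + 8 * M / (α - β)) * (κ * L) * (τ - s) ^ (α - β)
  have hγ : 0 < 2 * β := by linarith
  obtain ⟨-, h0, C, hC⟩ := isSewing_xiB h hβ hβ2 hβα hρ hT hR E hK hsT
  obtain ⟨-, h0', C', hC'⟩ := isSewing_xiB h hβ hβ2 hβα hρ hT hR E hK hτTm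
  simp only [hatDelta₂, processB_eq_sew h hβ hβ2 hβα hρ hT hR E hK hsT,
    processB_eq_sew h hβ hβ2 hβα hρ hT hR E hK hτTm]
  set y := sew S (xiB S N ω ω₂ E K s) s T α (α + 2 * β) with hy
  set y' := sew S (xiB S N ω ω₂ E K τ) τ T α (α + 2 * β) with hy'
  refine sub_eq_zero.1 (eq_zero_of_hatDelta_le h (T := T)
    (z := fun r => y r - y' r - S (r - τ) (y τ) - processA S N ω r τ E x)
    (C := C + C' + M * (1 + 1 / α) * L * (‖E‖ * B) / (2 * β)) hρ hτ ?_
    (fun a b hτa hab hb => ?_) hτt ht)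
  · have hA0 : processA S N ω τ τ E x = 0 := by
      rw [processA_eq h hω hα hγ hT hx E hτ le_rfl hτT, omegaS_self h,
        intervalIntegral.integral_same, add_zero]
    simp [hA0, h0', h.S_zero_apply]
  · have ha := hτ.trans hτa
    have e1 : xiB S N ω ω₂ E K s b a - xiB S N ω ω₂ E K τ b a =
        omegaS S ω b a (contract N E (S (a - τ) x)) := by
      rw [xiB, xiB, omegaS_split h hω hα hs hsτ hτa (hab.trans hb), contract_add,
        omegaS_add h hω hα ha hab hb, hxdef]
      abel
    have e2 : S (b - τ) (y τ) = S (b - a) (S (a - τ) (y τ)) := by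
      rw [← h.S_add_apply (by linarith) (by linarith)]; ring_nf
    have e3 : hatDelta S (fun r => y r - y' r - S (r - τ) (y τ) - processA S N ω r τ E x) b a =
        (hatDelta S y b a - xiB S N ω ω₂ E K s b a) -
        (hatDelta S y' b a - xiB S N ω ω₂ E K τ b a) -
        ∫ r in a..b, omegaS S ω b r (contract N E (D (r - τ) x)) := by
      have e4 := hatDelta_processA h hω hα hγ hT hx E hτ hτa hab hb
      rw [← e1, ← sub_eq_iff_eq_add'] at e4
      rw [← e4]
      simp only [hatDelta, map_sub, e2]
      abel
    rw [e3, add_mul, add_mul]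
    exact (norm_sub_le _ _).trans (add_le_add ((norm_sub_le _ _).trans (add_le_add
      (hC a b (hsτ.trans hτa) hab hb).2 (hC' a b hτa hab hb).2))
      (norm_processA_tail_le h hω hα hγ hβ2 hT hx E hτ hτa hab hb))

end ProcessA

/-! ### Rough paths and the space of bounded bilinear processes -/

section Assembly

variable {V : Type v} {W : Type u} [NormedAddCommGroup V] [NormedSpace ℝ V]
  [NormedAddCommGroup W] [NormedSpace ℝ W]

/-- The supremum in the definition of the Hölder norms is finite, hence a bound, as soon as some Hölder
bound holds; this includes `s = t`, where the latter makes `z` vanish. -/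
theorem le_iSup_div_rpow_mul {X : Type*} [NormedAddCommGroup X] {T γ B : ℝ} {z : ℝ → ℝ → X}
    (hγ : 0 < γ) (hB : ∀ s t : ℝ, 0 ≤ s → s ≤ t → t ≤ T → ‖z t s‖ ≤ B * (t - s) ^ γ) {s t : ℝ}
    (hs : 0 ≤ s) (hst : s ≤ t) (ht : t ≤ T) :
    ‖z t s‖ ≤ (⨆ p : {p : ℝ × ℝ // 0 ≤ p.2 ∧ p.2 < p.1 ∧ p.1 ≤ T},
      ‖z p.1.1 p.1.2‖ / (p.1.1 - p.1.2) ^ γ) * (t - s) ^ γ := by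
  rcases hst.eq_or_lt with rfl | hst
  · have := hB s s hs le_rfl ht
    simpa [Real.zero_rpow hγ.ne'] using this
  · rw [← div_le_iff₀ (Real.rpow_pos_of_pos (sub_pos.2 hst) γ)]
    refine le_ciSup (f := fun p : {p : ℝ × ℝ // 0 ≤ p.2 ∧ p.2 < p.1 ∧ p.1 ≤ T} =>
      ‖z p.1.1 p.1.2‖ / (p.1.1 - p.1.2) ^ γ) ⟨B, ?_⟩ ⟨(t, s), hs, hst, ht⟩
    rintro _ ⟨⟨⟨t', s'⟩, h0, h1, h2⟩, rfl⟩
    exact (div_le_iff₀ (Real.rpow_pos_of_pos (sub_pos.2 h1) γ)).2 (hB s' t' h0 h1.le h2)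

theorem IsRoughPath.roughBound {N : TensorNorms V W} {T α : ℝ} {ω : ℝ → V} {ω₂ : ℝ → ℝ → N.VV}
    (hω : IsRoughPath N T α ω ω₂) (hα : 0 < α) :
    RoughBound N T α (holderSeminorm T α ω) (holderNorm₂ T (2 * α) ω₂) ω ω₂ where
  path s t hs hst ht := by
    obtain ⟨B, hB⟩ := hω.holder
    exact le_iSup_div_rpow_mul (z := fun t s => ω t - ω s) hα hB hs hst ht
  area s t hs hst ht := by
    obtain ⟨B, hB⟩ := hω.holder₂
    refine (le_iSup_div_rpow_mul (by linarith) hB hs hst ht).trans ?_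
    rw [holderNorm₂, add_mul]
    exact le_add_of_nonneg_left (mul_nonneg (Real.iSup_nonneg fun _ => norm_nonneg _)
      (Real.rpow_nonneg (sub_nonneg.2 hst) _))
  chen := hω.chen

theorem RoughBound.mono {N : TensorNorms V W} {T α L L' L₂ : ℝ} {ω : ℝ → V} {ω₂ : ℝ → ℝ → N.VV}
    (hR : RoughBound N T α L L₂ ω ω₂) (hL : L ≤ L') : RoughBound N T α L' L₂ ω ω₂ where
  path s t hs hst ht := (hR.path s t hs hst ht).trans
    (mul_le_mul_of_nonneg_right hL (Real.rpow_nonneg (sub_nonneg.2 hst) _))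
  area := hR.area
  chen := hR.chen

variable {N : TensorNorms V W} {T α L L₂ β C₀ : ℝ} {ω : ℝ → V} {ω₂ : ℝ → ℝ → N.VV}
  {S D : ℝ → W →L[ℝ] W} {M : ℝ} (h : SmoothingPair S D M)
include h

theorem isHolderBilinear_processB [CompleteSpace W] (hβ : 0 < β) (hβ2 : 2 * β ≤ 1) (hβα : β < α)
    (hρ : 1 < α + 2 * β) (hα2 : α ≤ 1 / 2) (hT : 0 < T) (hR : RoughBound N T α L L₂ ω ω₂)
    (hreg : ∀ K : V →L[ℝ] W, MapsIntoDomain S β K →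
      RegularOp D β (C₀ * domainOpNorm S β K) K) :
    IsHolderBilinear S N T β (2 * α) (processB S N T α β ω ω₂) := by
  refine ⟨fun s t hs hst ht => ⟨fun E E' K c hK => ?_, fun E K K' c hK hK' => ?_⟩,
    processBConst M T α β * C₀ * (L ^ 2 + L₂), fun s t E K hs hst ht hK => ?_⟩
  · exact processB_smul_add_left h hβ hβ2 hβα hρ hT hR c E E' (hreg K hK) hs hst ht
  · exact processB_smul_add_right h hβ hβ2 hβα hρ hT hR c E (hreg K hK) (hreg K' hK') hs hst ht
  · exact (norm_processB_le h hβ hβ2 hβα hρ hα2 hT hR E (hreg K hK) hs hst ht).trans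
      (le_of_eq (by ring))

/-- The bilinearity and the Hölder bound are inherited from `b` over the iterated integrals of `w`. -/
theorem isHolderBilinear_regularB [CompleteSpace V] [CompleteSpace W] {w g : ℝ → V} (hβ : 0 < β)
    (hβ2 : 2 * β ≤ 1) (hβα : β < α) (hρ : 1 < α + 2 * β) (hα2 : α ≤ 1 / 2) (hT : 0 < T)
    (hw : IsRegularPath T w g)
    (hreg : ∀ K : V →L[ℝ] W, MapsIntoDomain S β K →
      RegularOp D β (C₀ * domainOpNorm S β K) K) :
    IsHolderBilinear S N T β (2 * α) (regularB S N g) := by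
  obtain ⟨B, hB, hg⟩ := hw.exists_bddMeasurableOn
  have hR : RoughBound N T α _ _ w (regularArea N w g) :=
    (hw.roughBound_one hB hg).of_one hT (hβ.trans hβα) (by linarith)
  obtain ⟨h1, Λ, h2⟩ := isHolderBilinear_processB h hβ hβ2 hβα hρ hα2 hT hR hreg
  have e : ∀ {s t : ℝ} (E : N.WV →L[ℝ] W) {κ : ℝ} {K : V →L[ℝ] W}, RegularOp D β κ K → 0 ≤ s →
      s ≤ t → t ≤ T →
      regularB S N g t s E K = processB S N T α β w (regularArea N w g) t s E K :=
    fun E _ _ hK hs hst ht => regularB_eq_processB h hβ hβ2 hβα hρ hα2 hT hw E hK hs hst ht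
  refine ⟨fun s t hs hst ht => ⟨fun E E' K c hK => ?_, fun E K K' c hK hK' => ?_⟩,
    Λ, fun s t E K hs hst ht hK => ?_⟩
  · have hK' := hreg K hK
    rw [e _ hK' hs hst ht, e _ hK' hs hst ht, e _ hK' hs hst ht]
    exact (h1 s t hs hst ht).1 E E' K c hK
  · rw [e _ ((hreg K hK).smul_add (hreg K' hK') c) hs hst ht, e _ (hreg K hK) hs hst ht,
      e _ (hreg K' hK') hs hst ht]
    exact (h1 s t hs hst ht).2 E K K' c hK hK'
  · rw [e _ (hreg K hK) hs hst ht]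
    exact h2 s t E K hs hst ht hK

theorem holderBilinearConverges_regularB [CompleteSpace V] [CompleteSpace W] {wn gn : ℕ → ℝ → V}
    (hβ : 0 < β) (hβ2 : 2 * β ≤ 1) (hβα : β < α) (hρ : 1 < α + 2 * β) (hα2 : α ≤ 1 / 2)
    (hT : 0 < T) (hR : RoughBound N T α L L₂ ω ω₂) (hC₀ : 0 ≤ C₀)
    (hreg : ∀ K : V →L[ℝ] W, MapsIntoDomain S β K →
      RegularOp D β (C₀ * domainOpNorm S β K) K)
    (hw : ∀ n, IsRegularPath T (wn n) (gn n))
    (hconv : RoughConverges N T α wn (fun n => regularArea N (wn n) (gn n)) ω ω₂) :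
    HolderBilinearConverges S N T β (2 * α) (fun n => regularB S N (gn n))
      (processB S N T α β ω ω₂) := by
  intro ε hε
  have hα := hβ.trans hβα
  have hα' : 0 < 2 * α := by linarith
  have hL := hR.path.nonneg hT
  have hX := processBConst_nonneg h.pos.le hT.le hβ hβα hρ
  have hTα : 0 ≤ T ^ (2 * α) := Real.rpow_nonneg hT.le _
  set X := processBConst M T α β * C₀ * (L + 1 + 1) * (1 + T ^ (2 * α)) with hXdef
  have hX0 : 0 ≤ X := by positivity
  -- With `η ≤ 1` the approximating paths share the Hölder constant `L + 1`, and `X η ≤ ε`.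
  set η := min 1 (ε / (X + 1)) with hη
  have hη0 : 0 < η := lt_min one_pos (by positivity)
  have hXη : X * η ≤ ε := by
    calc X * η ≤ X * (ε / (X + 1)) := by gcongr; exact min_le_right _ _
      _ = ε * (X / (X + 1)) := by ring
      _ ≤ ε * 1 := by gcongr; exact div_le_one_of_le₀ (by linarith) (by linarith)
      _ = ε := mul_one ε
  filter_upwards [hconv η hη0] with n hn E K hK
  obtain ⟨B, hB, hg⟩ := (hw n).exists_bddMeasurableOn
  have hRn : RoughBound N T α _ _ (wn n) (regularArea N (wn n) (gn n)) :=
    ((hw n).roughBound_one hB hg).of_one hT hα (by linarith)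
  have hd : HolderPath T α η fun r => wn n r - ω r := by
    intro s t hs hst ht
    rcases hst.eq_or_lt with rfl | hst
    · simp [Real.zero_rpow hα.ne']
    · have := (hn s t hs hst ht).1
      rwa [sub_sub_sub_comm] at this
  have hd₂ : ∀ s t : ℝ, 0 ≤ s → s ≤ t → t ≤ T →
      ‖regularArea N (wn n) (gn n) t s - ω₂ t s‖ ≤ η * (t - s) ^ (2 * α) := by
    intro s t hs hst ht
    rcases hst.eq_or_lt with rfl | hst
    · have h1 := hRn.area s s hs le_rfl ht
      have h2 := hR.area s s hs le_rfl ht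
      simp only [sub_self, Real.zero_rpow hα'.ne', mul_zero, norm_le_zero_iff] at h1 h2
      simp [h1, h2, Real.zero_rpow hα'.ne']
    · exact (hn s t hs hst ht).2
  have hRn' : RoughBound N T α (L + 1) _ (wn n) (regularArea N (wn n) (gn n)) :=
    { path := fun s t hs hst ht => by
        have e : wn n t - wn n s = (ω t - ω s) + ((wn n t - ω t) - (wn n s - ω s)) := by abel
        rw [e, add_mul]
        refine (norm_add_le _ _).trans (add_le_add (hR.path s t hs hst ht)
          ((hd s t hs hst ht).trans (mul_le_mul_of_nonneg_right (min_le_left _ _)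
            (Real.rpow_nonneg (sub_nonneg.2 hst) _))))
      area := hRn.area
      chen := hRn.chen }
  have hK0 := (domainOpNorm_spec hK).1
  have key : ∀ s t : ℝ, 0 ≤ s → s ≤ t → t ≤ T →
      ‖regularB S N (gn n) t s E K - processB S N T α β ω ω₂ t s E K‖ ≤
        processBConst M T α β * C₀ * (L + 1 + 1) * η * ‖E‖ * domainOpNorm S β K *
          (t - s) ^ (2 * α) := by
    intro s t hs hst ht
    rw [regularB_eq_processB h hβ hβ2 hβα hρ hα2 hT (hw n) E (hreg K hK) hs hst ht]
    exact (norm_processB_sub_le h hβ hβ2 hβα hρ hα2 hT hRn' (hR.mono (by linarith)) hd hd₂ E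
      (hreg K hK) hs hst ht).trans (le_of_eq (by ring))
  refine ⟨fun t h0 ht => (key 0 t le_rfl h0 ht).trans ?_,
    fun s t hs hst ht => (key s t hs hst.le ht).trans ?_⟩
  · calc _ ≤ processBConst M T α β * C₀ * (L + 1 + 1) * η * ‖E‖ * domainOpNorm S β K *
          (1 + T ^ (2 * α)) := by
          gcongr
          have : (t - 0) ^ (2 * α) ≤ T ^ (2 * α) :=
            Real.rpow_le_rpow (by linarith) (by linarith) hα'.le
          linarith
      _ = X * η * ‖E‖ * domainOpNorm S β K := by rw [hXdef]; ring
      _ ≤ _ := by gcongr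
  · have : 0 ≤ (t - s) ^ (2 * α) := Real.rpow_nonneg (by linarith) _
    calc _ ≤ X * η * ‖E‖ * domainOpNorm S β K * (t - s) ^ (2 * α) := by
          gcongr
          exact le_mul_of_one_le_right (by positivity) (by linarith)
      _ ≤ _ := by gcongr

end Assembly

end RoughEvolution

theorem mainTheorem5
    {W : Type u} [NormedAddCommGroup W] [NormedSpace ℝ W] [CompleteSpace W]
    [TopologicalSpace.SeparableSpace W]
    (S : ℝ → W →L[ℝ] W) (hS : IsAnalyticSemigroup S) (hexp : IsExpStable S)
    (T : ℝ) (hT : 0 < T) (α β : ℝ) (hα : α ≤ 1 / 2) (hαβ : 1 < α + 2 * β) (hβα : β < α) :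
    ∃ C : ℝ, ∀ (V : Type v) [NormedAddCommGroup V] [InnerProductSpace ℝ V] [CompleteSpace V]
      (N : TensorNorms V W) (ω : ℝ → V) (ω₂ : ℝ → ℝ → N.VV), IsRoughPath N T α ω ω₂ →
      -- the sewing of `Ξ^{(b),s}` exists and is unique, so that `b` is well defined
      (∀ (E : N.WV →L[ℝ] W) (K : V →L[ℝ] W), MapsIntoDomain S β K → ∀ s ∈ Icc (0 : ℝ) T,
        IsSewing S (xiB S N ω ω₂ E K s) s T α (α + 2 * β)
          (sew S (xiB S N ω ω₂ E K s) s T α (α + 2 * β)) ∧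
        ∀ y : ℝ → W, IsSewing S (xiB S N ω ω₂ E K s) s T α (α + 2 * β) y →
          EqOn y (sew S (xiB S N ω ω₂ E K s) s T α (α + 2 * β)) (Icc s T)) ∧
      IsHolderBilinear S N T β (2 * α) (processB S N T α β ω ω₂) ∧
      -- analytic property
      (∀ (E : N.WV →L[ℝ] W) (K : V →L[ℝ] W), MapsIntoDomain S β K →
        ∀ s t : ℝ, 0 ≤ s → s ≤ t → t ≤ T →
        ‖processB S N T α β ω ω₂ t s E K‖ ≤
          C * ‖E‖ * domainOpNorm S β K *
            (holderSeminorm T α ω ^ 2 + holderNorm₂ T (2 * α) ω₂) * (t - s) ^ (2 * α)) ∧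
      -- continuous dependence on the paths of the noise
      (∀ ωn gn : ℕ → ℝ → V, (∀ n, IsRegularPath T (ωn n) (gn n)) →
        RoughConverges N T α ωn (fun n => regularArea N (ωn n) (gn n)) ω ω₂ →
        (∀ n, IsHolderBilinear S N T β (2 * α) (regularB S N (gn n))) ∧
        HolderBilinearConverges S N T β (2 * α) (fun n => regularB S N (gn n))
          (processB S N T α β ω ω₂)) ∧
      -- algebraic property
      (∀ (E : N.WV →L[ℝ] W) (K : V →L[ℝ] W), MapsIntoDomain S β K →
        ∀ s τ t : ℝ, 0 ≤ s → s ≤ τ → τ ≤ t → t ≤ T →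
        hatDelta₂ S (fun t' s' => processB S N T α β ω ω₂ t' s' E K) t τ s =
          processA S N ω t τ E (omegaS S ω τ s K)) := by
  obtain ⟨D, M, h⟩ := exists_smoothingPair hS hexp
  have hβ : 0 < β := by linarith
  have hβ2 : 2 * β ≤ 1 := by linarith
  obtain ⟨C₀, hC₀, hreg⟩ := exists_regularOp.{u, v} h hexp hβ (by linarith)
  refine ⟨processBConst M T α β * C₀, fun V _ _ _ N ω ω₂ hω => ?_⟩
  have hR := hω.roughBound (hβ.trans hβα)
  refine ⟨fun E K hK s hs => ?_, isHolderBilinear_processB h hβ hβ2 hβα hαβ hα hT hR (hreg V),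
    fun E K hK s t hs hst ht => ?_, fun ωn gn hw hconv => ⟨fun n => ?_, ?_⟩,
    fun E K hK s τ t hs hsτ hτt ht => ?_⟩
  · have hy := isSewing_xiB h hβ hβ2 hβα hαβ hT hR E (hreg V K hK) hs
    exact ⟨hy, fun y hy' => hy'.eqOn h hαβ hs.1 hy⟩
  · exact (norm_processB_le h hβ hβ2 hβα hαβ hα hT hR E (hreg V K hK) hs hst ht).trans
      (le_of_eq (by ring))
  · exact isHolderBilinear_regularB h hβ hβ2 hβα hαβ hα hT (hw n) (hreg V)
  · exact holderBilinearConverges_regularB h hβ hβ2 hβα hαβ hα hT hR hC₀ (hreg V) hw hconv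
  · exact hatDelta₂_processB h hβ hβ2 hβα hαβ hT hR E (hreg V K hK) hs hsτ hτt ht
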